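/- Let $X$ be a compact connected Riemann surface without boundary, $q$ a holomorphic quadratic differential on $X$, not identically zero, whose zeros are called singularities, and let $f:X\to X$ be a pseudo-Anosov homeomorphism for $q$ with dilatation $\lambda>1$: $f$ preserves the set of singularities, is differentiable off the singularities, and there $$f^*|\mathrm{Re}\sqrt q|=\lambda\,|\mathrm{Re}\sqrt q|,\qquad f^*|\mathrm{Im}\sqrt q|=\tfrac1\lambda\,|\mathrm{Im}\sqrt q| .$$ Assume that $f$ fixes every singularity and every horizontal and every vertical trajectory of $q$ emanating from a singularity (this holds after replacing a pseudo-Anosov map by a power). A *$q$-rectangular decomposition* is obtained as follows. Choose an initial segment $\widetilde J$ of positive length of a vertical trajectory emanating from a singularity $z_0$. Lead all horizontal trajectories from all singularities until they first hit $\widetilde J$ (at a positive time). Let $J=[z_0,z_1]$ be the smallest initial subsegment of $\widetilde J$ containing all points where the drawn leaves meet $\widetilde J$. Then draw the horizontal leaf from $z_1$ in the direction that has not been drawn yet, until it first meets $J$ again. Let $\Gamma$ be the union of all the drawn horizontal segments. The connected components $R_1,\dots,R_n$ of $X\setminus(\Gamma\cup J)$ are open metric rectangles for $|q|$; let $l_i>0$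 be the (horizontal) length and $h_i>0$ the (vertical) height of $R_i$. Let $A=(a_{ij})$ be the $n\times n$ matrix of non-negative integers in which $a_{ij}$ is the number of times $f(R_i)$ crosses $R_j$, that is, the (finite) number of connected components of $f(R_i)\cap R_j$. Put $\mathbf l=(l_1,\dots,l_n)^\top$ and $\mathbf h=(h_1,\dots,h_n)^\top$. **Proposition.** The leading eigenvalue of $A$ is the dilatation $\lambda$ of $f$, that is, $\lambda$ is an eigenvalue of $A$ and every complex eigenvalue $\mu$ of $A$ satisfies $|\mu|\le\lambda$. The vectors $\mathbf l$ and $\mathbf h$ are eigenvectors (in particular, non-zero) of $A$ and $A^\top$, respectively, with eigenvalue $\lambda$: $$A\mathbf l=\lambda\mathbf l\qquad\text{and}\qquad A^\top\mathbf h=\lambda\mathbf h .$$ -/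

import Mathlib

open Set Complex
open scoped Manifold ContDiff Matrix

/-- A holomorphic quadratic differential on a Riemann surface `X`: in every chart `e` of the atlas
it reads `coeff e z dz²` with `coeff e` holomorphic, and the local expressions transform
by the square of the derivative of the coordinate change. -/
structure QuadraticDifferential (X : Type*) [TopologicalSpace X] [ChartedSpace ℂ X] where
  coeff : OpenPartialHomeomorph X ℂ → ℂ → ℂ
  holomorphic : ∀ e ∈ atlas ℂ X, DifferentiableOn ℂ (coeff e) e.target
  transform : ∀ e ∈ atlas ℂ X, ∀ e' ∈ atlas ℂ X, ∀ z ∈ (e.symm.trans e').source,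
    coeff e z = coeff e' (e' (e.symm z)) * (deriv (fun w => e' (e.symm w)) z) ^ 2

/-- `|Re √w|`; it does not depend on the branch of the square root. -/
noncomputable def absReSqrt (w : ℂ) : ℝ := |(w ^ (1 / 2 : ℂ)).re|

/-- `|Im √w|`; it does not depend on the branch of the square root. -/
noncomputable def absImSqrt (w : ℂ) : ℝ := |(w ^ (1 / 2 : ℂ)).im|

/-- The connected components of a subset of a topological space. -/
def componentsOf {X : Type*} [TopologicalSpace X] (S : Set X) : Set (Set X) :=
  {C | ∃ x ∈ S, C = connectedComponentIn S x}

namespace QuadraticDifferential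

variable {X : Type*} [TopologicalSpace X] [ChartedSpace ℂ X]

/-- `p` is a zero (that is, a singularity) of `q`. -/
def IsZero (q : QuadraticDifferential X) (p : X) : Prop :=
  q.coeff (chartAt ℂ p) (chartAt ℂ p p) = 0

/-- `γ`, restricted to `[0, T)`, is a continuous curve which for `0 < t < T` stays off the zeros
and satisfies `q(γ'(t)) = c`. The initial point `γ 0` may be a zero.
For `c = 1` this is a segment of a horizontal trajectory parametrized by `|q|`-arc length,
for `c = -1` a segment of a vertical one. -/
structure IsTrajectory (q : QuadraticDifferential X) (c : ℂ) (γ : ℝ → X) (T : ℝ) : Prop where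
  pos : 0 < T
  cont : ContinuousOn γ (Ico 0 T)
  regular : ∀ t ∈ Ioo 0 T, ¬ q.IsZero (γ t)
  speed : ∀ t ∈ Ioo 0 T, ∀ e ∈ atlas ℂ X, γ t ∈ e.source →
    ∃ v : ℂ, HasDerivAt (fun s => e (γ s)) v t ∧ q.coeff e (e (γ t)) * v ^ 2 = c

abbrev IsHorizontal (q : QuadraticDifferential X) (γ : ℝ → X) (T : ℝ) : Prop :=
  q.IsTrajectory 1 γ T

abbrev IsVertical (q : QuadraticDifferential X) (γ : ℝ → X) (T : ℝ) : Prop :=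
  q.IsTrajectory (-1) γ T

/-- The homeomorphism `f` is pseudo-Anosov for `q` with dilatation `lam`: it preserves the
zeros of `q`, is differentiable away from them, and there
`f^*|Re √q| = lam |Re √q|` and `f^*|Im √q| = lam⁻¹ |Im √q|`. -/
structure IsPseudoAnosov (q : QuadraticDifferential X) (f : X ≃ₜ X) (lam : ℝ) : Prop where
  nontrivial : ∃ p, ¬ q.IsZero p
  one_lt : 1 < lam
  zero_iff : ∀ p, q.IsZero (f p) ↔ q.IsZero p
  differentiable : ∀ p, ¬ q.IsZero p → ∀ e ∈ atlas ℂ X, ∀ e' ∈ atlas ℂ X,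
    p ∈ e.source → f p ∈ e'.source →
      DifferentiableAt ℝ (fun z => e' (f (e.symm z))) (e p)
  pullback_re : ∀ p, ¬ q.IsZero p → ∀ e ∈ atlas ℂ X, ∀ e' ∈ atlas ℂ X,
    p ∈ e.source → f p ∈ e'.source → ∀ v : ℂ,
      absReSqrt (q.coeff e' (e' (f p)) * (fderiv ℝ (fun z => e' (f (e.symm z))) (e p) v) ^ 2)
        = lam * absReSqrt (q.coeff e (e p) * v ^ 2)
  pullback_im : ∀ p, ¬ q.IsZero p → ∀ e ∈ atlas ℂ X, ∀ e' ∈ atlas ℂ X,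
    p ∈ e.source → f p ∈ e'.source → ∀ v : ℂ,
      absImSqrt (q.coeff e' (e' (f p)) * (fderiv ℝ (fun z => e' (f (e.symm z))) (e p) v) ^ 2)
        = lam⁻¹ * absImSqrt (q.coeff e (e p) * v ^ 2)

/-- `f` fixes every zero of `q` and every horizontal or vertical trajectory emanating from a zero:
a short initial piece of any initial segment of such a trajectory is mapped into that segment. -/
structure FixesCriticalTrajectories (q : QuadraticDifferential X) (f : X ≃ₜ X) : Prop where
  fixes_zero : ∀ p, q.IsZero p → f p = p
  fixes_horizontal : ∀ (γ : ℝ → X) (T : ℝ), q.IsHorizontal γ T → q.IsZero (γ 0) →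
    ∃ ε > 0, ε ≤ T ∧ ∀ t ∈ Ico 0 ε, f (γ t) ∈ γ '' Ico 0 T
  fixes_vertical : ∀ (γ : ℝ → X) (T : ℝ), q.IsVertical γ T → q.IsZero (γ 0) →
    ∃ ε > 0, ε ≤ T ∧ ∀ t ∈ Ico 0 ε, f (γ t) ∈ γ '' Ico 0 T

/-- The union of the horizontal leaves led from all zeros of `q` until they first hit `K`
(at a positive time), end points included. -/
def criticalLeavesUpTo (q : QuadraticDifferential X) (K : Set X) : Set X :=
  {x | ∃ (γ : ℝ → X) (T t : ℝ), q.IsHorizontal γ T ∧ q.IsZero (γ 0) ∧ t ∈ Ico 0 T ∧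
    (∀ s ∈ Ioo 0 t, γ s ∉ K) ∧ x = γ t}

/-- The horizontal leaves issuing from `z` in a direction not yet drawn (not contained in `D`
near `z`), followed until they first hit `K` at a positive time, end points included. -/
def undrawnLeavesUpTo (q : QuadraticDifferential X) (D K : Set X) (z : X) : Set X :=
  {x | ∃ (η : ℝ → X) (T t : ℝ), q.IsHorizontal η T ∧ η 0 = z ∧
    (∃ ε > 0, ∀ s ∈ Ioo 0 ε, s < T → η s ∉ D) ∧ t ∈ Ico 0 T ∧
    (∀ s ∈ Ioo 0 t, η s ∉ K) ∧ x = η t}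

/-- `R` is an open metric rectangle for `|q|`, of horizontal side length `l` and vertical side
length `h`: there is a continuous map `Φ` of the closed rectangle `[0,l] × [0,h]` into `X` which
restricts to a bijection of the open rectangle onto `R` with `Φ^* q = dz²` there. -/
def IsMetricRectangle (q : QuadraticDifferential X) (R : Set X) (l h : ℝ) : Prop :=
  0 < l ∧ 0 < h ∧ ∃ Φ : ℂ → X,
    ContinuousOn Φ (Icc 0 l ×ℂ Icc 0 h) ∧
    InjOn Φ (Ioo 0 l ×ℂ Ioo 0 h) ∧
    Φ '' (Ioo 0 l ×ℂ Ioo 0 h) = R ∧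
    ∀ z ∈ Ioo 0 l ×ℂ Ioo 0 h, ∀ e ∈ atlas ℂ X, Φ z ∈ e.source →
      ∃ w : ℂ, HasDerivAt (fun ζ => e (Φ ζ)) w z ∧ q.coeff e (e (Φ z)) * w ^ 2 = 1

/-- A `q`-rectangular decomposition with `n` numbered rectangles. -/
structure RectangularDecomposition (q : QuadraticDifferential X) (n : ℕ) where
  /-- a vertical leaf emanating from a zero `z₀ = β 0`, defined on `[0, T)` -/
  β : ℝ → X
  T : ℝ
  vertical : q.IsVertical β T
  start_zero : q.IsZero (β 0)
  /-- the length of the initial segment chosen first, `β '' [0, b₀]` -/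
  b₀ : ℝ
  b₀_mem : b₀ ∈ Ioo 0 T
  /-- `β '' [0, b]` is the smallest initial subsegment containing all the points where the
  horizontal leaves led from the zeros meet `β '' [0, b₀]` -/
  b : ℝ
  isLeast : IsLeast {s | s ∈ Icc 0 b₀ ∧
    q.criticalLeavesUpTo (β '' Icc 0 b₀) ∩ β '' Icc 0 b₀ ⊆ β '' Icc 0 s} b
  /-- the rectangles: the components of the complement of the drawn segments, each listed once -/
  R : Fin n → Set X
  R_injective : Function.Injective R
  range_R : range R = componentsOf
    (β '' Icc 0 b ∪ (q.criticalLeavesUpTo (β '' Icc 0 b₀) ∪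
      q.undrawnLeavesUpTo (q.criticalLeavesUpTo (β '' Icc 0 b₀)) (β '' Icc 0 b) (β b)))ᶜ
  /-- the lengths and the heights of the rectangles -/
  l : Fin n → ℝ
  h : Fin n → ℝ
  isRectangle : ∀ i, q.IsMetricRectangle (R i) (l i) (h i)

namespace RectangularDecomposition

variable {q : QuadraticDifferential X} {n : ℕ}

/-- The crossings of `R_j` by `f(R_i)`: the connected components of `f(R_i) ∩ R_j`. -/
def crossings (D : RectangularDecomposition q n) (f : X ≃ₜ X) (i j : Fin n) : Set (Set X) :=
  componentsOf (f '' D.R i ∩ D.R j)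

/-- The matrix whose `(i, j)` entry is the number of times `f(R_i)` crosses `R_j`. -/
noncomputable def crossingMatrix (D : RectangularDecomposition q n) (f : X ≃ₜ X) :
    Matrix (Fin n) (Fin n) ℕ :=
  Matrix.of fun i j => (D.crossings f i j).ncard

end RectangularDecomposition

end QuadraticDifferential

/-- `r` is the leading eigenvalue of `A`: an eigenvalue of largest modulus among all
complex eigenvalues. -/
def IsLeadingEigenvalue {n : ℕ} (A : Matrix (Fin n) (Fin n) ℂ) (r : ℝ) : Prop :=
  Module.End.HasEigenvalue (Matrix.toLin' A) (r : ℂ) ∧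
    ∀ μ : ℂ, Module.End.HasEigenvalue (Matrix.toLin' A) μ → ‖μ‖ ≤ r

open Filter Topology

/-! In flat coordinates, where q = dz², `f` is locally affine with linear part diag(±λ, ±1/λ). Since
`f` fixes the leaves emanating from the zeros, it rescales each of them by λ or 1/λ, whence f(J) ⊆ J
and f⁻¹(Γ) ⊆ Γ (`map_verticalSegment`, `symm_horizontalSegments`). This is a Markov property: f(R_i)
neither ends inside R_j in the horizontal direction nor crosses a horizontal side of R_j. So each
component of f(R_i) ∩ R_j is the image of a full-height vertical strip of R_i of width l_j/λ, and is
a full-length horizontal strip of R_j of height h_i/λ (`exists_strips`).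

For fixed i the vertical strips are disjoint and cover R_i up to f⁻¹(J); comparing lengths on a
horizontal line gives λ l_i = Σ_j a_ij l_j. For fixed j, comparing heights gives λ h_j = Σ_i a_ij
h_i. As `l` is a positive eigenvector of a non-negative matrix, measuring other eigenvectors against
it bounds their eigenvalues by λ.

Two devices carry the argument. Near a zero the square of the primitive of √q is holomorphic and
equals c t² along every trajectory q(γ') = c leaving the zero (`exists_clock`). This clock shows
that `f` rescales time on such trajectories, that vertical ones are simple, and that only finitely
many horizontal ones exist. The second device is countability: in a flat chart a horizontal leaf has
countably many ordinates and a vertical leaf countably many abscissas, whereas a crossing that is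
not full would produce an open interval of them. Hence it need not be known which side of a
rectangle lies in J and which in Γ. -/

/-! ### Calculus: derivatives of constant absolute value and diagonal affine maps. -/

theorem absReSqrt_sq (w : ℂ) : absReSqrt (w ^ 2) = |w.re| := by
  have h : ((w ^ 2) ^ (1 / 2 : ℂ)) ^ 2 = w ^ 2 := by
    rw [← Complex.cpow_nat_mul]; norm_num
  unfold absReSqrt
  rcases sq_eq_sq_iff_eq_or_eq_neg.1 h with h | h
  · rw [h]
  · rw [h]; simp

theorem absImSqrt_sq (w : ℂ) : absImSqrt (w ^ 2) = |w.im| := by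
  have h : ((w ^ 2) ^ (1 / 2 : ℂ)) ^ 2 = w ^ 2 := by
    rw [← Complex.cpow_nat_mul]; norm_num
  unfold absImSqrt
  rcases sq_eq_sq_iff_eq_or_eq_neg.1 h with h | h
  · rw [h]
  · rw [h]; simp

/-- A function on an interval whose derivative has constant absolute value is affine. -/
theorem exists_slope_of_abs_deriv_eq {I : Set ℝ} (hI : Convex ℝ I) {φ φ' : ℝ → ℝ} {c : ℝ}
    (h : ∀ t ∈ I, HasDerivAt φ (φ' t) t) (hφ' : ∀ t ∈ I, |φ' t| = c) :
    ∃ a, |a| = |c| ∧ ∀ s ∈ I, ∀ t ∈ I, φ t - φ s = a * (t - s) := by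
  have key : ∀ a : ℝ, (∀ t ∈ I, φ' t = a) → ∀ s ∈ I, ∀ t ∈ I, φ t - φ s = a * (t - s) := by
    intro a ha s hs t ht
    have h1 : ∀ x ∈ I, HasDerivWithinAt (fun x => φ x - a * x) 0 I x := fun x hx => by
      have := ((h x hx).sub ((hasDerivAt_id x).const_mul a)).hasDerivWithinAt (s := I)
      rw [ha x hx, mul_one, sub_self] at this
      exact this
    have := hI.norm_image_sub_le_of_norm_hasDerivWithin_le (C := 0) h1 (by simp) hs ht
    rw [zero_mul, norm_le_zero_iff] at this
    linarith
  rcases eq_or_ne c 0 with rfl | hc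
  · exact ⟨0, by simp, key 0 fun t ht => abs_eq_zero.1 (hφ' t ht)⟩
  · have hne : ∀ t ∈ I, φ' t ≠ 0 := fun t ht h0 => hc (by rw [← hφ' t ht, h0, abs_zero])
    -- Darboux: a derivative without zeros on an interval has constant sign, so no continuity of
    -- `φ'` is needed.
    rcases hasDerivWithinAt_forall_lt_or_forall_gt_of_forall_ne hI
      (fun t ht => (h t ht).hasDerivWithinAt) hne with h1 | h1
    · refine ⟨-c, abs_neg c, key _ fun t ht => ?_⟩
      rw [← hφ' t ht, abs_of_neg (h1 t ht), neg_neg]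
    · refine ⟨c, rfl, key _ fun t ht => ?_⟩
      rw [← hφ' t ht, abs_of_pos (h1 t ht)]

/-- A complex curve whose velocity has constant square is affine. -/
theorem exists_velocity_of_sq_deriv_eq {I : Set ℝ} (hI : Convex ℝ I) {σ v : ℝ → ℂ} {c : ℂ}
    (h : ∀ t ∈ I, HasDerivAt σ (v t) t) (hv : ∀ t ∈ I, v t ^ 2 = c) :
    ∃ w : ℂ, w ^ 2 = c ∧ ∀ s ∈ I, ∀ t ∈ I, σ t - σ s = (t - s : ℝ) * w := by
  obtain ⟨r, hr⟩ : ∃ r : ℂ, r ^ 2 = c := IsAlgClosed.exists_pow_nat_eq c two_pos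
  rcases eq_or_ne r 0 with rfl | hr0
  · refine ⟨0, hr, fun s hs t ht => ?_⟩
    have h0 : ∀ t ∈ I, v t = 0 := fun t ht => by
      have := hv t ht; rw [← hr] at this; simpa using this
    have := hI.norm_image_sub_le_of_norm_hasDerivWithin_le (C := 0)
      (fun x hx => (h x hx).hasDerivWithinAt) (fun x hx => by simp [h0 x hx]) hs ht
    rw [zero_mul, norm_le_zero_iff] at this
    simp [this]
  -- After division by a root of `c` the velocity is ±1: the imaginary part is constant and the real
  -- part has slope of absolute value 1.
  have h1 : ∀ t ∈ I, v t / r = 1 ∨ v t / r = -1 := fun t ht => by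
    rcases sq_eq_sq_iff_eq_or_eq_neg.1 ((hv t ht).trans hr.symm) with e | e
    · left; rw [e, div_self hr0]
    · right; rw [e, neg_div, div_self hr0]
  have hd : ∀ t ∈ I, HasDerivAt (fun t => σ t / r) (v t / r) t := fun t ht => (h t ht).div_const r
  obtain ⟨a, ha, hre⟩ := exists_slope_of_abs_deriv_eq hI (φ := fun t => (σ t / r).re)
    (φ' := fun t => (v t / r).re) (c := 1)
    (fun t ht => (Complex.reCLM.hasFDerivAt.comp_hasDerivAt t (hd t ht)))
    (fun t ht => by rcases h1 t ht with e | e <;> simp [e])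
  obtain ⟨b, hb, him⟩ := exists_slope_of_abs_deriv_eq hI (φ := fun t => (σ t / r).im)
    (φ' := fun t => (v t / r).im) (c := 0)
    (fun t ht => (Complex.imCLM.hasFDerivAt.comp_hasDerivAt t (hd t ht)))
    (fun t ht => by rcases h1 t ht with e | e <;> simp [e])
  have hb0 : b = 0 := by simpa using hb
  refine ⟨a * r, ?_, fun s hs t ht => ?_⟩
  · have : a ^ 2 = 1 := by rw [← sq_abs, ha]; norm_num
    rw [mul_pow, hr, ← Complex.ofReal_pow, this]; simp
  · have e : σ t / r - σ s / r = (a * (t - s) : ℝ) := by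
      apply Complex.ext
      · simpa using hre s hs t ht
      · have := him s hs t ht
        rw [hb0] at this
        simpa using this
    rw [← sub_div, div_eq_iff hr0] at e
    rw [e]; push_cast; ring

/-- A priori the sign of `u'` relative to `L` may vary from point to point. Restriction to segments
shows that `u` multiplies distances of values of `L` by `μ`, and such a map of a subset of the line
is affine. -/
theorem exists_factor_of_abs_fderiv_eq {U : Set ℂ} (hU : Convex ℝ U) {u : ℂ → ℝ}
    {u' : ℂ → ℂ →L[ℝ] ℝ} {L : ℂ →L[ℝ] ℝ} {μ : ℝ} (hμ : 0 ≤ μ)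
    (h : ∀ z ∈ U, HasFDerivAt u (u' z) z) (hu' : ∀ z ∈ U, ∀ v, |u' z v| = μ * |L v|) :
    ∃ a, |a| = μ ∧ ∀ z ∈ U, ∀ w ∈ U, u z - u w = a * (L z - L w) := by
  have iso : ∀ z ∈ U, ∀ w ∈ U, (u z - u w) ^ 2 = μ ^ 2 * (L z - L w) ^ 2 := by
    intro z hz w hw
    have hmem : ∀ t ∈ Icc (0 : ℝ) 1, w + t • (z - w) ∈ U := fun t ht =>
      hU.add_smul_sub_mem hw hz ht
    obtain ⟨a, ha, hφ⟩ := exists_slope_of_abs_deriv_eq (convex_Icc (0 : ℝ) 1)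
      (φ := fun t => u (w + t • (z - w))) (φ' := fun t => u' (w + t • (z - w)) (z - w))
      (c := μ * |L (z - w)|)
      (fun t ht => by
        refine (h _ (hmem t ht)).comp_hasDerivAt t ?_
        simpa using ((hasDerivAt_id t).smul_const (z - w)).const_add w)
      (fun t ht => hu' _ (hmem t ht) _)
    have := hφ 0 (by simp) 1 (by simp)
    simp only [one_smul, zero_smul, add_zero, add_sub_cancel, sub_zero, mul_one] at this
    rw [this, ← sq_abs, ha, abs_mul, abs_abs, mul_pow, sq_abs, sq_abs, map_sub]
  by_cases hc : ∀ z ∈ U, ∀ w ∈ U, L z - L w = 0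
  · refine ⟨μ, abs_of_nonneg hμ, fun z hz w hw => ?_⟩
    have := iso z hz w hw
    rw [hc z hz w hw] at this ⊢
    simpa using this
  push Not at hc
  obtain ⟨z₀, hz₀, w₀, hw₀, hne⟩ := hc
  set a := (u z₀ - u w₀) / (L z₀ - L w₀) with ha
  have ha1 : u z₀ - u w₀ = a * (L z₀ - L w₀) := by rw [ha]; field_simp
  have ha2 : a ^ 2 = μ ^ 2 := by
    have := iso z₀ hz₀ w₀ hw₀
    rw [ha1, mul_pow] at this
    exact mul_right_cancel₀ (pow_ne_zero 2 hne) this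
  have key : ∀ z ∈ U, u z - u w₀ = a * (L z - L w₀) := by
    intro z hz
    rcases eq_or_ne a 0 with h0 | h0
    · have := iso z hz w₀ hw₀
      rw [← ha2, h0] at this
      rw [h0]
      have : u z - u w₀ = 0 := by simpa using this
      linarith
    -- The squared distances to two distinct points determine a position on the line: the quadratic
    -- terms cancel in the difference.
    have e1 := iso z hz w₀ hw₀
    have e2 := iso z hz z₀ hz₀
    rw [← ha2] at e1 e2
    have : u z - u z₀ = (u z - u w₀) - a * (L z₀ - L w₀) := by rw [← ha1]; ring
    rw [this] at e2
    refine mul_left_cancel₀ (mul_ne_zero h0 hne) ?_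
    linear_combination (e1 - e2) / 2
  refine ⟨a, ?_, fun z hz w hw => ?_⟩
  · rw [← abs_of_nonneg hμ]; exact sq_eq_sq_iff_abs_eq_abs _ _ |>.1 ha2
  · linear_combination key z hz - key w hw

/-- The real-affine map of the plane with diagonal linear part `(a, b)` and translation `c`. -/
def diagAffine (a b : ℝ) (c z : ℂ) : ℂ := ⟨a * z.re + c.re, b * z.im + c.im⟩

@[simp] theorem diagAffine_re (a b : ℝ) (c z : ℂ) : (diagAffine a b c z).re = a * z.re + c.re := rfl
@[simp] theorem diagAffine_im (a b : ℝ) (c z : ℂ) : (diagAffine a b c z).im = b * z.im + c.im := rfl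

theorem continuous_diagAffine (a b : ℝ) (c : ℂ) : Continuous (diagAffine a b c) := by
  have : diagAffine a b c = fun z => ((a * z.re + c.re : ℝ) : ℂ) + ((b * z.im + c.im : ℝ) : ℂ) * I := by
    funext z; apply Complex.ext <;> simp
  rw [this]; fun_prop

/-- Diagonal affine maps which agree near a point agree. -/
theorem diagAffine_injective_of_eventuallyEq {a b a' b' : ℝ} {c c' z : ℂ}
    (h : diagAffine a b c =ᶠ[𝓝 z] diagAffine a' b' c') : a = a' ∧ b = b' ∧ c = c' := by
  obtain ⟨r, hr, hball⟩ := Metric.eventually_nhds_iff.1 h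
  have h0 := hball (y := z) (by simpa using hr)
  have h1 := hball (y := z + (r / 2 : ℝ)) (by
    rw [dist_eq_norm, add_sub_cancel_left, Complex.norm_real, Real.norm_eq_abs, abs_of_pos] <;>
      linarith)
  have h2 := hball (y := z + (r / 2 : ℝ) * I) (by
    rw [dist_eq_norm, add_sub_cancel_left, norm_mul, Complex.norm_real, Real.norm_eq_abs,
      abs_of_pos, norm_I] <;> linarith)
  have r0 := congrArg Complex.re h0
  have i0 := congrArg Complex.im h0
  have r1 := congrArg Complex.re h1
  have i2 := congrArg Complex.im h2
  simp only [diagAffine_re, diagAffine_im, add_re, add_im, ofReal_re, ofReal_im, mul_im,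
    I_re, I_im, mul_zero, mul_one, add_zero] at r0 i0 r1 i2
  have ea : a = a' := by
    have : a * (r / 2) = a' * (r / 2) := by linear_combination r1 - r0
    exact mul_right_cancel₀ (by positivity) this
  have eb : b = b' := by
    have : b * (r / 2) = b' * (r / 2) := by linear_combination i2 - i0
    exact mul_right_cancel₀ (by positivity) this
  subst ea eb
  exact ⟨rfl, rfl, Complex.ext (by linarith) (by linarith)⟩

theorem exists_diagAffine {U : Set ℂ} (hU : Convex ℝ U) (hne : U.Nonempty) {g : ℂ → ℂ}
    {g' : ℂ → ℂ →L[ℝ] ℂ} {μ ν : ℝ} (hμ : 0 ≤ μ) (hν : 0 ≤ ν)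
    (h : ∀ z ∈ U, HasFDerivAt g (g' z) z) (hre : ∀ z ∈ U, ∀ v, |(g' z v).re| = μ * |v.re|)
    (him : ∀ z ∈ U, ∀ v, |(g' z v).im| = ν * |v.im|) :
    ∃ a b c, |a| = μ ∧ |b| = ν ∧ ∀ z ∈ U, g z = diagAffine a b c z := by
  obtain ⟨w, hw⟩ := hne
  obtain ⟨a, ha, h1⟩ := exists_factor_of_abs_fderiv_eq hU (L := reCLM) hμ
    (fun z hz => reCLM.hasFDerivAt.comp z (h z hz)) (fun z hz v => by simpa using hre z hz v)
  obtain ⟨b, hb, h2⟩ := exists_factor_of_abs_fderiv_eq hU (L := imCLM) hν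
    (fun z hz => imCLM.hasFDerivAt.comp z (h z hz)) (fun z hz v => by simpa using him z hz v)
  refine ⟨a, b, ⟨(g w).re - a * w.re, (g w).im - b * w.im⟩, ha, hb, fun z hz => Complex.ext ?_ ?_⟩
  · have := h1 z hz w hw
    simp at this ⊢; linarith
  · have := h2 z hz w hw
    simp at this ⊢; linarith

/-! ### Complex analysis: the square of the primitive of √Q near a zero. -/

/-- Dividing by `f z₀` moves the value at `z₀` to 1, where the principal power is analytic; the
identity for the square holds at every point, even across the cut. -/
theorem AnalyticAt.exists_sqrt {f : ℂ → ℂ} {z₀ : ℂ} (hf : AnalyticAt ℂ f z₀) (h0 : f z₀ ≠ 0) :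
    ∃ s : ℂ → ℂ, AnalyticAt ℂ s z₀ ∧ ∀ z, s z ^ 2 = f z := by
  obtain ⟨a, ha⟩ : ∃ a : ℂ, a ^ 2 = f z₀ := IsAlgClosed.exists_pow_nat_eq _ two_pos
  refine ⟨fun z => a * (f z / f z₀) ^ (1 / 2 : ℂ), ?_, fun z => ?_⟩
  · refine analyticAt_const.mul ((hf.div analyticAt_const h0).cpow analyticAt_const ?_)
    simp [h0]
  · have : ((f z / f z₀) ^ (1 / 2 : ℂ)) ^ 2 = f z / f z₀ := by
      rw [← Complex.cpow_nat_mul]; norm_num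
    rw [mul_pow, this, ha, mul_div_cancel₀ _ h0]

/-- A holomorphic solution of the equation `m h + 2 z h' = 2 g`. -/
theorem exists_solution_euler {g : ℂ → ℂ} {r : ℝ} (hg : DifferentiableOn ℂ g (Metric.ball 0 r))
    {m : ℕ} (hm : 0 < m) : ∃ h h' : ℂ → ℂ, ∀ z ∈ Metric.ball (0 : ℂ) r,
      HasDerivAt h (h' z) z ∧ m * h z + 2 * z * h' z = 2 * g z := by
  -- The solution is z^(-m/2) ∫₀^z u^(m/2-1) g(u) du; substituting u = t² z removes the half-integer
  -- powers and leaves the integral of `F z` over [0, 1].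
  set F : ℂ → ℝ → ℂ := fun z t => 2 * (t : ℂ) ^ (m - 1) * g ((t : ℂ) ^ 2 * z) with hF
  set F' : ℂ → ℝ → ℂ := fun z t => 2 * (t : ℂ) ^ (m + 1) * deriv g ((t : ℂ) ^ 2 * z) with hF'
  have hmem : ∀ {ρ : ℝ} {z : ℂ}, z ∈ Metric.ball (0 : ℂ) ρ → ∀ t ∈ Icc (0 : ℝ) 1,
      (t : ℂ) ^ 2 * z ∈ Metric.ball (0 : ℂ) ρ := by
    intro ρ z hz t ht
    rw [mem_ball_zero_iff] at hz ⊢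
    rw [norm_mul, norm_pow, Complex.norm_real, Real.norm_eq_abs, sq_abs]
    have : t ^ 2 ≤ 1 := pow_le_one₀ ht.1 ht.2
    nlinarith [norm_nonneg z]
  have hgd : DifferentiableOn ℂ (deriv g) (Metric.ball 0 r) := hg.deriv Metric.isOpen_ball
  have hcF : ∀ z ∈ Metric.ball (0 : ℂ) r, ContinuousOn (F z) (uIcc 0 1) := by
    intro z hz
    rw [uIcc_of_le zero_le_one]
    refine ContinuousOn.mul (by fun_prop) (hg.continuousOn.comp (by fun_prop) fun t ht => ?_)
    exact hmem hz t ht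
  have hcF' : ∀ z ∈ Metric.ball (0 : ℂ) r, ContinuousOn (F' z) (uIcc 0 1) := by
    intro z hz
    rw [uIcc_of_le zero_le_one]
    refine ContinuousOn.mul (by fun_prop) (hgd.continuousOn.comp (by fun_prop) fun t ht => ?_)
    exact hmem hz t ht
  have hmeas : ∀ {G : ℝ → ℂ}, ContinuousOn G (uIcc 0 1) → MeasureTheory.AEStronglyMeasurable G
      (MeasureTheory.volume.restrict (Set.uIoc 0 1)) := fun h =>
    (h.mono uIoc_subset_uIcc).aestronglyMeasurable measurableSet_uIoc
  refine ⟨fun z => ∫ t in (0 : ℝ)..1, F z t, fun z => ∫ t in (0 : ℝ)..1, F' z t, fun z hz => ?_⟩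
  obtain ⟨ρ, hzρ, hρr⟩ : ∃ ρ, ‖z‖ < ρ ∧ ρ < r := exists_between (by simpa using hz)
  have hsub : Metric.closedBall (0 : ℂ) ρ ⊆ Metric.ball 0 r := Metric.closedBall_subset_ball hρr
  obtain ⟨M, hM⟩ := (isCompact_closedBall (0 : ℂ) ρ).exists_bound_of_continuousOn
    (hgd.continuousOn.mono hsub)
  have hder := intervalIntegral.hasDerivAt_integral_of_dominated_loc_of_deriv_le
    (μ := MeasureTheory.volume) (F := F) (F' := F') (x₀ := z) (s := Metric.ball 0 ρ)
    (a := 0) (b := 1) (bound := fun _ => 2 * M)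
    (Metric.isOpen_ball.mem_nhds (by simpa using hzρ))
    (by filter_upwards [Metric.isOpen_ball.mem_nhds hz] with w hw using hmeas (hcF w hw))
    (hcF z hz).intervalIntegrable (hmeas (hcF' z hz))
    (.of_forall fun t ht w hw => by
      rw [uIoc_of_le zero_le_one] at ht
      have ht' : t ∈ Icc (0 : ℝ) 1 := Ioc_subset_Icc_self ht
      have h1 := hM _ (Metric.ball_subset_closedBall (hmem hw t ht'))
      have h2 : ‖(2 : ℂ) * (t : ℂ) ^ (m + 1)‖ ≤ 2 := by
        rw [norm_mul, norm_pow, Complex.norm_real, Real.norm_eq_abs, abs_of_nonneg ht'.1]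
        have := pow_le_one₀ (n := m + 1) ht'.1 ht'.2
        simp; linarith
      rw [hF', norm_mul]
      exact mul_le_mul h2 h1 (norm_nonneg _) zero_le_two)
    (by simp)
    (.of_forall fun t ht w hw => by
      rw [uIoc_of_le zero_le_one] at ht
      have h1 : HasDerivAt g _ ((t : ℂ) ^ 2 * w) := (hg.differentiableAt
        (Metric.isOpen_ball.mem_nhds (hsub (Metric.ball_subset_closedBall
          (hmem hw t (Ioc_subset_Icc_self ht)))))).hasDerivAt
      have h2 := (h1.comp w ((hasDerivAt_id w).const_mul ((t : ℂ) ^ 2))).const_mul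
        (2 * (t : ℂ) ^ (m - 1))
      refine h2.congr_deriv ?_
      obtain ⟨m, rfl⟩ := Nat.exists_eq_succ_of_ne_zero hm.ne'
      simp only [hF', Nat.succ_eq_add_one, Nat.add_sub_cancel]; ring)
  refine ⟨hder.2, ?_⟩
  have hI := (hcF z hz).intervalIntegrable (μ := MeasureTheory.volume)
  have hint : IntervalIntegrable (fun t => m * F z t + 2 * z * F' z t) MeasureTheory.volume 0 1 :=
    (hI.const_mul _).add (hder.1.const_mul _)
  -- The integrand m F + 2 z F' is the t-derivative of 2 t^m g(t² z).
  have hft := intervalIntegral.integral_eq_sub_of_hasDerivAt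
    (f := fun t : ℝ => 2 * (t : ℂ) ^ m * g ((t : ℂ) ^ 2 * z)) (fun t ht => ?_) hint
  · rw [intervalIntegral.integral_add (hI.const_mul _) (hder.1.const_mul _),
      intervalIntegral.integral_const_mul, intervalIntegral.integral_const_mul] at hft
    rw [hft]
    simp [hm.ne']
  · rw [uIcc_of_le zero_le_one] at ht
    have h1 : HasDerivAt g _ ((t : ℂ) ^ 2 * z) := (hg.differentiableAt
      (Metric.isOpen_ball.mem_nhds (hmem hz t ht))).hasDerivAt
    have h2 := (((hasDerivAt_pow m (t : ℂ)).const_mul 2).mul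
      (h1.comp (t : ℂ) ((hasDerivAt_pow 2 (t : ℂ)).mul_const z))).comp_ofReal
    refine h2.congr_deriv ?_
    obtain ⟨m, rfl⟩ := Nat.exists_eq_succ_of_ne_zero hm.ne'
    simp only [hF, hF', Nat.succ_eq_add_one, Nat.add_sub_cancel, Function.comp_apply]
    push_cast; ring

/-- Near a zero of `Q`, the square `Ψ` of the primitive of `√Q` is holomorphic. -/
theorem AnalyticAt.exists_sq_primitive_sqrt {Q : ℂ → ℂ} {z₀ : ℂ} (hQ : AnalyticAt ℂ Q z₀)
    (hne : ¬ ∀ᶠ z in 𝓝 z₀, Q z = 0) : ∃ Ψ Ψ' : ℂ → ℂ, ∃ r > 0, ∀ z ∈ Metric.ball z₀ r,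
      HasDerivAt Ψ (Ψ' z) z ∧ Ψ' z ^ 2 = 4 * Q z * Ψ z ∧ (Ψ z = 0 ↔ z = z₀) ∧
      (Q z = 0 → z = z₀) := by
  obtain ⟨k, g, hg, hg0, hQg⟩ := hQ.exists_eventuallyEq_pow_smul_nonzero_iff.2 hne
  obtain ⟨s, hs, hs2⟩ := hg.exists_sqrt hg0
  have hs' : ∀ᶠ w in 𝓝 (0 : ℂ), AnalyticAt ℂ s (z₀ + w) ∧ g (z₀ + w) ≠ 0 ∧
      Q (z₀ + w) = w ^ k * g (z₀ + w) := by
    have ht : Tendsto (fun w => z₀ + w) (𝓝 0) (𝓝 z₀) := by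
      have : Continuous fun w : ℂ => z₀ + w := by fun_prop
      simpa using this.tendsto 0
    filter_upwards [ht.eventually hs.eventually_analyticAt,
      ht.eventually (hg.continuousAt.eventually_ne hg0), ht.eventually hQg] with w h1 h2 h3
    refine ⟨h1, h2, ?_⟩
    rw [h3, add_sub_cancel_left, smul_eq_mul]
  obtain ⟨r, hr, hball⟩ := Metric.eventually_nhds_iff_ball.1 hs'
  -- With w = z - z₀, Q = w^k g and s² = g, the ansatz w^((k+2)/2) h for a primitive of w^(k/2) s
  -- leads to (k+2) h + 2 w h' = 2 s. Its square w^(k+2) h² is single-valued.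
  obtain ⟨h, h', hh⟩ := exists_solution_euler (g := fun w => s (z₀ + w)) (r := r) (m := k + 2)
    (fun w hw => ((hball w hw).1.differentiableAt.comp w (by fun_prop)).differentiableWithinAt)
    (by omega)
  have h00 : h 0 ≠ 0 := fun h0 => by
    have := (hh 0 (by simpa using hr)).2
    rw [h0, mul_zero, mul_zero, zero_mul, zero_add, add_zero, eq_comm] at this
    have hsz : s z₀ = 0 := by simpa using this
    have := hs2 z₀
    rw [hsz] at this
    exact hg0 (by simpa using this.symm)
  obtain ⟨r', hr', hball'⟩ := Metric.eventually_nhds_iff_ball.1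
    ((hh 0 (by simpa using hr)).1.continuousAt.eventually_ne h00)
  refine ⟨fun z => (z - z₀) ^ (k + 2) * h (z - z₀) ^ 2,
    fun z => 2 * (z - z₀) ^ (k + 1) * h (z - z₀) * s z, min r r', lt_min hr hr', fun z hz => ?_⟩
  have hw : z - z₀ ∈ Metric.ball (0 : ℂ) r := by
    simpa [dist_eq_norm] using (lt_of_lt_of_le (Metric.mem_ball.1 hz) (min_le_left _ _))
  have hw' : z - z₀ ∈ Metric.ball (0 : ℂ) r' := by
    simpa [dist_eq_norm] using (lt_of_lt_of_le (Metric.mem_ball.1 hz) (min_le_right _ _))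
  obtain ⟨hd, he⟩ := hh _ hw
  obtain ⟨-, hgz, hQz⟩ := hball _ hw
  rw [add_sub_cancel] at he hgz hQz
  refine ⟨?_, ?_, ?_, fun h0 => ?_⟩
  · have h1 : HasDerivAt (fun z => z - z₀) 1 z := (hasDerivAt_id z).sub_const z₀
    have h2 : HasDerivAt (fun z => h (z - z₀)) (h' (z - z₀)) z := by
      exact (HasDerivAt.comp z hd h1).congr_deriv (mul_one _)
    refine ((h1.pow (k + 2)).mul (h2.pow 2)).congr_deriv ?_
    push_cast at he ⊢
    simp only [Pi.pow_apply]
    linear_combination (z - z₀) ^ (k + 1) * h (z - z₀) * he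
  · rw [hQz, ← hs2]; ring
  · rw [mul_eq_zero, or_iff_left (pow_ne_zero 2 (hball' _ hw')), pow_eq_zero_iff (by omega),
      sub_eq_zero]
  · rw [hQz, mul_eq_zero, or_iff_left hgz] at h0
    exact sub_eq_zero.1 (eq_zero_of_pow_eq_zero h0)

/-! ### Flat coordinates and trajectories. -/

namespace QuadraticDifferential

variable {X : Type*} [TopologicalSpace X] [ChartedSpace ℂ X]

/-- Using the transformation rule in both directions makes it unnecessary to know that coordinate
changes have nonvanishing derivative. -/
theorem isZero_iff (q : QuadraticDifferential X) {p : X} {e : OpenPartialHomeomorph X ℂ}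
    (he : e ∈ atlas ℂ X) (hp : p ∈ e.source) : q.IsZero p ↔ q.coeff e (e p) = 0 := by
  have key : ∀ e₁ ∈ atlas ℂ X, ∀ e₂ ∈ atlas ℂ X, p ∈ e₁.source → p ∈ e₂.source →
      q.coeff e₂ (e₂ p) = 0 → q.coeff e₁ (e₁ p) = 0 := by
    intro e₁ h₁ e₂ h₂ hp₁ hp₂ h
    rw [q.transform e₁ h₁ e₂ h₂ (e₁ p) (by simp [hp₁, hp₂]), e₁.left_inv hp₁, h, zero_mul]
  have hc := chart_mem_atlas ℂ p
  exact ⟨key e he _ hc hp (mem_chart_source ℂ p), key _ hc e he (mem_chart_source ℂ p) hp⟩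

/-- A flat coordinate of `q`: a local homeomorphism `ψ` with `q = dψ²`. -/
def IsFlat (q : QuadraticDifferential X) (ψ : OpenPartialHomeomorph X ℂ) : Prop :=
  ∀ x ∈ ψ.source, ∀ e ∈ atlas ℂ X, x ∈ e.source →
    ∃ w, w ≠ 0 ∧ HasDerivAt (fun z => ψ (e.symm z)) w (e x) ∧ w ^ 2 = q.coeff e (e x)

variable {q : QuadraticDifferential X} {ψ ψ' : OpenPartialHomeomorph X ℂ}

theorem IsFlat.not_isZero (hψ : q.IsFlat ψ) {x : X} (hx : x ∈ ψ.source) : ¬ q.IsZero x := by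
  obtain ⟨w, hw, -, h⟩ := hψ x hx _ (chart_mem_atlas ℂ x) (mem_chart_source ℂ x)
  rw [IsZero, ← h]
  exact pow_ne_zero 2 hw

theorem IsFlat.hasDerivAt_symm (hψ : q.IsFlat ψ) {x : X} (hx : x ∈ ψ.source)
    {e : OpenPartialHomeomorph X ℂ} (he : e ∈ atlas ℂ X) (hxe : x ∈ e.source) :
    ∃ w, w ≠ 0 ∧ HasDerivAt (fun ζ => e (ψ.symm ζ)) w (ψ x) ∧ q.coeff e (e x) * w ^ 2 = 1 := by
  obtain ⟨w, hw, hd, h⟩ := hψ x hx e he hxe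
  refine ⟨w⁻¹, inv_ne_zero hw, ?_, ?_⟩
  · refine (e.symm.trans ψ).hasDerivAt_symm (a := ψ x) ?_ hw ?_
    · simp [hx, hxe]
    · have e1 : (e.symm.trans ψ).symm (ψ x) = e x := by simp [hx]
      rw [e1]; exact hd
  · rw [← h, inv_pow, mul_inv_cancel₀ (pow_ne_zero 2 hw)]

theorem IsTrajectory.continuousAt {c : ℂ} {γ : ℝ → X} {T t : ℝ} (h : q.IsTrajectory c γ T)
    (ht : t ∈ Ioo 0 T) : ContinuousAt γ t :=
  h.cont.continuousAt (Ico_mem_nhds ht.1 ht.2)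

theorem IsTrajectory.hasDerivAt_flat {c : ℂ} {γ : ℝ → X} {T t : ℝ} (h : q.IsTrajectory c γ T)
    (hψ : q.IsFlat ψ) (ht : t ∈ Ioo 0 T) (hx : γ t ∈ ψ.source) :
    ∃ v, HasDerivAt (fun s => ψ (γ s)) v t ∧ v ^ 2 = c := by
  have hc := chart_mem_atlas ℂ (γ t)
  have hs := mem_chart_source ℂ (γ t)
  obtain ⟨v, hv, hq⟩ := h.speed t ht _ hc hs
  obtain ⟨w, -, hw, hw2⟩ := hψ _ hx _ hc hs
  refine ⟨w * v, ?_, by rw [mul_pow, hw2, hq]⟩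
  refine (hw.comp t hv).congr_of_eventuallyEq ?_
  filter_upwards [(h.continuousAt ht).preimage_mem_nhds
    ((chartAt ℂ (γ t)).open_source.mem_nhds hs)] with s hs'
  simp [(chartAt ℂ (γ t)).left_inv hs']

theorem isTrajectory_of_flat {c : ℂ} {γ : ℝ → X} {T : ℝ} (hT : 0 < T)
    (hcont : ContinuousOn γ (Ico 0 T))
    (h : ∀ t ∈ Ioo 0 T, ∃ ψ, q.IsFlat ψ ∧ γ t ∈ ψ.source ∧
      ∃ v, HasDerivAt (fun s => ψ (γ s)) v t ∧ v ^ 2 = c) : q.IsTrajectory c γ T := by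
  refine ⟨hT, hcont, fun t ht => ?_, fun t ht e he hte => ?_⟩
  · obtain ⟨ψ, hψ, hs, -⟩ := h t ht
    exact hψ.not_isZero hs
  · obtain ⟨ψ, hψ, hs, v, hv, hv2⟩ := h t ht
    obtain ⟨w, -, hw, hw2⟩ := hψ.hasDerivAt_symm hs he hte
    refine ⟨w * v, (hw.comp t hv).congr_of_eventuallyEq ?_, ?_⟩
    · filter_upwards [(hcont.continuousAt (Ico_mem_nhds ht.1 ht.2)).preimage_mem_nhds
        (ψ.open_source.mem_nhds hs)] with s hs'
      simp [ψ.left_inv hs']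
    · rw [mul_pow, ← mul_assoc, hw2, one_mul, hv2]

theorem IsTrajectory.mono {c : ℂ} {γ : ℝ → X} {T T' : ℝ} (h : q.IsTrajectory c γ T)
    (hT' : 0 < T') (hle : T' ≤ T) : q.IsTrajectory c γ T' :=
  ⟨hT', h.cont.mono (Ico_subset_Ico_right hle), fun t ht => h.regular t ⟨ht.1, ht.2.trans_le hle⟩,
    fun t ht => h.speed t ⟨ht.1, ht.2.trans_le hle⟩⟩

theorem IsTrajectory.congr {c : ℂ} {γ η : ℝ → X} {T : ℝ} (h : q.IsTrajectory c γ T)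
    (he : EqOn η γ (Ico 0 T)) : q.IsTrajectory c η T := by
  have hev : ∀ t ∈ Ioo 0 T, η =ᶠ[𝓝 t] γ := fun t ht => by
    filter_upwards [Ico_mem_nhds ht.1 ht.2] with s hs using he hs
  refine ⟨h.pos, h.cont.congr he, fun t ht => ?_, fun t ht e hea hte => ?_⟩
  · rw [(hev t ht).eq_of_nhds]; exact h.regular t ht
  · have e1 := (hev t ht).eq_of_nhds
    obtain ⟨v, hv, hq⟩ := h.speed t ht e hea (by rwa [← e1])
    refine ⟨v, hv.congr_of_eventuallyEq ?_, by rw [e1, hq]⟩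
    filter_upwards [hev t ht] with s hs
    rw [hs]

/-- In a flat coordinate a trajectory is a straight line with constant velocity. -/
theorem IsTrajectory.eventually_affine {c : ℂ} {γ : ℝ → X} {T t : ℝ} (h : q.IsTrajectory c γ T)
    (hψ : q.IsFlat ψ) (ht : t ∈ Ioo 0 T) (hx : γ t ∈ ψ.source) :
    ∃ v : ℂ, v ^ 2 = c ∧ ∀ᶠ s in 𝓝 t, γ s ∈ ψ.source ∧ ψ (γ s) = ψ (γ t) + (s - t : ℝ) * v := by
  have hn : γ ⁻¹' ψ.source ∩ Ioo 0 T ∈ 𝓝 t := inter_mem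
    ((h.continuousAt ht).preimage_mem_nhds (ψ.open_source.mem_nhds hx)) (Ioo_mem_nhds ht.1 ht.2)
  obtain ⟨r, hr, hball⟩ := Metric.mem_nhds_iff.1 hn
  have hd : ∀ s ∈ Metric.ball t r, ∃ v, HasDerivAt (fun s => ψ (γ s)) v s ∧ v ^ 2 = c :=
    fun s hs => h.hasDerivAt_flat hψ (hball hs).2 (hball hs).1
  choose! v hv hv2 using hd
  obtain ⟨w, hw, haff⟩ := exists_velocity_of_sq_deriv_eq (convex_ball t r) hv hv2
  refine ⟨w, hw, ?_⟩
  filter_upwards [Metric.ball_mem_nhds t hr] with s hs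
  refine ⟨(hball hs).1, ?_⟩
  rw [← haff t (Metric.mem_ball_self hr) s hs]; ring

section Manifold

variable [IsManifold 𝓘(ℂ) ω X]

theorem differentiableOn_transition {e e' : OpenPartialHomeomorph X ℂ} (he : e ∈ atlas ℂ X)
    (he' : e' ∈ atlas ℂ X) :
    DifferentiableOn ℂ (fun z => e' (e.symm z)) (e.symm.trans e').source := by
  have h := (contDiffGroupoid ω 𝓘(ℂ)).compatible he he'
  rw [contDiffGroupoid, mem_groupoid_of_pregroupoid] at h
  have h1 : ContDiffOn ℂ ω (fun z => e' (e.symm z)) (e.symm.trans e').source := by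
    have := h.1
    simpa [contDiffPregroupoid, Function.comp_def] using this
  exact h1.differentiableOn (by simp)

/-- Off the zeros a primitive of a holomorphic branch of √q has nonzero derivative, so the inverse
function theorem makes it a coordinate. -/
theorem exists_isFlat (q : QuadraticDifferential X) {p : X} (hp : ¬ q.IsZero p) :
    ∃ ψ, q.IsFlat ψ ∧ p ∈ ψ.source := by
  set e := chartAt ℂ p with he
  have hea : e ∈ atlas ℂ X := chart_mem_atlas ℂ p
  have hpe : p ∈ e.source := mem_chart_source ℂ p
  set Q := q.coeff e with hQ
  have hQp : Q (e p) ≠ 0 := hp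
  have hdiff := q.holomorphic e hea
  have han : AnalyticAt ℂ Q (e p) :=
    hdiff.analyticAt (e.open_target.mem_nhds (e.map_source hpe))
  obtain ⟨s, hsan, hs2⟩ := han.exists_sqrt hQp
  obtain ⟨r, hr, hball⟩ := Metric.eventually_nhds_iff_ball.1
    (hsan.eventually_analyticAt.and (han.continuousAt.eventually_ne hQp))
  have hs0 : ∀ z ∈ Metric.ball (e p) r, s z ≠ 0 := fun z hz h0 => by
    have h1 := hs2 z
    rw [h0] at h1
    exact (hball z hz).2 (by simpa using h1.symm)
  have hsd : DifferentiableOn ℂ s (Metric.ball (e p) r) := fun z hz =>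
    (hball z hz).1.differentiableAt.differentiableWithinAt
  obtain ⟨F, hF⟩ := hsd.isExactOn_ball
  have hFs : HasStrictDerivAt F (s (e p)) (e p) := by
    have han : AnalyticAt ℂ F (e p) :=
      (DifferentiableOn.analyticAt (s := Metric.ball (e p) r)
        (fun z hz => (hF z hz).differentiableAt.differentiableWithinAt)
        (Metric.ball_mem_nhds _ hr))
    have := han.hasStrictDerivAt
    rwa [(hF _ (Metric.mem_ball_self hr)).deriv] at this
  have hs00 := hs0 _ (Metric.mem_ball_self hr)
  set F₀ := (hFs.hasStrictFDerivAt_equiv hs00).toOpenPartialHomeomorph F with hF₀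
  set G := F₀.restrOpen (Metric.ball (e p) r) Metric.isOpen_ball with hG
  refine ⟨e.trans G, ?_, ?_⟩
  · intro x hx e' he' hxe'
    have hxs : x ∈ e.source ∧ e x ∈ Metric.ball (e p) r := by
      simp [hG] at hx; simpa using ⟨hx.1, hx.2.2⟩
    have hmem : e' x ∈ (e'.symm.trans e).source := by simp [hxe', hxs.1]
    have hdt : DifferentiableAt ℂ (fun z => e (e'.symm z)) (e' x) :=
      (differentiableOn_transition he' hea).differentiableAt
        ((e'.symm.trans e).open_source.mem_nhds hmem)
    have htr := q.transform e' he' e hea (e' x) hmem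
    rw [e'.left_inv hxe'] at htr
    have hd : HasDerivAt (fun z => (e.trans G) (e'.symm z))
        (s (e x) * deriv (fun z => e (e'.symm z)) (e' x)) (e' x) := by
      have h1 : HasDerivAt F (s (e x)) (e (e'.symm (e' x))) := by
        rw [e'.left_inv hxe']; exact hF _ hxs.2
      exact h1.comp (e' x) hdt.hasDerivAt
    have hsq : (s (e x) * deriv (fun z => e (e'.symm z)) (e' x)) ^ 2 = q.coeff e' (e' x) := by
      rw [mul_pow, hs2, htr]
    refine ⟨_, ?_, hd, hsq⟩
    intro h0
    rw [h0, eq_comm] at hsq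
    have hz := (q.isZero_iff he' hxe').2 (by simpa using hsq)
    have := (q.isZero_iff hea hxs.1).1 hz
    exact hs0 _ hxs.2 (by have h2 := hs2 (e x); rw [hQ, this] at h2; simpa using h2)
  · have : e p ∈ F₀.source := HasStrictFDerivAt.mem_toOpenPartialHomeomorph_source _
    simp [hG, hpe, this, hr]

end Manifold

/-- In charts `Φ` is holomorphic with nonzero derivative on the open rectangle, hence open. Being
injective as well, it has an inverse that is one flat coordinate on all of `R`. -/
theorem IsMetricRectangle.exists_isFlat {R : Set X} {l h : ℝ} {Φ : ℂ → X}
    (hc : ContinuousOn Φ (Icc 0 l ×ℂ Icc 0 h)) (hi : InjOn Φ (Ioo 0 l ×ℂ Ioo 0 h))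
    (him : Φ '' (Ioo 0 l ×ℂ Ioo 0 h) = R)
    (hd : ∀ z ∈ Ioo 0 l ×ℂ Ioo 0 h, ∀ e ∈ atlas ℂ X, Φ z ∈ e.source →
      ∃ w : ℂ, HasDerivAt (fun ζ => e (Φ ζ)) w z ∧ q.coeff e (e (Φ z)) * w ^ 2 = 1) :
    ∃ ψ, q.IsFlat ψ ∧ ψ.source = R ∧ ψ.target = Ioo 0 l ×ℂ Ioo 0 h ∧ ψ.symm = Φ := by
  set S := Ioo 0 l ×ℂ Ioo 0 h with hS
  have hSo : IsOpen S := isOpen_Ioo.reProdIm isOpen_Ioo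
  have hcS : ContinuousOn Φ S := hc.mono (reProdIm_subset_iff'.2 (Or.inl ⟨Ioo_subset_Icc_self,
    Ioo_subset_Icc_self⟩))
  have hwne : ∀ {w b : ℂ}, b * w ^ 2 = 1 → w ≠ 0 := by
    rintro w b h1 rfl; simp at h1
  have hstrict : ∀ z ∈ S, ∀ e ∈ atlas ℂ X, Φ z ∈ e.source →
      ∃ w : ℂ, w ≠ 0 ∧ HasStrictDerivAt (fun ζ => e (Φ ζ)) w z ∧ q.coeff e (e (Φ z)) * w ^ 2 = 1 := by
    intro z hz e he hze
    obtain ⟨w, hw, hq⟩ := hd z hz e he hze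
    refine ⟨w, hwne hq, ?_, hq⟩
    have hn : S ∩ Φ ⁻¹' e.source ∈ 𝓝 z :=
      inter_mem (hSo.mem_nhds hz) ((hcS.continuousAt (hSo.mem_nhds hz)).preimage_mem_nhds
        (e.open_source.mem_nhds hze))
    have han : AnalyticAt ℂ (fun ζ => e (Φ ζ)) z :=
      DifferentiableOn.analyticAt (s := S ∩ Φ ⁻¹' e.source) (fun ζ hζ => by
        obtain ⟨w', hw', -⟩ := hd ζ hζ.1 e he hζ.2
        exact hw'.differentiableAt.differentiableWithinAt) hn
    have := han.hasStrictDerivAt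
    rwa [hw.deriv] at this
  have hopen : IsOpenMap (S.domRestrict Φ) := by
    rw [isOpenMap_iff_nhds_le]
    rintro ⟨z, hz⟩
    set e := chartAt ℂ (Φ z)
    have hze : Φ z ∈ e.source := mem_chart_source ℂ _
    obtain ⟨w, hw0, hw, -⟩ := hstrict z hz e (chart_mem_atlas ℂ _) hze
    have h1 := hw.map_nhds_eq hw0
    have h2 : map (S.domRestrict Φ) (𝓝 ⟨z, hz⟩) = map Φ (𝓝 z) := by
      rw [show S.domRestrict Φ = Φ ∘ Subtype.val from rfl, ← Filter.map_map,
        map_nhds_subtype_coe_eq_nhds hz (hSo.mem_nhds hz)]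
    change 𝓝 (Φ z) ≤ _
    rw [h2, ← e.symm_map_nhds_eq hze, ← h1, Filter.map_map]
    refine le_of_eq (Filter.map_congr ?_)
    filter_upwards [(hcS.continuousAt (hSo.mem_nhds hz)).preimage_mem_nhds
      (e.open_source.mem_nhds hze)] with ζ hζ
    simp [e.left_inv hζ]
  set P := OpenPartialHomeomorph.ofContinuousOpenRestrict (hi.toPartialEquiv Φ S) hcS hopen hSo
  refine ⟨P.symm, ?_, by simpa [P] using him, by simp [P], rfl⟩
  intro x hx e he hxe
  have hx' : x ∈ P.target := hx
  have hzS : P.symm x ∈ S := P.map_target hx'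
  have hxz : Φ (P.symm x) = x := P.right_inv hx'
  obtain ⟨w, hw0, hw, hq⟩ := hstrict _ hzS e he (by rwa [hxz])
  rw [hxz] at hq
  refine ⟨w⁻¹, inv_ne_zero hw0, ?_, ?_⟩
  · refine (P.trans e).hasDerivAt_symm (a := e x) ?_ hw0 ?_
    · simp [hx', hxe]
    · simp only [OpenPartialHomeomorph.trans_symm_eq_symm_trans_symm,
        OpenPartialHomeomorph.coe_trans, Function.comp_apply, e.left_inv hxe]
      exact hw.hasDerivAt
  · rw [inv_pow, inv_eq_iff_eq_inv, eq_inv_of_mul_eq_one_right hq]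

end QuadraticDifferential

/-! ### Pseudo-Anosov maps in flat coordinates. -/

namespace QuadraticDifferential

variable {X : Type*} [TopologicalSpace X] [ChartedSpace ℂ X]
  {q : QuadraticDifferential X} {ψ ψ' : OpenPartialHomeomorph X ℂ}

/-- `f` reads, in flat coordinates, locally as an affine map with linear part
`diag(±μ, ±μ⁻¹)`. -/
structure IsFlatAffine (q : QuadraticDifferential X) (f : X ≃ₜ X) (μ : ℝ) : Prop where
  regular : ∀ p, q.IsZero (f p) ↔ q.IsZero p
  affine : ∀ p ψ ψ', q.IsFlat ψ → q.IsFlat ψ' → p ∈ ψ.source → f p ∈ ψ'.source →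
    ∃ a b c, |a| = μ ∧ |b| = μ⁻¹ ∧ ∀ᶠ z in 𝓝 (ψ p), ψ' (f (ψ.symm z)) = diagAffine a b c z

/-- Written in flat coordinates, the pullback identities say that the real differential multiplies
|Re v| by λ and |Im v| by 1/λ at each point; `exists_diagAffine` makes the signs locally constant.
-/
theorem IsPseudoAnosov.isFlatAffine {f : X ≃ₜ X} {lam : ℝ} (hf : q.IsPseudoAnosov f lam) :
    q.IsFlatAffine f lam := by
  have hlam : 0 < lam := one_pos.trans hf.one_lt
  refine ⟨hf.zero_iff, fun p ψ ψ' hψ hψ' hp hp' => ?_⟩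
  have hn : ψ.target ∩ ψ.symm ⁻¹' (f ⁻¹' ψ'.source) ∈ 𝓝 (ψ p) := by
    refine inter_mem (ψ.open_target.mem_nhds (ψ.map_source hp)) ?_
    refine (ψ.continuousAt_symm (ψ.map_source hp)).preimage_mem_nhds ?_
    rw [ψ.left_inv hp]
    exact (ψ'.open_source.preimage f.continuous).mem_nhds hp'
  obtain ⟨r, hr, hball⟩ := Metric.mem_nhds_iff.1 hn
  have key : ∀ z ∈ Metric.ball (ψ p) r, ∃ g' : ℂ →L[ℝ] ℂ,
      HasFDerivAt (fun z => ψ' (f (ψ.symm z))) g' z ∧ ∀ v, |(g' v).re| = lam * |v.re| ∧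
        |(g' v).im| = lam⁻¹ * |v.im| := by
    intro z hz
    obtain ⟨hzt, hzf⟩ := hball hz
    set x := ψ.symm z with hx
    have hxs : x ∈ ψ.source := ψ.map_target hzt
    have hzx : ψ x = z := ψ.right_inv hzt
    have hfx : f x ∈ ψ'.source := hzf
    have hxr := hψ.not_isZero hxs
    set e := chartAt ℂ x
    set e' := chartAt ℂ (f x)
    have he : e ∈ atlas ℂ X := chart_mem_atlas ℂ x
    have he' : e' ∈ atlas ℂ X := chart_mem_atlas ℂ (f x)
    have hxe : x ∈ e.source := mem_chart_source ℂ x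
    have hxe' : f x ∈ e'.source := mem_chart_source ℂ (f x)
    obtain ⟨w, -, hw, hwq⟩ := hψ.hasDerivAt_symm hxs he hxe
    obtain ⟨w', -, hw', hwq'⟩ := hψ' _ hfx e' he' hxe'
    have hD := (hf.differentiable x hxr e he e' he' hxe hxe').hasFDerivAt
    set Df := fderiv ℝ (fun z => e' (f (e.symm z))) (e x)
    rw [hzx] at hw
    obtain ⟨L, hL, h1⟩ : ∃ L : ℂ →L[ℝ] ℂ, (∀ v, L v = w * v) ∧
        HasFDerivAt (fun ζ => e (ψ.symm ζ)) L z :=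
      ⟨_, fun v => by simp [mul_comm], hw.hasFDerivAt.restrictScalars ℝ⟩
    obtain ⟨L', hL', h1'⟩ : ∃ L : ℂ →L[ℝ] ℂ, (∀ v, L v = w' * v) ∧
        HasFDerivAt (fun ζ => ψ' (e'.symm ζ)) L (e' (f (e.symm (e (ψ.symm z))))) := by
      rw [← hx, e.left_inv hxe]
      exact ⟨_, fun v => by simp [mul_comm], hw'.hasFDerivAt.restrictScalars ℝ⟩
    have h2 : HasFDerivAt (fun ζ => e' (f (e.symm (e (ψ.symm ζ))))) (Df.comp L) z :=
      HasFDerivAt.comp (g := fun z => e' (f (e.symm z))) z hD h1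
    have h3 : HasFDerivAt (fun ζ => ψ' (e'.symm (e' (f (e.symm (e (ψ.symm ζ)))))))
        (L'.comp (Df.comp L)) z :=
      HasFDerivAt.comp (g := fun ζ => ψ' (e'.symm ζ)) z h1' h2
    refine ⟨_, h3.congr_of_eventuallyEq ?_, fun v => ?_⟩
    · have c1 : ContinuousAt ψ.symm z := ψ.continuousAt_symm hzt
      filter_upwards [c1.preimage_mem_nhds (e.open_source.mem_nhds hxe),
        (f.continuous.continuousAt.comp c1).preimage_mem_nhds (e'.open_source.mem_nhds hxe')]
        with ζ h4 h5
      rw [e.left_inv h4, e'.left_inv (show f (ψ.symm ζ) ∈ e'.source from h5)]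
    · have hval : ∀ g : ℂ, g = w' * Df (w * v) →
          |g.re| = lam * |v.re| ∧ |g.im| = lam⁻¹ * |v.im| := by
        rintro g rfl
        have hsq : (w' * Df (w * v)) ^ 2 = q.coeff e' (e' (f x)) * Df (w * v) ^ 2 := by
          rw [mul_pow, hwq']
        have hsq2 : q.coeff e (e x) * (w * v) ^ 2 = v ^ 2 := by
          rw [mul_pow, ← mul_assoc, hwq, one_mul]
        have r1 := hf.pullback_re x hxr e he e' he' hxe hxe' (w * v)
        have r2 := hf.pullback_im x hxr e he e' he' hxe hxe' (w * v)
        rw [hsq2, ← hsq, absReSqrt_sq, absReSqrt_sq] at r1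
        rw [hsq2, ← hsq, absImSqrt_sq, absImSqrt_sq] at r2
        exact ⟨r1, r2⟩
      apply hval
      simp [hL, hL']
  choose! g' hg hgv using key
  obtain ⟨a, b, c, ha, hb, h⟩ := exists_diagAffine (convex_ball (ψ p) r)
    ⟨_, Metric.mem_ball_self hr⟩ hlam.le (inv_pos.2 hlam).le hg (fun z hz v => (hgv z hz v).1)
    (fun z hz v => (hgv z hz v).2)
  exact ⟨a, b, c, ha, hb, by filter_upwards [Metric.ball_mem_nhds _ hr] with z hz using h z hz⟩

theorem IsFlatAffine.symm {f : X ≃ₜ X} {μ : ℝ} (hμ : 0 < μ) (hf : q.IsFlatAffine f μ) :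
    q.IsFlatAffine f.symm μ⁻¹ := by
  refine ⟨fun p => by rw [← hf.regular, f.apply_symm_apply], fun p ψ ψ' hψ hψ' hp hp' => ?_⟩
  obtain ⟨a, b, c, ha, hb, h⟩ := hf.affine (f.symm p) ψ' ψ hψ' hψ hp' (by simpa using hp)
  have ha0 : a ≠ 0 := by rintro rfl; simp at ha; linarith
  have hb0 : b ≠ 0 := by rintro rfl; simp at hb; linarith
  refine ⟨a⁻¹, b⁻¹, ⟨-(a⁻¹ * c.re), -(b⁻¹ * c.im)⟩, by rw [abs_inv, ha], by rw [abs_inv, hb], ?_⟩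
  have hpt := ψ.map_source hp
  have c1 : ContinuousAt (fun z => f.symm (ψ.symm z)) (ψ p) :=
    f.symm.continuous.continuousAt.comp (ψ.continuousAt_symm hpt)
  have c2 : Tendsto (fun z => ψ' (f.symm (ψ.symm z))) (𝓝 (ψ p)) (𝓝 (ψ' (f.symm p))) := by
    have h1 : ContinuousAt ψ' (f.symm (ψ.symm (ψ p))) := by
      rw [ψ.left_inv hp]; exact ψ'.continuousAt hp'
    have := ContinuousAt.comp (g := ψ') (f := fun z => f.symm (ψ.symm z)) h1 c1
    unfold ContinuousAt at this
    simpa [Function.comp_def, ψ.left_inv hp] using this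
  have n1 : ∀ᶠ z in 𝓝 (ψ p), f.symm (ψ.symm z) ∈ ψ'.source :=
    c1.preimage_mem_nhds (ψ'.open_source.mem_nhds (by simpa [ψ.left_inv hp] using hp'))
  filter_upwards [c2.eventually h, ψ.open_target.mem_nhds hpt, n1] with z h1 h2 h3
  rw [ψ'.left_inv h3, f.apply_symm_apply, ψ.right_inv h2] at h1
  generalize ψ' (f.symm (ψ.symm z)) = u at h1 ⊢
  subst h1
  apply Complex.ext
  · simp only [diagAffine_re]; field_simp; ring
  · simp only [diagAffine_im]; field_simp; ring

/-- The linear maps `diag(±μ, ±μ⁻¹)` multiply the vectors `v` with `v² = c` by `k` in length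
and preserve their direction up to sign. -/
def StretchesBy (μ : ℝ) (c : ℂ) (k : ℝ) : Prop :=
  0 < k ∧ ∀ (a b : ℝ) (v : ℂ), |a| = μ → |b| = μ⁻¹ → v ^ 2 = c →
    (⟨a * v.re, b * v.im⟩ : ℂ) ^ 2 = k ^ 2 * c

theorem stretchesBy_one {μ : ℝ} (hμ : 0 < μ) : StretchesBy μ 1 μ := by
  refine ⟨hμ, fun a b v ha _ hv => ?_⟩
  have e : (⟨a * v.re, b * v.im⟩ : ℂ) = a * v := by
    rcases sq_eq_sq_iff_eq_or_eq_neg.1 (hv.trans (one_pow 2).symm) with rfl | rfl <;> apply Complex.ext <;> simp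
  rw [e, mul_pow, hv, ← ha, ← Complex.ofReal_pow, ← Complex.ofReal_pow, sq_abs]

theorem stretchesBy_neg_one {μ : ℝ} (hμ : 0 < μ) : StretchesBy μ (-1) μ⁻¹ := by
  refine ⟨inv_pos.2 hμ, fun a b v _ hb hv => ?_⟩
  have e : (⟨a * v.re, b * v.im⟩ : ℂ) = b * v := by
    rw [← I_sq] at hv
    rcases sq_eq_sq_iff_eq_or_eq_neg.1 hv with rfl | rfl <;> apply Complex.ext <;> simp
  rw [e, mul_pow, hv, ← hb, ← Complex.ofReal_pow, ← Complex.ofReal_pow, sq_abs]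

section Manifold

variable [IsManifold 𝓘(ℂ) ω X]

/-- The map multiplies the speed along the trajectory by `k`; running through it `k` times slower
restores the normalization. -/
theorem IsFlatAffine.isTrajectory {f : X ≃ₜ X} {μ k T : ℝ} {c : ℂ} {γ : ℝ → X}
    (hf : q.IsFlatAffine f μ) (hk : StretchesBy μ c k) (h : q.IsTrajectory c γ T) :
    q.IsTrajectory c (fun t => f (γ (t / k))) (k * T) := by
  have hk0 := hk.1
  refine isTrajectory_of_flat (mul_pos hk0 h.pos) ?_ fun t ht => ?_
  · refine f.continuous.comp_continuousOn (h.cont.comp (by fun_prop) fun t ht => ?_)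
    exact ⟨div_nonneg ht.1 hk0.le, (div_lt_iff₀' hk0).2 ht.2⟩
  · have htk : t / k ∈ Ioo 0 T := ⟨div_pos ht.1 hk0, (div_lt_iff₀' hk0).2 ht.2⟩
    have hreg := h.regular _ htk
    obtain ⟨ψ, hψ, hs⟩ := q.exists_isFlat hreg
    obtain ⟨ψ', hψ', hs'⟩ := q.exists_isFlat ((hf.regular _).not.2 hreg)
    obtain ⟨a, b, d, ha, hb, haff⟩ := hf.affine _ ψ ψ' hψ hψ' hs hs'
    obtain ⟨v, hv, hv2⟩ := h.hasDerivAt_flat hψ htk hs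
    refine ⟨ψ', hψ', hs', ⟨a * v.re, b * v.im⟩ / k, ?_, ?_⟩
    · have h1 : HasDerivAt (fun s => diagAffine a b d (ψ (γ s))) ⟨a * v.re, b * v.im⟩ (t / k) := by
        have hre : HasDerivAt (fun s => (ψ (γ s)).re) v.re (t / k) :=
          Complex.reCLM.hasFDerivAt.comp_hasDerivAt _ hv
        have him : HasDerivAt (fun s => (ψ (γ s)).im) v.im (t / k) :=
          Complex.imCLM.hasFDerivAt.comp_hasDerivAt _ hv
        have e1 := ((hre.const_mul a).add_const d.re).ofReal_comp
        have e2 := (((him.const_mul b).add_const d.im).ofReal_comp).mul_const I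
        refine ((e1.add e2).congr_of_eventuallyEq (.of_forall fun s => ?_)).congr_deriv ?_
        · apply Complex.ext <;> simp
        · apply Complex.ext <;> simp
      have h2 : HasDerivAt (fun s => ψ' (f (γ s))) ⟨a * v.re, b * v.im⟩ (t / k) := by
        refine h1.congr_of_eventuallyEq ?_
        filter_upwards [hv.continuousAt.eventually haff,
          (h.continuousAt htk).preimage_mem_nhds (ψ.open_source.mem_nhds hs)] with s hs1 hs2
        rw [← hs1, ψ.left_inv hs2]
      have h3 := h2.scomp t ((hasDerivAt_id t).div_const k)
      refine h3.congr_deriv ?_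
      rw [Complex.real_smul]; push_cast; ring
    · rw [div_pow, hk.2 a b v ha hb hv2, mul_div_cancel_left₀]
      exact pow_ne_zero 2 (Complex.ofReal_ne_zero.2 hk0.ne')

variable [T2Space X]

/-- Trajectories which agree near one time agree at all times. -/
theorem IsTrajectory.eqOn {c : ℂ} {γ η : ℝ → X} {T t₀ : ℝ}
    (hγ : q.IsTrajectory c γ T) (hη : q.IsTrajectory c η T) (ht₀ : t₀ ∈ Ioo 0 T)
    (h : γ =ᶠ[𝓝 t₀] η) : EqOn γ η (Ioo 0 T) := by
  set A := {t | γ =ᶠ[𝓝 t] η} with hA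
  have hAo : IsOpen A := isOpen_setOfPred_eventually_nhds
  have hsub : Ioo 0 T ⊆ A := by
    refine isPreconnected_Ioo.subset_of_closure_inter_subset hAo ⟨t₀, ht₀, h⟩ ?_
    rintro t₁ ⟨hcl, ht₁⟩
    have hfr := mem_closure_iff_frequently.1 hcl
    have heq : γ t₁ = η t₁ := tendsto_nhds_unique_of_frequently_eq (hγ.continuousAt ht₁)
      (hη.continuousAt ht₁) (hfr.mono fun t ht => ht.eq_of_nhds)
    obtain ⟨ψ, hψ, hs⟩ := q.exists_isFlat (hγ.regular _ ht₁)
    obtain ⟨v, -, hv⟩ := hγ.eventually_affine hψ ht₁ hs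
    obtain ⟨w, -, hw⟩ := hη.eventually_affine hψ ht₁ (heq ▸ hs)
    obtain ⟨t, htA, hvt, hwt⟩ := (hfr.and_eventually
      (hv.eventually_nhds.and hw.eventually_nhds)).exists
    -- The two lines agree at `t₁`; a second common time `s ≠ t₁` is what identifies their
    -- velocities.
    obtain ⟨s, ⟨⟨h1, -, h2⟩, -, h3⟩, hne⟩ :=
      (dense_compl_singleton t₁).inter_nhds_nonempty (htA.and (hvt.and hwt)) |>.imp
        fun s hs => (And.comm.1 hs).imp (fun h => (⟨⟨h.1, h.2.1⟩, h.2.2⟩ :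
          ((γ s = η s ∧ _) ∧ _))) id
    have hvw : v = w := by
      have hne' : ((s - t₁ : ℝ) : ℂ) ≠ 0 := Complex.ofReal_ne_zero.2 (sub_ne_zero.2 hne)
      refine mul_left_cancel₀ hne' ?_
      rw [h1, heq] at h2
      exact add_left_cancel (h2.symm.trans h3)
    change γ =ᶠ[𝓝 t₁] η
    filter_upwards [hv, hw] with r hr1 hr2
    refine ψ.injOn hr1.1 hr2.1 ?_
    rw [hr1.2, hr2.2, hvw, heq]
  exact fun t ht => (hsub ht).eq_of_nhds

end Manifold

/-! ### Countability of the levels of a leaf in a flat chart. -/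

/-- By the Lindelöf property of subsets of the line, countably many of the sets on which `F` is
constant cover `V`. -/
theorem countable_image_of_eventually_eq {α : Type*} {F : ℝ → α} {V : Set ℝ}
    (h : ∀ t ∈ V, ∀ᶠ s in 𝓝 t, F s = F t) : (F '' V).Countable := by
  obtain ⟨C, -, hC, hcov⟩ := TopologicalSpace.countable_cover_nhdsWithin
    (f := fun t => {s | F s = F t}) (s := V) fun t ht => mem_nhdsWithin_of_mem_nhds (h t ht)
  refine (hC.image F).mono ?_
  rintro _ ⟨t, ht, rfl⟩
  obtain ⟨c, hc, hct⟩ := mem_iUnion₂.1 (hcov ht)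
  exact ⟨c, hc, (show F t = F c from hct).symm⟩

theorem IsTrajectory.countable_im {γ : ℝ → X} {T : ℝ} (h : q.IsHorizontal γ T)
    (hψ : q.IsFlat ψ) : {y | ∃ t ∈ Ioo 0 T, γ t ∈ ψ.source ∧ (ψ (γ t)).im = y}.Countable := by
  refine (countable_image_of_eventually_eq (F := fun t => (ψ (γ t)).im)
    (V := {t | t ∈ Ioo 0 T ∧ γ t ∈ ψ.source}) fun t ht => ?_).mono ?_
  · obtain ⟨v, hv, hev⟩ := h.eventually_affine hψ ht.1 ht.2
    filter_upwards [hev] with s hs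
    rw [hs.2]
    rcases sq_eq_sq_iff_eq_or_eq_neg.1 (hv.trans (one_pow 2).symm) with rfl | rfl <;> simp
  · rintro y ⟨t, h1, h2, h3⟩
    exact ⟨t, ⟨h1, h2⟩, h3⟩

theorem IsTrajectory.countable_re {γ : ℝ → X} {T : ℝ} (h : q.IsVertical γ T)
    (hψ : q.IsFlat ψ) : {x | ∃ t ∈ Ioo 0 T, γ t ∈ ψ.source ∧ (ψ (γ t)).re = x}.Countable := by
  refine (countable_image_of_eventually_eq (F := fun t => (ψ (γ t)).re)
    (V := {t | t ∈ Ioo 0 T ∧ γ t ∈ ψ.source}) fun t ht => ?_).mono ?_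
  · obtain ⟨v, hv, hev⟩ := h.eventually_affine hψ ht.1 ht.2
    filter_upwards [hev] with s hs
    rw [hs.2]
    rw [← I_sq] at hv
    rcases sq_eq_sq_iff_eq_or_eq_neg.1 hv with rfl | rfl <;> simp
  · rintro y ⟨t, h1, h2, h3⟩
    exact ⟨t, ⟨h1, h2⟩, h3⟩

end QuadraticDifferential

/-! ### The clock at a zero. -/

/-- The only nonvanishing solution of `s'² = 4 s` on `(0, T)` with `s(0) = 0` is `t²`. -/
theorem eq_sq_of_sq_deriv_eq {s s' : ℝ → ℂ} {T : ℝ} (hc : ContinuousOn s (Ico 0 T)) (h0 : s 0 = 0)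
    (hne : ∀ t ∈ Ioo 0 T, s t ≠ 0) (hd : ∀ t ∈ Ioo 0 T, HasDerivAt s (s' t) t)
    (he : ∀ t ∈ Ioo 0 T, s' t ^ 2 = 4 * s t) : ∀ t ∈ Ico 0 T, s t = (t : ℂ) ^ 2 := by
  -- Locally √s has constant velocity ±1, so s'/2 - t is locally constant. This quantity involves no
  -- branch of the root, so the local statements glue.
  have hloc : ∀ t₁ ∈ Ioo 0 T, ∃ κ : ℂ, ∀ᶠ t in 𝓝 t₁, s' t / 2 - t = κ := by
    intro t₁ ht₁
    have hs₁ := hne t₁ ht₁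
    obtain ⟨r, hr, hr2⟩ := (analyticAt_id (𝕜 := ℂ) (z := s t₁)).exists_sqrt hs₁
    replace hr2 : ∀ z, r z ^ 2 = z := hr2
    have hev : ∀ᶠ t in 𝓝 t₁, t ∈ Ioo 0 T ∧ AnalyticAt ℂ r (s t) :=
      Filter.Eventually.and (Ioo_mem_nhds ht₁.1 ht₁.2)
        ((hd t₁ ht₁).continuousAt.eventually hr.eventually_analyticAt)
    obtain ⟨ε, hε, hball⟩ := Metric.eventually_nhds_iff_ball.1 hev
    have hw : ∀ t ∈ Metric.ball t₁ ε, HasDerivAt (fun t => r (s t)) (deriv r (s t) * s' t) t ∧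
        s' t = 2 * r (s t) * (deriv r (s t) * s' t) := by
      intro t ht
      have h1 := (hball t ht).2.differentiableAt.hasDerivAt.comp t (hd t (hball t ht).1)
      refine ⟨h1, ?_⟩
      have h2 : HasDerivAt (fun t => r (s t) ^ 2) (s' t) t := by
        simpa only [hr2] using hd t (hball t ht).1
      have h3 : HasDerivAt (fun t => r (s t) ^ 2) _ t := h1.pow 2
      have := h2.unique h3
      simpa using this
    have hw2 : ∀ t ∈ Metric.ball t₁ ε, (deriv r (s t) * s' t) ^ 2 = 1 := by
      intro t ht
      have h1 := he t (hball t ht).1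
      rw [(hw t ht).2, mul_pow, mul_pow, hr2] at h1
      have h2 : (4 * s t) ≠ 0 := mul_ne_zero (by norm_num) (hne t (hball t ht).1)
      refine mul_left_cancel₀ h2 ?_
      linear_combination h1
    obtain ⟨v, hv, haff⟩ := exists_velocity_of_sq_deriv_eq (convex_ball t₁ ε)
      (fun t ht => (hw t ht).1) hw2
    refine ⟨v * r (s t₁) - t₁, ?_⟩
    filter_upwards [Metric.ball_mem_nhds t₁ hε] with t ht
    have h1 : r (s t) = r (s t₁) + (t - t₁ : ℝ) * v := by
      rw [← haff t₁ (Metric.mem_ball_self hε) t ht]; ring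
    have h2 : HasDerivAt (fun t => r (s t)) v t := by
      have h3 : HasDerivAt (fun t : ℝ => r (s t₁) + (t - t₁ : ℝ) * v) v t := by
        have := ((((hasDerivAt_id t).sub_const t₁).ofReal_comp).mul_const v).const_add (r (s t₁))
        simpa using this
      refine h3.congr_of_eventuallyEq ?_
      filter_upwards [Metric.isOpen_ball.mem_nhds ht] with u hu
      rw [← haff t₁ (Metric.mem_ball_self hε) u hu]; ring
    rw [(hw t ht).2, (hw t ht).1.unique h2, h1]
    push_cast
    linear_combination (t - t₁ : ℂ) * hv
  obtain ⟨κ, hκ⟩ : ∃ κ : ℂ, ∀ t ∈ Ioo 0 T, s t = (t + κ) ^ 2 := by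
    rcases (Ioo 0 T).eq_empty_or_nonempty with hem | ⟨t₀, ht₀⟩
    · exact ⟨0, by simp [hem]⟩
    obtain ⟨v, hv, haff⟩ := exists_velocity_of_sq_deriv_eq (convex_Ioo 0 T)
      (σ := fun t : ℝ => s' t / 2 - t) (v := fun _ => 0) (c := 0) (fun t ht => by
        obtain ⟨κ, hκ⟩ := hloc t ht
        exact (hasDerivAt_const t κ).congr_of_eventuallyEq hκ) (by simp)
    have hv0 : v = 0 := by simpa using hv
    refine ⟨s' t₀ / 2 - t₀, fun t ht => ?_⟩
    have h1 := haff t₀ ht₀ t ht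
    rw [hv0, mul_zero, sub_eq_zero] at h1
    rw [← h1]
    linear_combination -(1 / 4) * he t ht
  intro t ht
  rcases eq_or_lt_of_le ht.1 with rfl | hpos
  · simp [h0]
  have hT : 0 < T := ht.1.trans_lt ht.2
  have l1 : Tendsto s (𝓝[>] 0) (𝓝 0) := by
    have := hc 0 ⟨le_rfl, hT⟩
    rw [ContinuousWithinAt, h0] at this
    exact this.mono_left (by rw [← nhdsWithin_Ioo_eq_nhdsGT hT]; exact nhdsWithin_mono _ Ioo_subset_Ico_self)
  have l2 : Tendsto s (𝓝[>] 0) (𝓝 (κ ^ 2)) := by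
    have h1 : Tendsto (fun t : ℝ => ((t : ℂ) + κ) ^ 2) (𝓝[>] 0) (𝓝 (κ ^ 2)) := by
      have : Continuous fun t : ℝ => ((t : ℂ) + κ) ^ 2 := by fun_prop
      simpa using (this.tendsto 0).mono_left nhdsWithin_le_nhds
    refine h1.congr' ?_
    filter_upwards [Ioo_mem_nhdsGT hT] with t ht using (hκ t ht).symm
  have hκ0 : κ = 0 := by simpa using tendsto_nhds_unique l2 l1
  rw [hκ t ⟨hpos, ht.2⟩, hκ0, add_zero]

namespace QuadraticDifferential

variable {X : Type*} [TopologicalSpace X] [ChartedSpace ℂ X] {q : QuadraticDifferential X}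

/-- By the identity theorem the set of points near which `q` vanishes identically is open and
closed. -/
theorem not_eventually_coeff_eq_zero [ConnectedSpace X] (hq : ∃ p, ¬ q.IsZero p)
    (p : X) : ¬ ∀ᶠ z in 𝓝 (chartAt ℂ p p), q.coeff (chartAt ℂ p) z = 0 := by
  set A := {x | ∀ᶠ y in 𝓝 x, q.IsZero y} with hA
  have hmem : ∀ x, ∀ e ∈ atlas ℂ X, x ∈ e.source →
      ((∀ᶠ y in 𝓝 x, q.IsZero y) ↔ ∀ᶠ z in 𝓝 (e x), q.coeff e z = 0) := by
    intro x e he hx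
    constructor
    · intro h
      have ht := e.map_source hx
      have h1 : Tendsto e.symm (𝓝 (e x)) (𝓝 x) := by
        have := e.continuousAt_symm ht
        rwa [ContinuousAt, e.left_inv hx] at this
      filter_upwards [h1.eventually h, e.open_target.mem_nhds ht] with z h2 h3
      rwa [q.isZero_iff he (e.map_target h3), e.right_inv h3] at h2
    · intro h
      filter_upwards [(e.continuousAt hx).eventually h, e.open_source.mem_nhds hx] with y h2 h3
      rwa [q.isZero_iff he h3]
  have hcl : IsClosed A := by
    refine isClosed_of_closure_subset fun x hx => ?_
    set e := chartAt ℂ x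
    have he : e ∈ atlas ℂ X := chart_mem_atlas ℂ x
    have hxe : x ∈ e.source := mem_chart_source ℂ x
    obtain ⟨r, hr, hball⟩ := Metric.mem_nhds_iff.1 (e.open_target.mem_nhds (e.map_source hxe))
    have hn : e.source ∩ e ⁻¹' Metric.ball (e x) r ∈ 𝓝 x := inter_mem (e.open_source.mem_nhds hxe)
      ((e.continuousAt hxe).preimage_mem_nhds (Metric.ball_mem_nhds _ hr))
    obtain ⟨y, ⟨hye, hyr⟩, hyA⟩ := mem_closure_iff_nhds.1 hx _ hn
    have h1 := (hmem y e he hye).1 hyA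
    have h2 := ((q.holomorphic e he).mono hball).analyticOnNhd Metric.isOpen_ball
      |>.eqOn_zero_of_preconnected_of_eventuallyEq_zero (convex_ball _ _).isPreconnected hyr h1
    refine (hmem x e he hxe).2 ?_
    filter_upwards [Metric.ball_mem_nhds _ hr] with z hz using h2 hz
  have hop : IsOpen A := isOpen_setOfPred_eventually_nhds
  have : A = ∅ := by
    rcases isClopen_iff.1 ⟨hcl, hop⟩ with h | h
    · exact h
    · obtain ⟨x, hx⟩ := hq
      have hxA : x ∈ A := h ▸ mem_univ x
      exact absurd hxA.self_of_nhds hx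
  rw [← hmem p _ (chart_mem_atlas ℂ p) (mem_chart_source ℂ p)]
  exact fun h => (this ▸ h : p ∈ (∅ : Set X))

/-- Near a zero `p` of `q` there is a function `Ψ`, with finite level sets in a compact
neighbourhood of `p`, which measures the time on the trajectories emanating from `p`. -/
theorem exists_clock [T2Space X] [ConnectedSpace X] (hq : ∃ p, ¬ q.IsZero p) {p : X}
    (hp : q.IsZero p) :
    ∃ (Ψ : X → ℂ) (K : Set X) (s₀ : ℝ), 0 < s₀ ∧ K ∈ 𝓝 p ∧ (∀ x ∈ K, q.IsZero x → x = p) ∧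
      (∀ w ≠ 0, {x ∈ K | Ψ x = w}.Finite) ∧
      ∀ (c : ℂ) (γ : ℝ → X) (T : ℝ), c ^ 2 = 1 → q.IsTrajectory c γ T → γ 0 = p →
        ∀ t ∈ Ico 0 T, t < s₀ → γ t ∈ K ∧ Ψ (γ t) = c * t ^ 2 := by
  set e := chartAt ℂ p
  have he : e ∈ atlas ℂ X := chart_mem_atlas ℂ p
  have hpe : p ∈ e.source := mem_chart_source ℂ p
  set Q := q.coeff e with hQ
  have han : AnalyticAt ℂ Q (e p) :=
    (q.holomorphic e he).analyticAt (e.open_target.mem_nhds (e.map_source hpe))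
  obtain ⟨Ψ, Ψ', r, hr, hΨ⟩ := han.exists_sq_primitive_sqrt (not_eventually_coeff_eq_zero hq p)
  obtain ⟨r', hr', hball'⟩ := Metric.mem_nhds_iff.1 (e.open_target.mem_nhds (e.map_source hpe))
  obtain ⟨ρ, hρ, hρr⟩ := exists_between (lt_min hr hr')
  have hsub : Metric.closedBall (e p) ρ ⊆ Metric.ball (e p) r :=
    Metric.closedBall_subset_ball (hρr.trans_le (min_le_left _ _))
  have hsub' : Metric.closedBall (e p) ρ ⊆ e.target :=
    (Metric.closedBall_subset_ball (hρr.trans_le (min_le_right _ _))).trans hball'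
  set K := e.symm '' Metric.closedBall (e p) ρ with hK
  set V := e.source ∩ e ⁻¹' Metric.ball (e p) ρ with hV
  have hVo : IsOpen V := e.isOpen_inter_preimage Metric.isOpen_ball
  have hpV : p ∈ V := ⟨hpe, Metric.mem_ball_self hρ⟩
  have hKc : IsCompact K := (isCompact_closedBall _ _).image_of_continuousOn
    (e.continuousOn_symm.mono hsub')
  have hVK : V ⊆ K := fun x hx => ⟨e x, Metric.ball_subset_closedBall hx.2, e.left_inv hx.1⟩
  have hKe : ∀ x ∈ K, x ∈ e.source ∧ e x ∈ Metric.closedBall (e p) ρ := by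
    rintro _ ⟨z, hz, rfl⟩
    exact ⟨e.map_target (hsub' hz), by rwa [e.right_inv (hsub' hz)]⟩
  have hΨc : ContinuousOn Ψ (Metric.closedBall (e p) ρ) := fun z hz =>
    (hΨ z (hsub hz)).1.continuousAt.continuousWithinAt
  obtain ⟨m, hm, hmin⟩ : ∃ m > 0, ∀ z ∈ Metric.sphere (e p) ρ, m ≤ ‖Ψ z‖ := by
    obtain ⟨z₁, hz₁, hz₁m⟩ := (isCompact_sphere (e p) ρ).exists_isMinOn
      (NormedSpace.sphere_nonempty.2 hρ.le) (hΨc.mono Metric.sphere_subset_closedBall).norm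
    refine ⟨‖Ψ z₁‖, norm_pos_iff.2 fun h0 => ?_, fun z hz => hz₁m hz⟩
    have := (hΨ z₁ (hsub (Metric.sphere_subset_closedBall hz₁))).2.2.1.1 h0
    rw [this, Metric.mem_sphere, dist_self] at hz₁
    exact hρ.ne hz₁
  have hKz : ∀ x ∈ K, q.IsZero x → x = p := fun x hx hxz => by
    obtain ⟨h1, h2⟩ := hKe x hx
    rw [q.isZero_iff he h1] at hxz
    exact e.injOn h1 hpe ((hΨ _ (hsub h2)).2.2.2 hxz)
  -- The function s = c Ψ(e γ) solves s'² = 4 s, because Ψ'² = 4 Q Ψ, Q v² = c and c² = 1.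
  have hclock : ∀ (c : ℂ) (γ : ℝ → X) (T : ℝ), c ^ 2 = 1 → q.IsTrajectory c γ T → γ 0 = p →
      (∀ t ∈ Ico 0 T, γ t ∈ V) → ∀ t ∈ Ico 0 T, Ψ (e (γ t)) = c * t ^ 2 := by
    intro c γ T hc hγ h0 hin
    have hc0 : c ≠ 0 := by rintro rfl; norm_num at hc
    have hin' : ∀ t ∈ Ico 0 T, e (γ t) ∈ Metric.closedBall (e p) ρ := fun t ht =>
      Metric.ball_subset_closedBall (hin t ht).2
    have hsp : ∀ t ∈ Ioo 0 T, ∃ v, HasDerivAt (fun s => e (γ s)) v t ∧ Q (e (γ t)) * v ^ 2 = c :=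
      fun t ht => hγ.speed t ht e he (hin t (Ioo_subset_Ico_self ht)).1
    choose! v hv hvq using hsp
    have key := eq_sq_of_sq_deriv_eq (s := fun t => c * Ψ (e (γ t)))
      (s' := fun t => c * (Ψ' (e (γ t)) * v t)) (T := T) ?_ ?_ ?_ ?_ ?_
    · intro t ht
      rw [← key t ht, ← mul_assoc, ← sq, hc, one_mul]
    · refine continuousOn_const.mul (hΨc.comp (e.continuousOn.comp hγ.cont fun t ht => ?_) hin')
      exact (hin t ht).1
    · have := (hΨ (e p) (Metric.mem_ball_self hr)).2.2.1.2 rfl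
      simp [h0, this]
    · intro t ht
      refine mul_ne_zero hc0 fun hz => hγ.regular t ht ?_
      have hV' := hin t (Ioo_subset_Ico_self ht)
      have := (hΨ _ (hsub (hin' t (Ioo_subset_Ico_self ht)))).2.2.1.1 hz
      rwa [e.injOn hV'.1 hpe this]
    · intro t ht
      exact ((hΨ _ (hsub (hin' t (Ioo_subset_Ico_self ht)))).1.comp t (hv t ht)).const_mul c
    · intro t ht
      have h1 := (hΨ _ (hsub (hin' t (Ioo_subset_Ico_self ht)))).2.1
      have h2 := hvq t ht
      calc (c * (Ψ' (e (γ t)) * v t)) ^ 2 = c ^ 2 * (Ψ' (e (γ t)) ^ 2 * v t ^ 2) := by ring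
        _ = 4 * ((Q (e (γ t)) * v t ^ 2) * Ψ (e (γ t))) := by rw [h1, hc]; ring
        _ = _ := by rw [h2]
  -- A first exit from `V` at time τ takes place on the circle, where |Ψ| ≥ m, while the clock reads
  -- |Ψ| = τ² there. So no exit happens before √m, the value taken for `s₀`.
  have hconf : ∀ (c : ℂ) (γ : ℝ → X) (T : ℝ), c ^ 2 = 1 → q.IsTrajectory c γ T → γ 0 = p →
      ∀ t ∈ Ico 0 T, t < √m → γ t ∈ V := by
    intro c γ T hc hγ h0 t ht htm
    by_contra hout
    have hsubT : Icc 0 t ⊆ Ico 0 T := fun s hs => ⟨hs.1, hs.2.trans_lt ht.2⟩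
    have hclosed : IsClosed (Icc 0 t ∩ γ ⁻¹' Vᶜ) :=
      (hγ.cont.mono hsubT).preimage_isClosed_of_isClosed isClosed_Icc hVo.isClosed_compl
    have hcomp : IsCompact (Icc 0 t ∩ γ ⁻¹' Vᶜ) :=
      isCompact_Icc.of_isClosed_subset hclosed inter_subset_left
    obtain ⟨τ, ⟨hτ, hτV⟩, hτmin⟩ := hcomp.exists_isLeast ⟨t, ⟨ht.1, le_rfl⟩, hout⟩
    have hτ0 : 0 < τ := hτ.1.lt_of_ne fun h => hτV (by rwa [← h, h0])
    have hτT : τ < T := (hsubT hτ).2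
    have hbefore : ∀ s ∈ Ico 0 τ, γ s ∈ V := fun s hs => by
      by_contra hsV
      exact hs.2.not_ge (hτmin ⟨⟨hs.1, hs.2.le.trans hτ.2⟩, hsV⟩)
    have hcl := hclock c γ τ hc (hγ.mono hτ0 hτT.le) h0 hbefore
    have hcont : ContinuousAt γ τ := hγ.continuousAt ⟨hτ0, hτT⟩
    have hev : ∀ᶠ s in 𝓝[<] τ, s ∈ Ico 0 τ := Ico_mem_nhdsLT hτ0
    have hτK : γ τ ∈ K := hKc.isClosed.mem_of_tendsto (hcont.mono_left nhdsWithin_le_nhds)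
      (hev.mono fun s hs => hVK (hbefore s hs))
    obtain ⟨hτe, hτb⟩ := hKe _ hτK
    have hsph : e (γ τ) ∈ Metric.sphere (e p) ρ := by
      refine le_antisymm hτb (not_lt.1 fun hlt => hτV ⟨hτe, hlt⟩)
    have l1 : Tendsto (fun s => Ψ (e (γ s))) (𝓝[<] τ) (𝓝 (Ψ (e (γ τ)))) :=
      (ContinuousAt.comp (g := Ψ) (f := fun s => e (γ s)) (hΨ _ (hsub hτb)).1.continuousAt
        (ContinuousAt.comp (g := e) (e.continuousAt hτe) hcont)).tendsto.mono_left nhdsWithin_le_nhds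
    have l2 : Tendsto (fun s => Ψ (e (γ s))) (𝓝[<] τ) (𝓝 (c * τ ^ 2)) := by
      have hcs : Continuous fun s : ℝ => c * (s : ℂ) ^ 2 := by fun_prop
      refine ((hcs.tendsto τ).mono_left nhdsWithin_le_nhds).congr' ?_
      filter_upwards [hev] with s hs using (hcl s hs).symm
    have h1 := hmin _ hsph
    have hcn : ‖c‖ = 1 := by
      have : ‖c‖ ^ 2 = 1 := by rw [← norm_pow, hc, norm_one]
      exact (pow_eq_one_iff_of_nonneg (norm_nonneg c) two_ne_zero).1 this
    rw [tendsto_nhds_unique l1 l2, norm_mul, hcn, one_mul, norm_pow, Complex.norm_real,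
      Real.norm_eq_abs, sq_abs] at h1
    have h2 : τ < √m := hτ.2.trans_lt htm
    have := (Real.lt_sqrt hτ0.le).1 h2
    linarith
  refine ⟨fun x => Ψ (e x), K, √m, Real.sqrt_pos.2 hm, mem_of_superset (hVo.mem_nhds hpV) hVK, hKz,
    fun w hw => ?_, fun c γ T hc hγ h0 t ht hts => ?_⟩
  -- An infinite level set would accumulate at a point where Ψ = w ≠ 0; there Ψ'² = 4 Q Ψ is
  -- nonzero, so the level is isolated.
  · have hfin : {z ∈ Metric.closedBall (e p) ρ | Ψ z = w}.Finite := by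
      by_contra hinf
      obtain ⟨z₁, hz₁, hacc⟩ := Set.Infinite.exists_accPt_of_subset_isCompact hinf
        (isCompact_closedBall _ _) (sep_subset _ _)
      rw [accPt_iff_frequently_nhdsNE] at hacc
      obtain ⟨hd, h2, h3, h4⟩ := hΨ z₁ (hsub hz₁)
      have hval : Ψ z₁ = w := tendsto_nhds_unique_of_frequently_eq
        (hd.continuousAt.tendsto.mono_left nhdsWithin_le_nhds) tendsto_const_nhds
        (hacc.mono fun z hz => hz.2)
      have hz₁p : z₁ ≠ e p := fun h => hw (by rw [← hval]; exact h3.2 h)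
      have hd0 : Ψ' z₁ ≠ 0 := fun h0 => by
        rw [h0, hval, zero_pow two_ne_zero, eq_comm] at h2
        have := mul_ne_zero (mul_ne_zero (by norm_num : (4 : ℂ) ≠ 0) fun h => hz₁p (h4 h)) hw
        exact this h2
      obtain ⟨z, hz, hz'⟩ := (hacc.and_eventually (hd.eventually_ne hd0 (c := w))).exists
      exact hz' hz.2
    refine (hfin.image e.symm).subset ?_
    rintro x ⟨hx, hxw⟩
    obtain ⟨h1, h2⟩ := hKe x hx
    exact ⟨e x, ⟨h2, hxw⟩, e.left_inv h1⟩
  · refine ⟨hVK (hconf c γ T hc hγ h0 t ht hts), ?_⟩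
    obtain ⟨T', h1, h2⟩ := exists_between (lt_min ht.2 hts)
    have hT' : 0 < T' := ht.1.trans_lt h1
    have hγ' := hγ.mono hT' (h2.le.trans (min_le_left _ _))
    exact hclock c γ T' hc hγ' h0 (fun s hs => hconf c γ T' hc hγ' h0 s hs
      (hs.2.trans (h2.trans_le (min_le_right _ _)))) t ⟨ht.1, h1⟩

theorem finite_isZero [T2Space X] [CompactSpace X] [ConnectedSpace X]
    (hq : ∃ p, ¬ q.IsZero p) : {p | q.IsZero p}.Finite := by
  by_contra hinf
  obtain ⟨p, -, hacc⟩ := Set.Infinite.exists_accPt_of_subset_isCompact hinf isCompact_univ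
    (subset_univ _)
  rw [accPt_iff_frequently] at hacc
  have hp : q.IsZero p := by
    by_contra hreg
    set e := chartAt ℂ p
    have he : e ∈ atlas ℂ X := chart_mem_atlas ℂ p
    have hpe : p ∈ e.source := mem_chart_source ℂ p
    have hc : ContinuousAt (q.coeff e) (e p) := ((q.holomorphic e he).differentiableAt
      (e.open_target.mem_nhds (e.map_source hpe))).continuousAt
    obtain ⟨x, ⟨-, hx⟩, h1, h2⟩ := (hacc.and_eventually (((hc.comp (e.continuousAt hpe)).eventually_ne
      hreg).and (e.open_source.mem_nhds hpe))).exists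
    exact h1 ((q.isZero_iff he h2).1 hx)
  obtain ⟨-, K, -, -, hK, hKz, -⟩ := exists_clock hq hp
  obtain ⟨x, ⟨hne, hx⟩, hxK⟩ := (hacc.and_eventually hK).exists
  exact hne (hKz x hxK hx)

end QuadraticDifferential

/-! ### The action of f on leaves emanating from zeros; separatrices. -/

namespace QuadraticDifferential

variable {X : Type*} [TopologicalSpace X] [ChartedSpace ℂ X] {q : QuadraticDifferential X}
  [T2Space X] [ConnectedSpace X] [IsManifold 𝓘(ℂ) ω X] {f : X ≃ₜ X} {lam : ℝ}

/-- The hypothesis `hfix` puts f(γ t) on γ without saying at which time. The rescaled image `δ` is a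
trajectory from the same zero, so the clock identifies that time for small `t`, and unique
continuation does the rest. -/
theorem IsFlatAffine.map_trajectory {μ k T : ℝ} {c : ℂ} {γ : ℝ → X} (hf : q.IsFlatAffine f μ)
    (hq : ∃ p, ¬ q.IsZero p) (hc : c ^ 2 = 1) (hk : StretchesBy μ c k)
    (hγ : q.IsTrajectory c γ T) (h0 : q.IsZero (γ 0)) (hf0 : f (γ 0) = γ 0)
    (hfix : ∀ T', 0 < T' → T' ≤ T → ∃ ε > 0, ∀ t ∈ Ico 0 ε, f (γ t) ∈ γ '' Ico 0 T') :
    ∀ t ∈ Ico 0 T, k * t < T → f (γ t) = γ (k * t) := by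
  obtain ⟨Ψ, K, s₀, hs₀, -, -, -, hclock⟩ := exists_clock hq h0
  have hk0 := hk.1
  have hc0 : c ≠ 0 := by rintro rfl; norm_num at hc
  -- The segment is shortened to `min T s₀` so that the time found on γ is also within reach of the
  -- clock.
  obtain ⟨ε, hε, hεf⟩ := hfix (min T s₀) (lt_min hγ.pos hs₀) (min_le_left _ _)
  have hδ := hf.isTrajectory hk hγ
  set δ : ℝ → X := fun t => f (γ (t / k)) with hδdef
  have hδ0 : δ 0 = γ 0 := by simp [hδdef, hf0]
  have hkT : 0 < k * T := mul_pos hk0 hγ.pos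
  set m := min T (k * T) with hm
  have hm0 : 0 < m := lt_min hγ.pos hkT
  have hsmall : ∀ t ∈ Ico 0 (min m (min s₀ (k * ε))), δ t = γ t := by
    intro t ht
    have h1 : t < m := ht.2.trans_le (min_le_left _ _)
    have h2 : t < s₀ := ht.2.trans_le ((min_le_right _ _).trans (min_le_left _ _))
    have h3 : t < k * ε := ht.2.trans_le ((min_le_right _ _).trans (min_le_right _ _))
    obtain ⟨s, hs, hst⟩ := hεf (t / k) ⟨div_nonneg ht.1 hk0.le, (div_lt_iff₀' hk0).2 h3⟩
    have e1 := (hclock c δ _ hc hδ hδ0 t ⟨ht.1, h1.trans_le (min_le_right _ _)⟩ h2).2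
    have e2 := (hclock c γ _ hc hγ rfl s ⟨hs.1, hs.2.trans_le (min_le_left _ _)⟩
      (hs.2.trans_le (min_le_right _ _))).2
    have e3 : (t : ℂ) ^ 2 = (s : ℂ) ^ 2 := mul_left_cancel₀ hc0 (by rw [← e1, ← e2, hst])
    have e4 : t ^ 2 = s ^ 2 := by exact_mod_cast e3
    rw [(pow_left_inj₀ ht.1 hs.1 two_ne_zero).1 e4, hst, (pow_left_inj₀ ht.1 hs.1 two_ne_zero).1 e4]
  have hmin : 0 < min m (min s₀ (k * ε)) := lt_min hm0 (lt_min hs₀ (mul_pos hk0 hε))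
  have heq : EqOn δ γ (Ioo 0 m) := by
    refine (hδ.mono hm0 (min_le_right _ _)).eqOn (hγ.mono hm0 (min_le_left _ _))
      (t₀ := min m (min s₀ (k * ε)) / 2) ⟨by positivity, ?_⟩ ?_
    · have := min_le_left m (min s₀ (k * ε)); linarith
    · filter_upwards [Ioo_mem_nhds (half_pos hmin) (half_lt_self hmin)] with t ht
      exact hsmall t ⟨ht.1.le, ht.2⟩
  intro t ht hkt
  rcases eq_or_lt_of_le ht.1 with rfl | hpos
  · simp [hf0]
  have : f (γ (k * t / k)) = γ (k * t) :=
    heq (x := k * t) ⟨mul_pos hk0 hpos, lt_min hkt (mul_lt_mul_of_pos_left ht.2 hk0)⟩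
  rwa [mul_div_cancel_left₀ _ hk0.ne'] at this

theorem IsPseudoAnosov.map_horizontal (hf : q.IsPseudoAnosov f lam)
    (hfix : q.FixesCriticalTrajectories f) {γ : ℝ → X} {T : ℝ} (hγ : q.IsHorizontal γ T)
    (h0 : q.IsZero (γ 0)) : ∀ t ∈ Ico 0 T, f (γ (t / lam)) = γ t := by
  have hlam : 0 < lam := one_pos.trans hf.one_lt
  intro t ht
  have h1 := hf.isFlatAffine.map_trajectory hf.nontrivial (one_pow 2) (stretchesBy_one hlam) hγ h0
    (hfix.fixes_zero _ h0) (fun T' h1 h2 => by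
      obtain ⟨ε, hε, -, h⟩ := hfix.fixes_horizontal γ T' (hγ.mono h1 h2) h0
      exact ⟨ε, hε, h⟩) (t / lam)
    ⟨div_nonneg ht.1 hlam.le, (div_le_self ht.1 hf.one_lt.le).trans_lt ht.2⟩
  rw [mul_div_cancel₀ _ hlam.ne'] at h1
  exact h1 ht.2

theorem IsPseudoAnosov.map_vertical (hf : q.IsPseudoAnosov f lam)
    (hfix : q.FixesCriticalTrajectories f) {γ : ℝ → X} {T : ℝ} (hγ : q.IsVertical γ T)
    (h0 : q.IsZero (γ 0)) : ∀ t ∈ Ico 0 T, f (γ t) = γ (t / lam) := by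
  have hlam : 0 < lam := one_pos.trans hf.one_lt
  intro t ht
  have h1 := hf.isFlatAffine.map_trajectory hf.nontrivial (by norm_num) (stretchesBy_neg_one hlam)
    hγ h0
    (hfix.fixes_zero _ h0) (fun T' h1 h2 => by
      obtain ⟨ε, hε, -, h⟩ := hfix.fixes_vertical γ T' (hγ.mono h1 h2) h0
      exact ⟨ε, hε, h⟩) t ht
  rw [inv_mul_eq_div] at h1
  exact h1 ((div_le_self ht.1 hf.one_lt.le).trans_lt ht.2)

/-- Vertical trajectories emanating from a zero are simple curves. -/
theorem IsPseudoAnosov.injOn_vertical (hf : q.IsPseudoAnosov f lam)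
    (hfix : q.FixesCriticalTrajectories f) {γ : ℝ → X} {T : ℝ} (hγ : q.IsVertical γ T)
    (h0 : q.IsZero (γ 0)) : InjOn γ (Ico 0 T) := by
  have hlam : 0 < lam := one_pos.trans hf.one_lt
  obtain ⟨Ψ, K, s₀, hs₀, -, -, -, hclock⟩ := exists_clock hf.nontrivial h0
  intro s hs t ht hst
  have hdiv : ∀ u ∈ Ico 0 T, ∀ n : ℕ, u / lam ^ n ∈ Ico 0 T := fun u hu n =>
    ⟨div_nonneg hu.1 (by positivity),
      (div_le_self hu.1 (one_le_pow₀ hf.one_lt.le)).trans_lt hu.2⟩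
  -- Applying `f` divides both times by λ; after finitely many steps they are so small that the
  -- clock separates them.
  have hiter : ∀ n : ℕ, γ (s / lam ^ n) = γ (t / lam ^ n) := by
    intro n
    induction n with
    | zero => simpa using hst
    | succ n ih =>
      have e : ∀ u : ℝ, u / lam ^ (n + 1) = u / lam ^ n / lam := fun u => by
        rw [pow_succ, div_div]
      rw [e, e, ← hf.map_vertical hfix hγ h0 _ (hdiv s hs n),
        ← hf.map_vertical hfix hγ h0 _ (hdiv t ht n), ih]
  obtain ⟨n, hn⟩ := pow_unbounded_of_one_lt (max s t / s₀) hf.one_lt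
  rw [div_lt_iff₀ hs₀, mul_comm, ← div_lt_iff₀ (by positivity)] at hn
  have hn' : ∀ u, u ≤ max s t → u / lam ^ n < s₀ := fun u hu =>
    (div_le_div_of_nonneg_right hu (by positivity)).trans_lt hn
  have e1 := (hclock (-1) γ T (by norm_num) hγ rfl _ (hdiv s hs n) (hn' s (le_max_left _ _))).2
  have e2 := (hclock (-1) γ T (by norm_num) hγ rfl _ (hdiv t ht n) (hn' t (le_max_right _ _))).2
  rw [hiter n, e2] at e1
  have e3 : (t / lam ^ n) ^ 2 = (s / lam ^ n) ^ 2 := by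
    have := mul_left_cancel₀ (by norm_num) e1
    exact_mod_cast this
  have e4 := (pow_left_inj₀ (hdiv t ht n).1 (hdiv s hs n).1 two_ne_zero).1 e3
  exact (div_left_inj' (by positivity)).1 e4.symm

/-- A complete horizontal trajectory emanating from a zero. -/
structure IsSeparatrix (q : QuadraticDifferential X) (g : ℝ → X) : Prop where
  isZero : q.IsZero (g 0)
  horizontal : ∀ T, 0 < T → q.IsHorizontal g T


/-- Every horizontal trajectory emanating from a zero extends to all positive times. -/
theorem IsPseudoAnosov.exists_isSeparatrix (hf : q.IsPseudoAnosov f lam)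
    (hfix : q.FixesCriticalTrajectories f) {γ : ℝ → X} {T : ℝ} (hγ : q.IsHorizontal γ T)
    (h0 : q.IsZero (γ 0)) : ∃ g, q.IsSeparatrix g ∧ EqOn γ g (Ico 0 T) := by
  have hlam : 0 < lam := one_pos.trans hf.one_lt
  -- `G n` is fⁿ ∘ γ with time divided by λⁿ. It lives on [0, λⁿ T), and by `map_horizontal` these
  -- curves extend one another.
  set G : ℕ → ℝ → X := fun n => (fun (g : ℝ → X) t => f (g (t / lam)))^[n] γ with hG
  have hGs : ∀ n t, G (n + 1) t = f (G n (t / lam)) := fun n t => by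
    simp only [hG, Function.iterate_succ_apply']
  have hTr : ∀ n, q.IsHorizontal (G n) (lam ^ n * T) ∧ q.IsZero (G n 0) := by
    intro n
    induction n with
    | zero => simpa [hG] using ⟨hγ, h0⟩
    | succ n ih =>
      constructor
      · have := hf.isFlatAffine.isTrajectory (stretchesBy_one hlam) ih.1
        rw [← mul_assoc, ← pow_succ'] at this
        exact this.congr fun t _ => hGs n t
      · rw [hGs, zero_div, hf.zero_iff]; exact ih.2
  have hTmono : Monotone fun n : ℕ => lam ^ n * T := fun m n h =>
    mul_le_mul_of_nonneg_right (pow_le_pow_right₀ hf.one_lt.le h) hγ.pos.le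
  have hagree : ∀ m n, m ≤ n → ∀ t ∈ Ico 0 (lam ^ m * T), G n t = G m t := by
    intro m n hmn
    induction n, hmn using Nat.le_induction with
    | base => simp
    | succ n hmn ih =>
      intro t ht
      rw [← ih t ht, hGs]
      exact hf.map_horizontal hfix (hTr n).1 (hTr n).2 t ⟨ht.1, ht.2.trans_le (hTmono hmn)⟩
  have hex : ∀ t : ℝ, ∃ n : ℕ, t < lam ^ n * T := fun t => by
    obtain ⟨n, hn⟩ := pow_unbounded_of_one_lt (t / T) hf.one_lt
    exact ⟨n, (div_lt_iff₀ hγ.pos).1 hn⟩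
  choose N hN using hex
  have heq : ∀ n, EqOn (fun t => G (N t) t) (G n) (Ico 0 (lam ^ n * T)) := by
    intro n t ht
    rcases le_total (N t) n with h | h
    · exact (hagree _ _ h t ⟨ht.1, hN t⟩).symm
    · exact hagree _ _ h t ht
  refine ⟨fun t => G (N t) t, ⟨?_, fun T' hT' => ?_⟩, fun t ht => ?_⟩
  · have := heq 0 (x := 0) ⟨le_rfl, by simpa using hγ.pos⟩
    change q.IsZero (G (N 0) 0)
    rw [show G (N 0) 0 = G 0 0 from this]; exact (hTr 0).2
  · have h1 := (hTr (N T')).1.congr (heq (N T'))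
    exact h1.mono hT' (hN T').le
  · exact (heq 0 (by simpa using ht)).symm

/-- There are finitely many complete horizontal trajectories emanating from zeros. -/
theorem exists_finite_separatrices [CompactSpace X] (hq : ∃ p, ¬ q.IsZero p) :
    ∃ 𝒢 : Set (ℝ → X), 𝒢.Finite ∧ (∀ g ∈ 𝒢, q.IsSeparatrix g) ∧
      ∀ g, q.IsSeparatrix g → ∃ g' ∈ 𝒢, EqOn g g' (Ici 0) := by
  choose! Ψ K s₀ hs₀ hK hKz hfin hclock using fun p (hp : q.IsZero p) => exists_clock hq hp
  -- A separatrix is determined by its zero and its position at half the clock range; that position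
  -- lies in a finite level set of Ψ.
  set σ : (ℝ → X) → X × X := fun g => (g 0, g (s₀ (g 0) / 2)) with hσ
  have hval : ∀ g, q.IsSeparatrix g → ∀ t, 0 ≤ t → t < s₀ (g 0) →
      g t ∈ K (g 0) ∧ Ψ (g 0) (g t) = t ^ 2 := by
    intro g hg t ht hts
    have := hclock (g 0) hg.isZero 1 g (t + 1) (one_pow 2) (hg.horizontal _ (by linarith)) rfl t
      ⟨ht, by linarith⟩ hts
    simpa using this
  have hσfin : (σ '' {g | q.IsSeparatrix g}).Finite := by
    have h1 : (⋃ p ∈ {p | q.IsZero p}, Prod.mk p '' {x ∈ K p | Ψ p x = ((s₀ p / 2 : ℝ) : ℂ) ^ 2}).Finite := by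
      refine (finite_isZero hq).biUnion fun p hp => (hfin p hp _ ?_).image _
      exact pow_ne_zero 2 (Complex.ofReal_ne_zero.2 (half_pos (hs₀ p hp)).ne')
    refine h1.subset ?_
    rintro _ ⟨g, hg, rfl⟩
    have h2 := hs₀ _ hg.isZero
    exact mem_biUnion (show g 0 ∈ {p | q.IsZero p} from hg.isZero)
      ⟨_, hval g hg _ (half_pos h2).le (half_lt_self h2), rfl⟩
  have hchoose : ∀ y ∈ σ '' {g | q.IsSeparatrix g}, ∃ g, q.IsSeparatrix g ∧ σ g = y := fun y hy => hy
  choose! sec hsec hsecσ using hchoose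
  refine ⟨sec '' (σ '' {g | q.IsSeparatrix g}), hσfin.image _, ?_, fun g hg => ?_⟩
  · rintro _ ⟨y, hy, rfl⟩
    exact hsec y hy
  have hy : σ g ∈ σ '' {g | q.IsSeparatrix g} := ⟨g, hg, rfl⟩
  refine ⟨_, ⟨σ g, hy, rfl⟩, ?_⟩
  set g' := sec (σ g) with hg'def
  have hg' : q.IsSeparatrix g' := hsec _ hy
  have hσeq := hsecσ _ hy
  rw [← hg'def] at hσeq
  have h00 : g' 0 = g 0 := congrArg Prod.fst hσeq
  set t₁ := s₀ (g 0) / 2 with ht₁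
  have hs0 := hs₀ _ hg.isZero
  have ht₁0 : 0 < t₁ := half_pos hs0
  have ht₁1 : t₁ < s₀ (g 0) := half_lt_self hs0
  have h11 : g' t₁ = g t₁ := by
    have := congrArg Prod.snd hσeq
    simp only [hσ, h00] at this
    exact this
  have hmem : t₁ ∈ Ioo 0 (t₁ + 1) := ⟨ht₁0, by linarith⟩
  have hh := hg.horizontal (t₁ + 1) (by linarith)
  have hh' := hg'.horizontal (t₁ + 1) (by linarith)
  obtain ⟨ψ, hψ, hs⟩ := q.exists_isFlat (hh.regular t₁ hmem)
  obtain ⟨v, hv, hva⟩ := hh.eventually_affine hψ hmem hs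
  obtain ⟨w, hw, hwa⟩ := hh'.eventually_affine hψ hmem (by rwa [h11])
  -- Opposite velocities would give g(s) = g'(2 t₁ - s), and the clock would read s² = (2 t₁ - s)²
  -- for some s > t₁.
  have hwv : w = v := by
    rcases sq_eq_sq_iff_eq_or_eq_neg.1 (hw.trans hv.symm) with h | h
    · exact h
    exfalso
    have hrefl : Tendsto (fun s => 2 * t₁ - s) (𝓝 t₁) (𝓝 t₁) := by
      have : Continuous fun s : ℝ => 2 * t₁ - s := by fun_prop
      simpa [two_mul] using this.tendsto t₁
    have hbd : ∀ᶠ s in 𝓝 t₁, s ∈ Ioo 0 (s₀ (g 0)) := Ioo_mem_nhds ht₁0 ht₁1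
    obtain ⟨s, ⟨⟨ha1, ha2⟩, ⟨hb1, hb2⟩, hc1, hc2⟩, hlt⟩ := (((hva.filter_mono nhdsWithin_le_nhds).and
      (((hrefl.eventually hwa).filter_mono nhdsWithin_le_nhds).and
      ((hbd.filter_mono nhdsWithin_le_nhds).and
        ((hrefl.eventually hbd).filter_mono nhdsWithin_le_nhds)))).and
      (self_mem_nhdsWithin : Ioi t₁ ∈ 𝓝[>] t₁)).exists
    have hgg : g s = g' (2 * t₁ - s) := by
      refine ψ.injOn ha1 hb1 ?_
      rw [ha2, hb2, h11, h]; push_cast; ring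
    have e1 := (hval g hg s hc1.1.le hc1.2).2
    have e2 := (hval g' hg' (2 * t₁ - s) hc2.1.le (by rw [h00]; exact hc2.2)).2
    rw [h00, ← hgg, e1] at e2
    have e3 : s ^ 2 = (2 * t₁ - s) ^ 2 := by exact_mod_cast e2
    have e4 := (pow_left_inj₀ hc1.1.le hc2.1.le two_ne_zero).1 e3
    have : t₁ < s := hlt
    linarith
  have hgerm : g =ᶠ[𝓝 t₁] g' := by
    filter_upwards [hva, hwa] with s h1 h2
    refine ψ.injOn h1.1 h2.1 ?_
    rw [h1.2, h2.2, hwv, h11]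
  intro t ht
  rcases eq_or_lt_of_le (show 0 ≤ t from ht) with rfl | hpos
  · exact h00.symm
  have hT : 0 < t + t₁ := by linarith
  exact (hg.horizontal _ hT).eqOn (hg'.horizontal _ hT) (t₀ := t₁) ⟨ht₁0, by linarith⟩ hgerm
    ⟨hpos, by linarith⟩

end QuadraticDifferential

/-! ### Invariance of the vertical segment J and of the horizontal segments Γ. -/

namespace QuadraticDifferential

variable {X : Type*} [TopologicalSpace X] [ChartedSpace ℂ X] {q : QuadraticDifferential X}
  {ψ : OpenPartialHomeomorph X ℂ}

theorem IsTrajectory.shift {c : ℂ} {γ : ℝ → X} {T a : ℝ} (h : q.IsTrajectory c γ T) (ha : 0 ≤ a)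
    (haT : a < T) : q.IsTrajectory c (fun t => γ (a + t)) (T - a) := by
  have hm : ∀ t ∈ Ioo 0 (T - a), a + t ∈ Ioo 0 T := fun t ht =>
    ⟨by linarith [ht.1], by linarith [ht.2]⟩
  refine ⟨sub_pos.2 haT, h.cont.comp (by fun_prop) fun t ht => ⟨by linarith [ht.1],
    by linarith [ht.2]⟩, fun t ht => h.regular _ (hm t ht), fun t ht e he hte => ?_⟩
  obtain ⟨v, hv, hq⟩ := h.speed _ (hm t ht) e he hte
  exact ⟨v, by simpa using hv.comp_const_add a t, hq⟩

/-- In a flat coordinate a trajectory is a straight line near its regular initial point. -/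
theorem IsTrajectory.exists_affine_initial {c : ℂ} {η : ℝ → X} {T : ℝ}
    (h : q.IsTrajectory c η T) (hψ : q.IsFlat ψ) (hx : η 0 ∈ ψ.source) :
    ∃ w : ℂ, w ^ 2 = c ∧ ∀ᶠ r in 𝓝[>] (0 : ℝ), η r ∈ ψ.source ∧ ψ (η r) = ψ (η 0) + r * w := by
  have h0 : ContinuousWithinAt η (Ico 0 T) 0 := h.cont 0 ⟨le_rfl, h.pos⟩
  have hIoi : 𝓝[>] (0 : ℝ) ≤ 𝓝[Ico 0 T] 0 := by
    rw [← nhdsWithin_Ioo_eq_nhdsGT h.pos]; exact nhdsWithin_mono _ Ioo_subset_Ico_self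
  have hev : ∀ᶠ r in 𝓝[>] (0 : ℝ), η r ∈ ψ.source ∧ r ∈ Ioo 0 T :=
    Filter.Eventually.and (hIoi (h0.preimage_mem_nhdsWithin (ψ.open_source.mem_nhds hx)))
      (Ioo_mem_nhdsGT h.pos)
  obtain ⟨δ, hδ, hsub⟩ := mem_nhdsGT_iff_exists_Ioo_subset.1 hev
  have hδ0 : (0 : ℝ) < δ := hδ
  choose! v hv hv2 using fun r (hr : r ∈ Ioo 0 δ) =>
    h.hasDerivAt_flat hψ (hsub hr).2 (hsub hr).1
  obtain ⟨w, hw, haff⟩ := exists_velocity_of_sq_deriv_eq (convex_Ioo 0 δ) hv hv2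
  refine ⟨w, hw, ?_⟩
  filter_upwards [Ioo_mem_nhdsGT hδ0] with r hr
  refine ⟨(hsub hr).1, ?_⟩
  have l1 : Tendsto (fun s => ψ (η r) - ψ (η s)) (𝓝[>] 0) (𝓝 (ψ (η r) - ψ (η 0))) :=
    ((ψ.continuousAt hx).tendsto.comp (h0.tendsto.mono_left hIoi)).const_sub _
  have l2 : Tendsto (fun s => ψ (η r) - ψ (η s)) (𝓝[>] 0) (𝓝 (r * w)) := by
    have hc : Continuous fun s : ℝ => ((r - s : ℝ) : ℂ) * w := by fun_prop
    have h1 : Tendsto (fun s : ℝ => ((r - s : ℝ) : ℂ) * w) (𝓝[>] 0) (𝓝 (r * w)) := by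
      simpa using (hc.tendsto 0).mono_left nhdsWithin_le_nhds
    refine h1.congr' ?_
    filter_upwards [Ioo_mem_nhdsGT hδ0] with s hs using (haff s hs r hr).symm
  rw [← tendsto_nhds_unique l1 l2]; ring

theorem IsSeparatrix.map [T2Space X] [ConnectedSpace X] [IsManifold 𝓘(ℂ) ω X] {f : X ≃ₜ X}
    {lam : ℝ} {g : ℝ → X} (hg : q.IsSeparatrix g) (hf : q.IsPseudoAnosov f lam)
    (hfix : q.FixesCriticalTrajectories f) {t : ℝ} (ht : 0 ≤ t) : f (g (t / lam)) = g t :=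
  hf.map_horizontal hfix (hg.horizontal (t + 1) (by linarith)) hg.isZero t ⟨ht, by linarith⟩

theorem countable_im_separatrices {𝒢 : Set (ℝ → X)} (h𝒢 : 𝒢.Countable)
    (hsep : ∀ g ∈ 𝒢, q.IsSeparatrix g) (hψ : q.IsFlat ψ) :
    {y | ∃ g ∈ 𝒢, ∃ t, 0 ≤ t ∧ g t ∈ ψ.source ∧ (ψ (g t)).im = y}.Countable := by
  have h1 : (⋃ g ∈ 𝒢, ⋃ n : ℕ, {y | ∃ t ∈ Ioo 0 ((n : ℝ) + 1), g t ∈ ψ.source ∧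
      (ψ (g t)).im = y}).Countable :=
    h𝒢.biUnion fun g hg => countable_iUnion fun n =>
      ((hsep g hg).horizontal (n + 1) (by positivity)).countable_im hψ
  refine h1.mono ?_
  rintro y ⟨g, hg, t, ht, hs, rfl⟩
  have ht0 : t ≠ 0 := by rintro rfl; exact hψ.not_isZero hs (hsep g hg).isZero
  obtain ⟨n, hn⟩ := exists_nat_gt t
  exact mem_biUnion hg (mem_iUnion.2 ⟨n, t, ⟨lt_of_le_of_ne ht ht0.symm, by linarith⟩, hs, rfl⟩)

theorem IsTrajectory.countable_re_of_isZero {β : ℝ → X} {T : ℝ} (h : q.IsVertical β T)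
    (h0 : q.IsZero (β 0)) (hψ : q.IsFlat ψ) :
    {x | ∃ t ∈ Ico 0 T, β t ∈ ψ.source ∧ (ψ (β t)).re = x}.Countable := by
  refine (h.countable_re hψ).mono ?_
  rintro x ⟨t, ht, hs, rfl⟩
  have ht0 : t ≠ 0 := by rintro rfl; exact hψ.not_isZero hs h0
  exact ⟨t, ⟨lt_of_le_of_ne ht.1 ht0.symm, ht.2⟩, hs, rfl⟩

namespace RectangularDecomposition

variable {n : ℕ}

/-- The vertical segment `J = β '' [0, b]`. -/
def verticalSegment (D : RectangularDecomposition q n) : Set X := D.β '' Icc 0 D.b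

/-- The horizontal leaves issuing from the zeros, up to their first hits. -/
def criticalLeaves (D : RectangularDecomposition q n) : Set X :=
  q.criticalLeavesUpTo (D.β '' Icc 0 D.b₀)

/-- The union of the drawn horizontal segments. -/
def horizontalSegments (D : RectangularDecomposition q n) : Set X :=
  D.criticalLeaves ∪ q.undrawnLeavesUpTo D.criticalLeaves D.verticalSegment (D.β D.b)

theorem range_R_eq (D : RectangularDecomposition q n) :
    range D.R = componentsOf (D.verticalSegment ∪ D.horizontalSegments)ᶜ := D.range_R

theorem b_mem (D : RectangularDecomposition q n) : D.b ∈ Icc 0 D.b₀ := D.isLeast.1.1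

theorem Icc_b_subset (D : RectangularDecomposition q n) : Icc 0 D.b ⊆ Ico 0 D.T :=
  fun _ ht => ⟨ht.1, (ht.2.trans D.b_mem.2).trans_lt D.b₀_mem.2⟩

variable [T2Space X] [ConnectedSpace X] [IsManifold 𝓘(ℂ) ω X] {f : X ≃ₜ X} {lam : ℝ}
  (D : RectangularDecomposition q n)

theorem map_verticalSegment (hf : q.IsPseudoAnosov f lam) (hfix : q.FixesCriticalTrajectories f)
    {x : X} (hx : x ∈ D.verticalSegment) : f x ∈ D.verticalSegment := by
  obtain ⟨t, ht, rfl⟩ := hx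
  have hlam : 0 < lam := one_pos.trans hf.one_lt
  rw [hf.map_vertical hfix D.vertical D.start_zero t (D.Icc_b_subset ht)]
  exact ⟨t / lam, ⟨div_nonneg ht.1 hlam.le, (div_le_self ht.1 hf.one_lt.le).trans ht.2⟩, rfl⟩

/-- The inverse of `f` moves a point of a leaf towards its zero, and a leaf drawn up to its first
hit contains all its initial pieces. -/
theorem symm_criticalLeaves (hf : q.IsPseudoAnosov f lam) (hfix : q.FixesCriticalTrajectories f)
    {x : X} (hx : x ∈ D.criticalLeaves) : f.symm x ∈ D.criticalLeaves := by
  obtain ⟨γ, T, t, hγ, h0, ht, hhit, rfl⟩ := hx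
  have hlam : 0 < lam := one_pos.trans hf.one_lt
  have hle : t / lam ≤ t := div_le_self ht.1 hf.one_lt.le
  rw [← hf.map_horizontal hfix hγ h0 t ht, f.symm_apply_apply]
  exact ⟨γ, T, t / lam, hγ, h0, ⟨div_nonneg ht.1 hlam.le, hle.trans_lt ht.2⟩,
    fun s hs => hhit s ⟨hs.1, hs.2.trans_le hle⟩, rfl⟩

/-- Apart from the finitely many zeros, each of the finitely many separatrices contributes at most
its first hit at a positive time. -/
theorem finite_criticalLeaves_inter [CompactSpace X] (hf : q.IsPseudoAnosov f lam)
    (hfix : q.FixesCriticalTrajectories f) :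
    (D.criticalLeaves ∩ D.β '' Icc 0 D.b₀).Finite := by
  obtain ⟨𝒢, h𝒢, -, hrep⟩ := exists_finite_separatrices hf.nontrivial
  set K := D.β '' Icc 0 D.b₀ with hK
  have h1 : ({p | q.IsZero p} ∪ ⋃ g ∈ 𝒢, {x | ∃ t, 0 < t ∧ g t ∈ K ∧ (∀ s ∈ Ioo 0 t, g s ∉ K) ∧
      x = g t}).Finite := by
    refine (finite_isZero hf.nontrivial).union (h𝒢.biUnion fun g _ => Set.Subsingleton.finite ?_)
    rintro _ ⟨t, ht, htK, hth, rfl⟩ _ ⟨s, hs, hsK, hsh, rfl⟩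
    rcases lt_trichotomy t s with h | h | h
    · exact absurd htK (hsh t ⟨ht, h⟩)
    · rw [h]
    · exact absurd hsK (hth s ⟨hs, h⟩)
  refine h1.subset ?_
  rintro _ ⟨⟨γ, T, t, hγ, h0, ht, hhit, rfl⟩, hxK⟩
  rcases eq_or_lt_of_le ht.1 with rfl | hpos
  · exact Or.inl h0
  right
  obtain ⟨g, hg, hgeq⟩ := hf.exists_isSeparatrix hfix hγ h0
  obtain ⟨g', hg', hgeq'⟩ := hrep g hg
  have heq : ∀ s ∈ Ico 0 T, γ s = g' s := fun s hs => (hgeq hs).trans (hgeq' hs.1)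
  refine mem_biUnion hg' ⟨t, hpos, ?_, fun s hs => ?_, heq t ht⟩
  · rwa [← heq t ht]
  · rw [← heq s ⟨hs.1.le, hs.2.trans ht.2⟩]; exact hhit s hs

/-- By finiteness there is a last meeting time `m`, and minimality of `b` together with simplicity
of β gives b = m. If there is no meeting, minimality gives b = 0. -/
theorem endpoint_eq_zero_or_mem [CompactSpace X] (hf : q.IsPseudoAnosov f lam)
    (hfix : q.FixesCriticalTrajectories f) : D.b = 0 ∨ D.β D.b ∈ D.criticalLeaves := by
  have hb₀ : Icc 0 D.b₀ ⊆ Ico 0 D.T := fun t ht => ⟨ht.1, ht.2.trans_lt D.b₀_mem.2⟩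
  have hinj := (hf.injOn_vertical hfix D.vertical D.start_zero).mono hb₀
  set S := Icc 0 D.b₀ ∩ D.β ⁻¹' D.criticalLeaves with hS
  have hSfin : S.Finite := by
    refine Set.Finite.of_finite_image ((D.finite_criticalLeaves_inter hf hfix).subset ?_)
      (hinj.mono inter_subset_left)
    rintro _ ⟨s, hs, rfl⟩
    exact ⟨hs.2, s, hs.1, rfl⟩
  rcases S.eq_empty_or_nonempty with hSe | hSne
  · refine Or.inl (le_antisymm (D.isLeast.2 ⟨⟨le_rfl, D.b₀_mem.1.le⟩, ?_⟩) D.b_mem.1)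
    rintro _ ⟨hx, s, hs, rfl⟩
    exact absurd (show s ∈ S from ⟨hs, hx⟩) (by simp [hSe])
  right
  obtain ⟨m, hm, hmax⟩ := hSfin.isCompact.exists_isGreatest hSne
  have hbm : D.b ≤ m := D.isLeast.2 ⟨hm.1, by
    rintro _ ⟨hx, s, hs, rfl⟩
    exact ⟨s, ⟨hs.1, hmax ⟨hs, hx⟩⟩, rfl⟩⟩
  obtain ⟨s, hs, hsm⟩ := D.isLeast.1.2 ⟨hm.2, m, hm.1, rfl⟩
  have hsm' : s = m := hinj ⟨hs.1, hs.2.trans D.b_mem.2⟩ hm.1 hsm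
  have : m = D.b := le_antisymm (hsm' ▸ hs.2) hbm
  rw [← this]; exact hm.2

/-- A leaf issuing from the end point of `J` in a direction not yet drawn continues a
separatrix. -/
theorem exists_separatrix_of_undrawn [CompactSpace X] (hf : q.IsPseudoAnosov f lam)
    (hfix : q.FixesCriticalTrajectories f) {η : ℝ → X} {T : ℝ} (hη : q.IsHorizontal η T)
    (h0 : η 0 = D.β D.b) (hun : ∃ ε > 0, ∀ s ∈ Ioo 0 ε, s < T → η s ∉ D.criticalLeaves) :
    ∃ g t₁, q.IsSeparatrix g ∧ 0 ≤ t₁ ∧ (∀ s ∈ Icc 0 t₁, g s ∈ D.criticalLeaves) ∧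
      ∀ r ∈ Ico 0 T, η r = g (t₁ + r) := by
  by_cases hz : q.IsZero (η 0)
  · obtain ⟨g, hg, hgeq⟩ := hf.exists_isSeparatrix hfix hη hz
    refine ⟨g, 0, hg, le_rfl, fun s hs => ?_, fun r hr => by rw [zero_add]; exact hgeq hr⟩
    obtain rfl : s = 0 := le_antisymm hs.2 hs.1
    exact ⟨g, 1, 0, hg.horizontal 1 one_pos, hg.isZero, by simp, by simp, rfl⟩
  have hmem : D.β D.b ∈ D.criticalLeaves := by
    rcases D.endpoint_eq_zero_or_mem hf hfix with h | h
    · rw [h0, h] at hz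
      exact absurd D.start_zero hz
    · exact h
  obtain ⟨γ, T₁, t₁, hγ, hγ0, ht₁, hhit, hγt⟩ := hmem
  obtain ⟨g, hg, hgeq⟩ := hf.exists_isSeparatrix hfix hγ hγ0
  have hdrawn : ∀ s ∈ Icc 0 t₁, g s ∈ D.criticalLeaves := fun s hs => by
    have hsT : s ∈ Ico 0 T₁ := ⟨hs.1, hs.2.trans_lt ht₁.2⟩
    rw [← hgeq hsT]
    exact ⟨γ, T₁, s, hγ, hγ0, hsT, fun u hu => hhit u ⟨hu.1, hu.2.trans_le hs.2⟩, rfl⟩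
  refine ⟨g, t₁, hg, ht₁.1, hdrawn, ?_⟩
  have hη0 : η 0 = g t₁ := by rw [h0, hγt, hgeq ht₁]
  have ht₁0 : 0 < t₁ := ht₁.1.lt_of_ne fun h => hz (by rw [hη0, ← h]; exact hg.isZero)
  have hTpos := hη.pos
  have hgT := hg.horizontal (t₁ + T) (by linarith)
  have hm₁ : t₁ ∈ Ioo 0 (t₁ + T) := ⟨ht₁0, by linarith⟩
  obtain ⟨ψ, hψ, hs⟩ := q.exists_isFlat hz
  obtain ⟨w, hw, hwa⟩ := hη.exists_affine_initial hψ hs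
  obtain ⟨v, hv, hva⟩ := hgT.eventually_affine hψ hm₁ (hη0 ▸ hs)
  have htend : ∀ c : ℝ, Tendsto (fun r => t₁ + c * r) (𝓝[>] 0) (𝓝 t₁) := fun c => by
    have : Continuous fun r : ℝ => t₁ + c * r := by fun_prop
    simpa using (this.tendsto 0).mono_left nhdsWithin_le_nhds
  -- The separatrix `g` reaches the end point through drawn points. The velocity opposite to that of
  -- `g` would retrace them, so an undrawn direction must continue `g`.
  have hwv : w = v := by
    rcases sq_eq_sq_iff_eq_or_eq_neg.1 (hw.trans hv.symm) with h | h
    · exact h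
    exfalso
    obtain ⟨ε, hε, hεn⟩ := hun
    obtain ⟨r, ⟨h1, h2⟩, ⟨h3, h4⟩, h5, h6⟩ := (hwa.and (((htend (-1)).eventually hva).and
      (Filter.Eventually.and (Ioo_mem_nhdsGT (lt_min hε hTpos)) (Ioo_mem_nhdsGT ht₁0)))).exists
    refine hεn r ⟨h5.1, h5.2.trans_le (min_le_left _ _)⟩ (h5.2.trans_le (min_le_right _ _)) ?_
    have : η r = g (t₁ + -1 * r) := by
      refine ψ.injOn h1 h3 ?_
      rw [h2, h4, hη0, h]; push_cast; ring
    rw [this]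
    exact hdrawn _ ⟨by linarith [h6.2], by linarith [h6.1]⟩
  have hgs := hgT.shift ht₁.1 hm₁.2
  rw [add_sub_cancel_left] at hgs
  have hgerm : ∀ᶠ r in 𝓝[>] (0 : ℝ), η r = g (t₁ + r) := by
    filter_upwards [hwa, (htend 1).eventually hva] with r h1 h2
    rw [one_mul] at h2
    refine ψ.injOn h1.1 h2.1 ?_
    rw [h1.2, h2.2, hwv, hη0]; push_cast; ring
  obtain ⟨δ, hδ, hsub⟩ := mem_nhdsGT_iff_exists_Ioo_subset.1 hgerm
  have hδ0 : (0 : ℝ) < δ := hδ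
  have hδT : 0 < min δ T := lt_min hδ0 hTpos
  have heq := hη.eqOn hgs (t₀ := min δ T / 2) ⟨half_pos hδT, (half_lt_self hδT).trans_le
    (min_le_right _ _)⟩ (by
      filter_upwards [Ioo_mem_nhds (half_pos hδT) (half_lt_self hδT)] with r hr
      exact hsub ⟨hr.1, hr.2.trans_le (min_le_left _ _)⟩)
  intro r hr
  rcases eq_or_lt_of_le hr.1 with rfl | hpos
  · rw [add_zero, hη0]
  · exact heq ⟨hpos, hr.2⟩

/-- The extra leaf from the end of J continues a separatrix past time `t₁`. Division of time by λ
leads either to the part drawn before `t₁` or to an earlier point of the extra leaf. -/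
theorem symm_horizontalSegments [CompactSpace X] (hf : q.IsPseudoAnosov f lam)
    (hfix : q.FixesCriticalTrajectories f) {x : X} (hx : x ∈ D.horizontalSegments) :
    f.symm x ∈ D.horizontalSegments := by
  have hlam : 0 < lam := one_pos.trans hf.one_lt
  rcases hx with hx | ⟨η, T, t, hη, h0, hun, ht, hhit, rfl⟩
  · exact Or.inl (D.symm_criticalLeaves hf hfix hx)
  obtain ⟨g, t₁, hg, ht₁, hdrawn, heq⟩ := D.exists_separatrix_of_undrawn hf hfix hη h0 hun
  have hu : 0 ≤ t₁ + t := add_nonneg ht₁ ht.1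
  rw [heq t ht, ← hg.map hf hfix hu, f.symm_apply_apply]
  have hle : (t₁ + t) / lam ≤ t₁ + t := div_le_self hu hf.one_lt.le
  rcases le_or_gt ((t₁ + t) / lam) t₁ with h | h
  · exact Or.inl (hdrawn _ ⟨div_nonneg hu hlam.le, h⟩)
  · right
    have hr : (t₁ + t) / lam - t₁ ∈ Ico 0 T :=
      ⟨by linarith, by linarith [ht.2]⟩
    refine ⟨η, T, (t₁ + t) / lam - t₁, hη, h0, hun, hr, fun s hs => hhit s ⟨hs.1, ?_⟩, ?_⟩
    · linarith [hs.2]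
    · rw [heq _ hr, add_sub_cancel]

/-- The drawn horizontal segments are contained in finitely many separatrices. -/
theorem exists_separatrices_covering [CompactSpace X] (hf : q.IsPseudoAnosov f lam)
    (hfix : q.FixesCriticalTrajectories f) :
    ∃ 𝒢 : Set (ℝ → X), 𝒢.Finite ∧ (∀ g ∈ 𝒢, q.IsSeparatrix g) ∧
      ∀ x ∈ D.horizontalSegments, ∃ g ∈ 𝒢, ∃ t, 0 ≤ t ∧ g t = x := by
  obtain ⟨𝒢, h𝒢, hsep, hrep⟩ := exists_finite_separatrices hf.nontrivial
  refine ⟨𝒢, h𝒢, hsep, ?_⟩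
  rintro x (⟨γ, T, t, hγ, h0, ht, -, rfl⟩ | ⟨η, T, t, hη, h0, hun, ht, -, rfl⟩)
  · obtain ⟨g, hg, hgeq⟩ := hf.exists_isSeparatrix hfix hγ h0
    obtain ⟨g', hg', hgeq'⟩ := hrep g hg
    exact ⟨g', hg', t, ht.1, by rw [hgeq ht, hgeq' ht.1]⟩
  · obtain ⟨g, t₁, hg, ht₁, -, heq⟩ := D.exists_separatrix_of_undrawn hf hfix hη h0 hun
    obtain ⟨g', hg', hgeq'⟩ := hrep g hg
    have hu : 0 ≤ t₁ + t := add_nonneg ht₁ ht.1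
    exact ⟨g', hg', t₁ + t, hu, by rw [heq t ht, hgeq' hu]⟩

end RectangularDecomposition

end QuadraticDifferential

/-! ### Parametrized rectangles and the drawn segments. -/

theorem exists_preimage_Ioo {a : ℝ} (ha : a ≠ 0) (c l : ℝ) :
    ∃ α, ∀ x, a * x + c ∈ Ioo 0 l ↔ x ∈ Ioo α (α + l / |a|) := by
  rcases ha.lt_or_gt with h | h
  · refine ⟨(l - c) / a, fun x => ?_⟩
    rw [abs_of_neg h, show (l - c) / a + l / -a = -c / a by field_simp; ring, mem_Ioo, mem_Ioo,
      div_lt_iff_of_neg h, lt_div_iff_of_neg h]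
    constructor <;> rintro ⟨h1, h2⟩ <;> constructor <;> linarith
  · refine ⟨-c / a, fun x => ?_⟩
    rw [abs_of_pos h, show -c / a + l / a = (l - c) / a by field_simp; ring, mem_Ioo, mem_Ioo,
      div_lt_iff₀ h, lt_div_iff₀ h]
    constructor <;> rintro ⟨h1, h2⟩ <;> constructor <;> linarith

theorem Set.Countable.false_of_isOpen {s U : Set ℝ} (hs : s.Countable) (hU : IsOpen U)
    (hne : U.Nonempty) (hsub : U ⊆ s) : False := by
  obtain ⟨x, hx, hxs⟩ := (hs.dense_compl ℝ).inter_open_nonempty U hU hne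
  exact hxs (hsub hx)

namespace QuadraticDifferential

variable {X : Type*} [TopologicalSpace X] [ChartedSpace ℂ X] {q : QuadraticDifferential X}

/-- A parametrization `Φ` of a metric rectangle together with its inverse flat coordinate `ψ`. -/
structure IsRectParam (q : QuadraticDifferential X) (R : Set X) (l h : ℝ) (Φ : ℂ → X)
    (ψ : OpenPartialHomeomorph X ℂ) : Prop where
  l_pos : 0 < l
  h_pos : 0 < h
  cont : ContinuousOn Φ (Icc 0 l ×ℂ Icc 0 h)
  flat : q.IsFlat ψ
  source : ψ.source = R
  target : ψ.target = Ioo 0 l ×ℂ Ioo 0 h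
  symm : ψ.symm = Φ

theorem IsMetricRectangle.exists_isRectParam {R : Set X} {l h : ℝ}
    (hR : q.IsMetricRectangle R l h) : ∃ Φ ψ, q.IsRectParam R l h Φ ψ := by
  obtain ⟨hl, hh, Φ, hc, hi, him, hd⟩ := hR
  obtain ⟨ψ, h1, h2, h3, h4⟩ := IsMetricRectangle.exists_isFlat hc hi him hd
  exact ⟨Φ, ψ, hl, hh, hc, h1, h2, h3, h4⟩

namespace IsRectParam

variable {R : Set X} {l h : ℝ} {Φ : ℂ → X} {ψ : OpenPartialHomeomorph X ℂ}

theorem isOpen (H : q.IsRectParam R l h Φ ψ) : IsOpen R := H.source ▸ ψ.open_source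

theorem right_inv (H : q.IsRectParam R l h Φ ψ) {z : ℂ} (hz : z ∈ Ioo 0 l ×ℂ Ioo 0 h) :
    ψ (Φ z) = z := by
  rw [← H.symm]; exact ψ.right_inv (H.target ▸ hz)

theorem left_inv (H : q.IsRectParam R l h Φ ψ) {x : X} (hx : x ∈ R) : Φ (ψ x) = x := by
  rw [← H.symm]; exact ψ.left_inv (H.source ▸ hx)

theorem map_mem (H : q.IsRectParam R l h Φ ψ) {z : ℂ} (hz : z ∈ Ioo 0 l ×ℂ Ioo 0 h) : Φ z ∈ R := by
  rw [← H.symm, ← H.source]; exact ψ.map_target (H.target ▸ hz)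

theorem coord_mem (H : q.IsRectParam R l h Φ ψ) {x : X} (hx : x ∈ R) :
    ψ x ∈ Ioo 0 l ×ℂ Ioo 0 h := by
  rw [← H.target]; exact ψ.map_source (H.source ▸ hx)

theorem mem_closure (H : q.IsRectParam R l h Φ ψ) {z : ℂ} (hz : z ∈ Icc 0 l ×ℂ Icc 0 h) :
    z ∈ closure (Ioo 0 l ×ℂ Ioo 0 h) := by
  rwa [closure_reProdIm, closure_Ioo H.l_pos.ne, closure_Ioo H.h_pos.ne]

theorem tendsto (H : q.IsRectParam R l h Φ ψ) {z : ℂ} (hz : z ∈ Icc 0 l ×ℂ Icc 0 h) :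
    Tendsto Φ (𝓝[Ioo 0 l ×ℂ Ioo 0 h] z) (𝓝 (Φ z)) :=
  (H.cont z hz).tendsto.mono_left (nhdsWithin_mono _ (reProdIm_subset_iff'.2
    (Or.inl ⟨Ioo_subset_Icc_self, Ioo_subset_Icc_self⟩)))

/-- The boundary of the parametrizing rectangle is mapped to points outside `R`. -/
theorem mem_of_map_mem (H : q.IsRectParam R l h Φ ψ) {z : ℂ} (hz : z ∈ Icc 0 l ×ℂ Icc 0 h)
    (hzR : Φ z ∈ R) : z ∈ Ioo 0 l ×ℂ Ioo 0 h := by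
  have : (𝓝[Ioo 0 l ×ℂ Ioo 0 h] z).NeBot := mem_closure_iff_nhdsWithin_neBot.1 (H.mem_closure hz)
  have h1 : Tendsto (fun z => ψ (Φ z)) (𝓝[Ioo 0 l ×ℂ Ioo 0 h] z) (𝓝 (ψ (Φ z))) :=
    (ψ.continuousAt (H.source ▸ hzR)).tendsto.comp (H.tendsto hz)
  have h2 : Tendsto (fun z => ψ (Φ z)) (𝓝[Ioo 0 l ×ℂ Ioo 0 h] z) (𝓝 z) := by
    refine (tendsto_id'.2 nhdsWithin_le_nhds).congr' ?_
    filter_upwards [self_mem_nhdsWithin] with w hw using (H.right_inv hw).symm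
  rw [← tendsto_nhds_unique h1 h2]
  exact H.coord_mem hzR

end IsRectParam

namespace RectangularDecomposition

variable {n : ℕ} (D : RectangularDecomposition q n)

theorem mem_R_iff {x : X} :
    (∃ i, x ∈ D.R i) ↔ x ∉ D.verticalSegment ∪ D.horizontalSegments := by
  have key : ∀ S : Set X, range D.R = componentsOf S → ((∃ i, x ∈ D.R i) ↔ x ∈ S) := by
    intro S hS
    constructor
    · rintro ⟨i, hi⟩
      obtain ⟨y, -, hy⟩ : D.R i ∈ componentsOf S := hS ▸ mem_range_self i
      exact connectedComponentIn_subset S y (hy ▸ hi)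
    · intro hx
      obtain ⟨i, hi⟩ : connectedComponentIn S x ∈ range D.R := hS ▸ ⟨x, hx, rfl⟩
      exact ⟨i, hi ▸ mem_connectedComponentIn hx⟩
  exact key _ D.range_R_eq

theorem notMem_of_mem_R {x : X} {i : Fin n} (hx : x ∈ D.R i) :
    x ∉ D.verticalSegment ∧ x ∉ D.horizontalSegments := by
  have := D.mem_R_iff.1 ⟨i, hx⟩
  rwa [mem_union, not_or] at this

theorem R_eq_of_mem {x : X} {i j : Fin n} (hi : x ∈ D.R i) (hj : x ∈ D.R j) : i = j := by
  apply D.R_injective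
  have key : ∀ k, x ∈ D.R k → D.R k =
      connectedComponentIn (D.verticalSegment ∪ D.horizontalSegments)ᶜ x := by
    intro k hk
    obtain ⟨y, -, hy⟩ : D.R k ∈ componentsOf _ := D.range_R_eq ▸ mem_range_self k
    rw [hy]
    exact connectedComponentIn_eq (hy ▸ hk)
  rw [key i hi, key j hj]

/-- A boundary point off the drawn segments lies in some open rectangle, which then contains nearby
points of R_i and so equals R_i; but the boundary is not mapped into R_i. -/
theorem boundary_mem_drawn {i : Fin n} {l h : ℝ} {Φ : ℂ → X} {ψ : OpenPartialHomeomorph X ℂ}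
    (H : q.IsRectParam (D.R i) l h Φ ψ)
    (hopen : ∀ k, IsOpen (D.R k)) {z : ℂ} (hz : z ∈ Icc 0 l ×ℂ Icc 0 h)
    (hz' : z ∉ Ioo 0 l ×ℂ Ioo 0 h) : Φ z ∈ D.verticalSegment ∪ D.horizontalSegments := by
  by_contra hd
  obtain ⟨k, hk⟩ := D.mem_R_iff.2 hd
  have : (𝓝[Ioo 0 l ×ℂ Ioo 0 h] z).NeBot := mem_closure_iff_nhdsWithin_neBot.1 (H.mem_closure hz)
  obtain ⟨w, hw, hwr⟩ := (((H.tendsto hz).eventually ((hopen k).mem_nhds hk)).and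
    self_mem_nhdsWithin).exists
  obtain rfl := D.R_eq_of_mem hw (H.map_mem hwr)
  exact hz' (H.mem_of_map_mem hz hk)

theorem isOpen_R (k : Fin n) : IsOpen (D.R k) := by
  obtain ⟨Φ, ψ, H⟩ := (D.isRectangle k).exists_isRectParam
  exact H.isOpen

variable [IsManifold 𝓘(ℂ) ω X] {f : X ≃ₜ X} {lam : ℝ} {ψ : OpenPartialHomeomorph X ℂ}

/-- After rescaling, f⁻¹ ∘ β is again a vertical trajectory from a zero, and f⁻¹(J) lies on it. -/
theorem countable_re_preimage_vertical (hf : q.IsPseudoAnosov f lam)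
    (hψ : q.IsFlat ψ) :
    {x | ∃ p ∈ ψ.source, f p ∈ D.verticalSegment ∧ (ψ p).re = x}.Countable := by
  have hlam : 0 < lam := one_pos.trans hf.one_lt
  have htr := (hf.isFlatAffine.symm hlam).isTrajectory (stretchesBy_neg_one (inv_pos.2 hlam))
    D.vertical
  rw [inv_inv] at htr
  refine (htr.countable_re_of_isZero ?_ hψ).mono ?_
  · rw [zero_div, ← hf.zero_iff, f.apply_symm_apply]; exact D.start_zero
  · rintro x ⟨p, hp, ⟨t, ht, hpt⟩, rfl⟩
    have e : f.symm (D.β (lam * t / lam)) = p := by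
      rw [mul_div_cancel_left₀ _ hlam.ne', hpt, f.symm_apply_apply]
    have hT := D.Icc_b_subset ht
    exact ⟨lam * t, ⟨mul_nonneg hlam.le hT.1, mul_lt_mul_of_pos_left hT.2 hlam⟩, by rwa [e],
      by rw [e]⟩

variable [T2Space X] [CompactSpace X] [ConnectedSpace X]

/-- The identity f(g(t)) = g(λ t) keeps f(Γ) on the same finitely many separatrices that contain Γ.
-/
theorem countable_im_image_horizontal (hf : q.IsPseudoAnosov f lam)
    (hfix : q.FixesCriticalTrajectories f) (hψ : q.IsFlat ψ) :
    {y | ∃ p ∈ ψ.source, f.symm p ∈ D.horizontalSegments ∧ (ψ p).im = y}.Countable := by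
  have hlam : 0 < lam := one_pos.trans hf.one_lt
  obtain ⟨𝒢, h𝒢, hsep, hcov⟩ := D.exists_separatrices_covering hf hfix
  refine (countable_im_separatrices h𝒢.countable hsep hψ).mono ?_
  rintro y ⟨p, hp, hpΓ, rfl⟩
  obtain ⟨g, hg, t, ht, hgt⟩ := hcov _ hpΓ
  have e : g (lam * t) = p := by
    rw [← (hsep g hg).map hf hfix (mul_nonneg hlam.le ht), mul_div_cancel_left₀ _ hlam.ne', hgt,
      f.apply_symm_apply]
  exact ⟨g, hg, lam * t, mul_nonneg hlam.le ht, by rwa [e], by rw [e]⟩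

/-- The drawn segments have countably many abscissas and ordinates in a flat chart, so they miss a
point of it. At least one rectangle is needed for the eigenvectors to be nonzero. -/
theorem n_pos (D : RectangularDecomposition q n) (hf : q.IsPseudoAnosov f lam)
    (hfix : q.FixesCriticalTrajectories f) : 0 < n := by
  obtain ⟨p, hp⟩ := hf.nontrivial
  obtain ⟨ψ, hψ, hps⟩ := q.exists_isFlat hp
  obtain ⟨r, hr, hball⟩ := Metric.mem_nhds_iff.1 (ψ.open_target.mem_nhds (ψ.map_source hps))
  obtain ⟨𝒢, h𝒢, hsep, hcov⟩ := D.exists_separatrices_covering hf hfix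
  have c1 := D.vertical.countable_re_of_isZero D.start_zero hψ
  have c2 := countable_im_separatrices h𝒢.countable hsep hψ
  obtain ⟨x, hx, hx'⟩ := (c1.dense_compl ℝ).inter_open_nonempty _ isOpen_Ioo
    (nonempty_Ioo.2 (show (ψ p).re - r / 2 < (ψ p).re + r / 2 by linarith))
  obtain ⟨y, hy, hy'⟩ := (c2.dense_compl ℝ).inter_open_nonempty _ isOpen_Ioo
    (nonempty_Ioo.2 (show (ψ p).im - r / 2 < (ψ p).im + r / 2 by linarith))
  have hz : (⟨x, y⟩ : ℂ) ∈ ψ.target := by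
    refine hball ?_
    rw [Metric.mem_ball, dist_eq_norm]
    refine (Complex.norm_le_abs_re_add_abs_im _).trans_lt ?_
    have h1 : |x - (ψ p).re| < r / 2 := abs_lt.2 ⟨by linarith [hx.1], by linarith [hx.2]⟩
    have h2 : |y - (ψ p).im| < r / 2 := abs_lt.2 ⟨by linarith [hy.1], by linarith [hy.2]⟩
    simp only [sub_re, sub_im]; linarith
  have hs := ψ.map_target hz
  obtain ⟨i, -⟩ := (D.mem_R_iff (x := ψ.symm ⟨x, y⟩)).2 (by
    rintro (⟨t, ht, hpt⟩ | h)
    · exact hx' ⟨t, D.Icc_b_subset ht, by rwa [hpt], by rw [hpt, ψ.right_inv hz]⟩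
    · obtain ⟨g, hg, t, ht, hgt⟩ := hcov _ h
      exact hy' ⟨g, hg, t, ht, by rwa [hgt], by rw [hgt, ψ.right_inv hz]⟩)
  exact i.pos

end RectangularDecomposition

end QuadraticDifferential

/-! ### The shape of a crossing. -/

namespace QuadraticDifferential

variable {X : Type*} [TopologicalSpace X] [ChartedSpace ℂ X] {q : QuadraticDifferential X}
  {R R' : Set X} {l h l' h' : ℝ} {Φ Φ' : ℂ → X} {ψ ψ' : OpenPartialHomeomorph X ℂ}
  {f : X ≃ₜ X} {μ : ℝ}

theorem exists_germ (hf : q.IsFlatAffine f μ) (H : q.IsRectParam R l h Φ ψ)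
    (H' : q.IsRectParam R' l' h' Φ' ψ') {z₀ : ℂ} (hz₀ : z₀ ∈ Ioo 0 l ×ℂ Ioo 0 h)
    (hf₀ : f (Φ z₀) ∈ R') : ∃ a b c, |a| = μ ∧ |b| = μ⁻¹ ∧
      ∀ᶠ z in 𝓝 z₀, f (Φ z) = Φ' (diagAffine a b c z) ∧
        diagAffine a b c z ∈ Ioo 0 l' ×ℂ Ioo 0 h' := by
  have hm := H.map_mem hz₀
  obtain ⟨a, b, c, ha, hb, hev⟩ := hf.affine (Φ z₀) ψ ψ' H.flat H'.flat (H.source ▸ hm)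
    (H'.source ▸ hf₀)
  rw [H.right_inv hz₀, H.symm] at hev
  refine ⟨a, b, c, ha, hb, ?_⟩
  have hc : ContinuousAt Φ z₀ := by
    rw [← H.symm]; exact ψ.continuousAt_symm (H.target ▸ hz₀)
  filter_upwards [hev, (f.continuous.continuousAt.comp hc).preimage_mem_nhds
    (H'.isOpen.mem_nhds hf₀)] with z h1 h2
  have h2' : f (Φ z) ∈ R' := h2
  rw [← h1]
  exact ⟨(H'.left_inv h2').symm, H'.coord_mem h2'⟩

theorem eq_of_germs (H' : q.IsRectParam R' l' h' Φ' ψ') {a b a' b' : ℝ} {c c' z : ℂ}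
    (h1 : ∀ᶠ z in 𝓝 z, f (Φ z) = Φ' (diagAffine a b c z) ∧
      diagAffine a b c z ∈ Ioo 0 l' ×ℂ Ioo 0 h')
    (h2 : ∀ᶠ z in 𝓝 z, f (Φ z) = Φ' (diagAffine a' b' c' z) ∧
      diagAffine a' b' c' z ∈ Ioo 0 l' ×ℂ Ioo 0 h') : a = a' ∧ b = b' ∧ c = c' := by
  refine diagAffine_injective_of_eventuallyEq (z := z) ?_
  filter_upwards [h1, h2] with w hw hw'
  rw [← H'.right_inv hw.2, ← hw.1, hw'.1, H'.right_inv hw'.2]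

/-- The part of the rectangle which the affine map moves into the other rectangle. -/
def overlap (l h l' h' a b : ℝ) (c : ℂ) : Set ℂ :=
  {z | z ∈ Ioo 0 l ×ℂ Ioo 0 h ∧ diagAffine a b c z ∈ Ioo 0 l' ×ℂ Ioo 0 h'}

theorem isOpen_overlap (l h l' h' a b : ℝ) (c : ℂ) : IsOpen (overlap l h l' h' a b c) :=
  (isOpen_Ioo.reProdIm isOpen_Ioo).inter
    ((isOpen_Ioo.reProdIm isOpen_Ioo).preimage (continuous_diagAffine a b c))

/-- The points between a point of the closed overlap and a point of the overlap lie in the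
overlap. -/
theorem combo_mem_overlap {a b : ℝ} {c z w : ℂ} (hw : w ∈ overlap l h l' h' a b c)
    (hz : z ∈ Icc 0 l ×ℂ Icc 0 h) (hz' : diagAffine a b c z ∈ Icc 0 l' ×ℂ Icc 0 h') {t : ℝ}
    (ht : t ∈ Ioc (0 : ℝ) 1) : z + t * (w - z) ∈ overlap l h l' h' a b c := by
  have key : ∀ {m x y : ℝ}, x ∈ Icc 0 m → y ∈ Ioo 0 m → x + t * (y - x) ∈ Ioo 0 m := by
    intro m x y hx hy
    constructor
    · nlinarith [mul_pos ht.1 hy.1, mul_nonneg (sub_nonneg.2 ht.2) hx.1]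
    · nlinarith [mul_pos ht.1 (sub_pos.2 hy.2), mul_nonneg (sub_nonneg.2 ht.2) (sub_nonneg.2 hx.2)]
  obtain ⟨⟨h1, h2⟩, h3, h4⟩ := hw
  obtain ⟨h5, h6⟩ := hz
  obtain ⟨h7, h8⟩ := hz'
  simp only [mem_preimage, diagAffine_re, diagAffine_im] at h1 h2 h3 h4 h5 h6 h7 h8
  have e1 := key h5 h1
  have e2 := key h6 h2
  have e3 := key h7 h3
  have e4 := key h8 h4
  refine ⟨⟨?_, ?_⟩, ?_, ?_⟩
  · simpa using e1
  · simpa using e2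
  · simp only [mem_preimage, diagAffine_re]
    convert e3 using 1
    simp; ring
  · simp only [mem_preimage, diagAffine_im]
    convert e4 using 1
    simp; ring

theorem mem_closure_overlap {a b : ℝ} {c z w : ℂ} (hw : w ∈ overlap l h l' h' a b c)
    (hz : z ∈ Icc 0 l ×ℂ Icc 0 h) (hz' : diagAffine a b c z ∈ Icc 0 l' ×ℂ Icc 0 h') :
    z ∈ closure (overlap l h l' h' a b c) := by
  have ht : Tendsto (fun t : ℝ => z + t * (w - z)) (𝓝[>] 0) (𝓝 z) := by
    have : Continuous fun t : ℝ => z + t * (w - z) := by fun_prop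
    simpa using (this.tendsto 0).mono_left nhdsWithin_le_nhds
  refine mem_closure_of_tendsto ht ?_
  filter_upwards [Ioc_mem_nhdsGT (zero_lt_one' ℝ)] with t h1 using combo_mem_overlap hw hz hz' h1

theorem isPreconnected_overlap (l h l' h' a b : ℝ) (c : ℂ) :
    IsPreconnected (overlap l h l' h' a b c) := by
  have hsub : ∀ {m k : ℝ}, Ioo 0 m ×ℂ Ioo 0 k ⊆ Icc 0 m ×ℂ Icc 0 k := fun {m k} =>
    reProdIm_subset_iff'.2 (Or.inl ⟨Ioo_subset_Icc_self, Ioo_subset_Icc_self⟩)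
  refine (Convex.isPreconnected (s := overlap l h l' h' a b c) ?_)
  intro z hz w hw s t hs ht hst
  rcases eq_or_lt_of_le ht with rfl | ht0
  · obtain rfl : s = 1 := by linarith
    simpa using hz
  have := combo_mem_overlap hw (hsub hz.1) (hsub hz.2) (t := t) ⟨ht0, by linarith⟩
  convert this using 1
  obtain rfl : s = 1 - t := by linarith
  simp only [real_smul]; push_cast; ring

/-- The affine expression of `f` is valid on the whole overlap. -/
theorem germ_on_overlap [T2Space X] (hf : q.IsFlatAffine f μ) (H : q.IsRectParam R l h Φ ψ)
    (H' : q.IsRectParam R' l' h' Φ' ψ') {a b : ℝ} {c z₀ : ℂ} (hz₀ : z₀ ∈ Ioo 0 l ×ℂ Ioo 0 h)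
    (hgerm : ∀ᶠ z in 𝓝 z₀, f (Φ z) = Φ' (diagAffine a b c z) ∧
      diagAffine a b c z ∈ Ioo 0 l' ×ℂ Ioo 0 h') :
    ∀ z ∈ overlap l h l' h' a b c, ∀ᶠ w in 𝓝 z, f (Φ w) = Φ' (diagAffine a b c w) ∧
      diagAffine a b c w ∈ Ioo 0 l' ×ℂ Ioo 0 h' := by
  -- The germs where the formula holds form an open set. It is relatively closed because at a limit
  -- point `f` is again diagonal affine, and such maps coincide once they share a germ.
  refine (isPreconnected_overlap l h l' h' a b c).subset_of_closure_inter_subset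
    (u := {z | ∀ᶠ w in 𝓝 z, f (Φ w) = Φ' (diagAffine a b c w) ∧
      diagAffine a b c w ∈ Ioo 0 l' ×ℂ Ioo 0 h'}) isOpen_setOfPred_eventually_nhds
    ⟨z₀, ⟨hz₀, hgerm.self_of_nhds.2⟩, hgerm⟩ ?_
  rintro z ⟨hcl, hz, hz'⟩
  have hfr := mem_closure_iff_frequently.1 hcl
  have hc : ContinuousAt Φ z := by
    rw [← H.symm]; exact ψ.continuousAt_symm (H.target ▸ hz)
  have hc' : ContinuousAt Φ' (diagAffine a b c z) := by
    rw [← H'.symm]; exact ψ'.continuousAt_symm (H'.target ▸ hz')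
  have heq : f (Φ z) = Φ' (diagAffine a b c z) := tendsto_nhds_unique_of_frequently_eq
    (f.continuous.continuousAt.comp hc)
    (ContinuousAt.comp (g := Φ') hc' (continuous_diagAffine a b c).continuousAt)
    (hfr.mono fun w hw => hw.self_of_nhds.1)
  obtain ⟨a', b', c', -, -, hev⟩ := exists_germ hf H H' hz (by rw [heq]; exact H'.map_mem hz')
  obtain ⟨w, hw, hw'⟩ := (hfr.and_eventually hev.eventually_nhds).exists
  obtain ⟨rfl, rfl, rfl⟩ := eq_of_germs H' hw hw'
  exact hev

/-- Both parametrizations are continuous up to the sides, and a nonempty overlap is dense in its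
closed version. This gives access to the images of sides. -/
theorem eq_on_closed_overlap [T2Space X] (H : q.IsRectParam R l h Φ ψ)
    (H' : q.IsRectParam R' l' h' Φ' ψ') {a b : ℝ} {c w z : ℂ}
    (heq : ∀ z ∈ overlap l h l' h' a b c, f (Φ z) = Φ' (diagAffine a b c z))
    (hw : w ∈ overlap l h l' h' a b c) (hz : z ∈ Icc 0 l ×ℂ Icc 0 h)
    (hz' : diagAffine a b c z ∈ Icc 0 l' ×ℂ Icc 0 h') :
    f (Φ z) = Φ' (diagAffine a b c z) := by
  have hcl := mem_closure_overlap hw hz hz'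
  have : (𝓝[overlap l h l' h' a b c] z).NeBot := mem_closure_iff_nhdsWithin_neBot.1 hcl
  have l1 : Tendsto (fun z => f (Φ z)) (𝓝[overlap l h l' h' a b c] z) (𝓝 (f (Φ z))) :=
    (f.continuous.tendsto _).comp ((H.tendsto hz).mono_left (nhdsWithin_mono _ fun z hz => hz.1))
  have l2 : Tendsto (fun z => Φ' (diagAffine a b c z)) (𝓝[overlap l h l' h' a b c] z)
      (𝓝 (Φ' (diagAffine a b c z))) := by
    refine (H'.tendsto hz').comp (tendsto_nhdsWithin_iff.2 ⟨?_, ?_⟩)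
    · exact (continuous_diagAffine a b c).continuousAt.tendsto.mono_left nhdsWithin_le_nhds
    · filter_upwards [self_mem_nhdsWithin] with z hz using hz.2
  refine tendsto_nhds_unique l1 (l2.congr' ?_)
  filter_upwards [self_mem_nhdsWithin] with z hz using (heq z hz).symm

namespace RectangularDecomposition

variable {n : ℕ} (D : RectangularDecomposition q n) {lam : ℝ} {i j : Fin n}
  [T2Space X] [CompactSpace X] [ConnectedSpace X] [IsManifold 𝓘(ℂ) ω X]

/-- Each crossing of `R_j` by `f(R_i)` runs through the full length of `R_j`. -/
theorem crossing_full_length (hf : q.IsPseudoAnosov f lam) (hfix : q.FixesCriticalTrajectories f)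
    (H : q.IsRectParam (D.R i) l h Φ ψ) (H' : q.IsRectParam (D.R j) l' h' Φ' ψ') {a b : ℝ}
    (hb : b ≠ 0) {c w : ℂ}
    (heq : ∀ z ∈ overlap l h l' h' a b c, f (Φ z) = Φ' (diagAffine a b c z))
    (hw : w ∈ overlap l h l' h' a b c) {x : ℝ} (hx : a * x + c.re ∈ Ioo 0 l') : x ∈ Ioo 0 l := by
  by_contra hxl
  obtain ⟨⟨hw1, hw2⟩, hw3, hw4⟩ := hw
  simp only [mem_preimage, diagAffine_re, diagAffine_im] at hw1 hw2 hw3 hw4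
  have hconv : Convex ℝ {x : ℝ | a * x + c.re ∈ Ioo 0 l'} := by
    intro u hu v hv s t hs ht hst
    have := convex_Ioo 0 l' hu hv hs ht hst
    simp only [smul_eq_mul, mem_ofPred_eq] at this ⊢
    convert this using 1
    linear_combination -c.re * hst
  obtain ⟨y, hy, hyb⟩ : ∃ y, (y = 0 ∨ y = l) ∧ a * y + c.re ∈ Ioo 0 l' := by
    rw [mem_Ioo, not_and_or, not_lt, not_lt] at hxl
    rcases hxl with h | h
    · exact ⟨0, Or.inl rfl, hconv.ordConnected.out hx hw3 ⟨h, hw1.1.le⟩⟩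
    · exact ⟨l, Or.inr rfl, hconv.ordConnected.out hw3 hx ⟨hw1.2.le, h⟩⟩
  have hyI : y ∈ Icc 0 l ∧ y ∉ Ioo 0 l := by
    rcases hy with rfl | rfl <;> simp [H.l_pos.le]
  -- A crossing that is too short sends an open interval of the side x = `y` of R_i into R_j. Points
  -- of it in J are excluded by f(J) ⊆ J; the others lie in Γ, so their images have ordinates in a
  -- countable set.
  have hcount := (D.countable_im_image_horizontal hf hfix H'.flat)
  refine (hcount.preimage_of_injOn (f := fun v => b * v + c.im) (fun u _ v _ huv => ?_)
    ).false_of_isOpen (U := {v | v ∈ Ioo 0 h ∧ b * v + c.im ∈ Ioo 0 h'})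
    (isOpen_Ioo.inter (isOpen_Ioo.preimage (by fun_prop))) ⟨w.im, hw2, hw4⟩ ?_
  · exact mul_left_cancel₀ hb (add_right_cancel huv)
  rintro v ⟨hv, hv'⟩
  have hz : (⟨y, v⟩ : ℂ) ∈ Icc 0 l ×ℂ Icc 0 h := ⟨hyI.1, Ioo_subset_Icc_self hv⟩
  have hz' : diagAffine a b c ⟨y, v⟩ ∈ Ioo 0 l' ×ℂ Ioo 0 h' := ⟨hyb, hv'⟩
  have e := eq_on_closed_overlap H H' heq (w := w) ⟨⟨hw1, hw2⟩, hw3, hw4⟩ hz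
    ⟨Ioo_subset_Icc_self hz'.1, Ioo_subset_Icc_self hz'.2⟩
  have hR := H'.map_mem hz'
  rcases D.boundary_mem_drawn H D.isOpen_R hz (fun h => hyI.2 h.1) with hJ | hΓ
  · have := D.map_verticalSegment hf hfix hJ
    rw [e] at this
    exact absurd this (D.notMem_of_mem_R hR).1
  · refine ⟨_, H'.source ▸ hR, ?_, by rw [H'.right_inv hz']; rfl⟩
    rwa [← e, f.symm_apply_apply]

/-- Each crossing of `R_j` by `f(R_i)` has the full height of `f(R_i)`. -/
theorem crossing_full_height (hf : q.IsPseudoAnosov f lam) (hfix : q.FixesCriticalTrajectories f)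
    (H : q.IsRectParam (D.R i) l h Φ ψ) (H' : q.IsRectParam (D.R j) l' h' Φ' ψ') {a b : ℝ}
    {c w : ℂ}
    (heq : ∀ z ∈ overlap l h l' h' a b c, f (Φ z) = Φ' (diagAffine a b c z))
    (hw : w ∈ overlap l h l' h' a b c) {y : ℝ} (hy : y ∈ Ioo 0 h) : b * y + c.im ∈ Ioo 0 h' := by
  by_contra hyn
  obtain ⟨⟨hw1, hw2⟩, hw3, hw4⟩ := hw
  simp only [mem_preimage, diagAffine_re, diagAffine_im] at hw1 hw2 hw3 hw4
  have hord : OrdConnected ((fun y => b * y + c.im) '' Ioo 0 h) :=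
    (isPreconnected_Ioo.image _ (by fun_prop)).ordConnected
  -- By the intermediate value theorem some horizontal line inside R_i is sent to the line of a
  -- horizontal side of R_j. Side points in Γ are excluded by f⁻¹(Γ) ⊆ Γ; those in J give an
  -- interval of abscissas of f⁻¹(J), a countable set.
  obtain ⟨v, hv, hvb⟩ : ∃ v ∈ Ioo 0 h, b * v + c.im = 0 ∨ b * v + c.im = h' := by
    rw [mem_Ioo, not_and_or, not_lt, not_lt] at hyn
    rcases hyn with hle | hle
    · obtain ⟨v, hv, e⟩ := hord.out ⟨y, hy, rfl⟩ ⟨w.im, hw2, rfl⟩ ⟨hle, hw4.1.le⟩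
      exact ⟨v, hv, Or.inl e⟩
    · obtain ⟨v, hv, e⟩ := hord.out ⟨w.im, hw2, rfl⟩ ⟨y, hy, rfl⟩ ⟨hw4.2.le, hle⟩
      exact ⟨v, hv, Or.inr e⟩
  have hvI : b * v + c.im ∈ Icc 0 h' ∧ b * v + c.im ∉ Ioo 0 h' := by
    rcases hvb with e | e <;> rw [e] <;> simp [H'.h_pos.le]
  refine (D.countable_re_preimage_vertical hf H.flat).false_of_isOpen
    (U := {u | u ∈ Ioo 0 l ∧ a * u + c.re ∈ Ioo 0 l'})
    (isOpen_Ioo.inter (isOpen_Ioo.preimage (by fun_prop))) ⟨w.re, hw1, hw3⟩ ?_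
  rintro u ⟨hu, hu'⟩
  have hz : (⟨u, v⟩ : ℂ) ∈ Ioo 0 l ×ℂ Ioo 0 h := ⟨hu, hv⟩
  have hz' : diagAffine a b c ⟨u, v⟩ ∈ Icc 0 l' ×ℂ Icc 0 h' := ⟨Ioo_subset_Icc_self hu', hvI.1⟩
  have e := eq_on_closed_overlap H H' heq (w := w) ⟨⟨hw1, hw2⟩, hw3, hw4⟩
    ⟨Ioo_subset_Icc_self hz.1, Ioo_subset_Icc_self hz.2⟩ hz'
  have hR := H.map_mem hz
  refine ⟨_, H.source ▸ hR, ?_, by rw [H.right_inv hz]⟩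
  rcases D.boundary_mem_drawn H' D.isOpen_R hz' (fun h => hvI.2 h.2) with hJ | hΓ
  · rwa [e]
  · have := D.symm_horizontalSegments hf hfix hΓ
    rw [← e, f.symm_apply_apply] at this
    exact absurd this (D.notMem_of_mem_R hR).2

/-- A crossing of `R_j` by `f(R_i)` is a vertical strip of `R_i` and a horizontal strip of
`R_j`. -/
theorem exists_strips (hf : q.IsPseudoAnosov f lam) (hfix : q.FixesCriticalTrajectories f)
    (H : q.IsRectParam (D.R i) l h Φ ψ) (H' : q.IsRectParam (D.R j) l' h' Φ' ψ') {C : Set X}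
    (hC : C ∈ D.crossings f i j) :
    ∃ α d, Ioo α (α + l' / lam) ⊆ Ioo 0 l ∧ Ioo d (d + h / lam) ⊆ Ioo 0 h' ∧
      (∀ z ∈ Ioo 0 l ×ℂ Ioo 0 h, f (Φ z) ∈ C ↔ z.re ∈ Ioo α (α + l' / lam)) ∧
      (∀ z ∈ Ioo 0 l' ×ℂ Ioo 0 h', Φ' z ∈ C ↔ z.im ∈ Ioo d (d + h / lam)) := by
  have hlam : 0 < lam := one_pos.trans hf.one_lt
  obtain ⟨_, ⟨⟨x₀, hx₀, rfl⟩, hfx₀⟩, rfl⟩ := hC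
  set S := f '' D.R i ∩ D.R j with hS
  have hz₀ := H.coord_mem hx₀
  obtain ⟨a, b, c, ha, hb, hgerm⟩ := exists_germ hf.isFlatAffine H H' hz₀
    (by rwa [H.left_inv hx₀])
  have ha0 : a ≠ 0 := abs_pos.1 (ha ▸ hlam)
  have hb0 : b ≠ 0 := abs_pos.1 (hb ▸ inv_pos.2 hlam)
  have hw : ψ x₀ ∈ overlap l h l' h' a b c := ⟨hz₀, hgerm.self_of_nhds.2⟩
  have heq : ∀ z ∈ overlap l h l' h' a b c, f (Φ z) = Φ' (diagAffine a b c z) := fun z hz =>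
    (germ_on_overlap hf.isFlatAffine H H' hz₀ hgerm z hz).self_of_nhds.1
  have hlen : ∀ {x}, a * x + c.re ∈ Ioo 0 l' → x ∈ Ioo 0 l := fun hx =>
    D.crossing_full_length hf hfix H H' hb0 heq hw hx
  have hhei : ∀ {y}, y ∈ Ioo 0 h → b * y + c.im ∈ Ioo 0 h' := fun hy =>
    D.crossing_full_height hf hfix H H' heq hw hy
  have hΦc : ContinuousOn (fun z => f (Φ z)) (overlap l h l' h' a b c) := by
    refine f.continuous.comp_continuousOn ?_
    rw [← H.symm]
    exact ψ.continuousOn_symm.mono fun z hz => H.target ▸ hz.1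
  -- The image of the overlap is connected and open. It is also closed within the component, since
  -- the affine relation between the coordinates passes to limits.
  have hCeq : connectedComponentIn S (f x₀) = (fun z => f (Φ z)) '' overlap l h l' h' a b c := by
    refine Subset.antisymm ?_ ?_
    · refine isPreconnected_connectedComponentIn.subset_of_closure_inter_subset ?_
        ⟨f x₀, mem_connectedComponentIn ⟨⟨x₀, hx₀, rfl⟩, hfx₀⟩, ψ x₀, hw,
          by simp only [H.left_inv hx₀]⟩ ?_
      · rw [← image_image (g := f) (f := Φ), f.isOpen_image, ← H.symm]
        exact ψ.isOpen_image_symm_of_subset_target (isOpen_overlap _ _ _ _ _ _ _)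
          fun z hz => H.target ▸ hz.1
      · rintro p ⟨hcl, hpC⟩
        obtain ⟨⟨x, hx, rfl⟩, hfx⟩ := connectedComponentIn_subset _ _ hpC
        have hfr := mem_closure_iff_frequently.1 hcl
        have hlim : ψ' (f x) = diagAffine a b c (ψ (f.symm (f x))) := by
          refine tendsto_nhds_unique_of_frequently_eq (ψ'.continuousAt (H'.source ▸ hfx))
            (g := fun p => diagAffine a b c (ψ (f.symm p)))
            ((continuous_diagAffine a b c).continuousAt.comp (ContinuousAt.comp (g := ψ)
              (ψ.continuousAt ?_) f.symm.continuous.continuousAt)) (hfr.mono ?_)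
          · rw [f.symm_apply_apply]; exact H.source ▸ hx
          · rintro _ ⟨z, hz, rfl⟩
            simp only [f.symm_apply_apply]
            rw [H.right_inv hz.1, heq z hz, H'.right_inv hz.2]
        rw [f.symm_apply_apply] at hlim
        exact ⟨ψ x, ⟨H.coord_mem hx, hlim ▸ H'.coord_mem hfx⟩, by simp only [H.left_inv hx]⟩
    · refine ((isPreconnected_overlap l h l' h' a b c).image _ hΦc).subset_connectedComponentIn
        ⟨ψ x₀, hw, by simp only [H.left_inv hx₀]⟩ ?_
      rintro _ ⟨z, hz, rfl⟩
      exact ⟨⟨_, H.map_mem hz.1, rfl⟩, by simp only [heq z hz]; exact H'.map_mem hz.2⟩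
  obtain ⟨α, hα⟩ := exists_preimage_Ioo ha0 c.re l'
  -- The image of (0, h) under y ↦ b y + Im c is its preimage under the inverse map, whose slope has
  -- absolute value λ; hence the height h/λ.
  obtain ⟨d, hd⟩ := exists_preimage_Ioo (inv_ne_zero hb0) (-(b⁻¹ * c.im)) h
  rw [ha] at hα
  rw [abs_inv, hb, inv_inv] at hd
  have hinv : ∀ y, b⁻¹ * (b * y + c.im) + -(b⁻¹ * c.im) = y := fun y => by field_simp; ring
  have hinv' : ∀ y, b * (b⁻¹ * y + -(b⁻¹ * c.im)) + c.im = y := fun y => by field_simp; ring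
  refine ⟨α, d, fun x hx => hlen ((hα x).2 hx), fun y hy => ?_, fun z hz => ?_, fun z hz => ?_⟩
  · rw [← hinv' y]; exact hhei ((hd y).2 hy)
  · rw [hCeq, ← hα]
    constructor
    · rintro ⟨w, hw, hwz⟩
      have : w = z := by
        rw [← H.right_inv hw.1, f.injective hwz, H.right_inv hz]
      exact this ▸ hw.2.1
    · exact fun h1 => ⟨z, ⟨hz, h1, hhei hz.2⟩, rfl⟩
  · rw [hCeq, ← hd]
    constructor
    · rintro ⟨w, hw, hwz⟩
      have : diagAffine a b c w = z := by
        simp only [heq w hw] at hwz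
        rw [← H'.right_inv hw.2, hwz, H'.right_inv hz]
      rw [← this, diagAffine_im, hinv]
      exact hw.1.2
    · intro h1
      have hz1 : a * (a⁻¹ * (z.re - c.re)) + c.re = z.re := by field_simp; ring
      have e : diagAffine a b c ⟨a⁻¹ * (z.re - c.re), b⁻¹ * z.im + -(b⁻¹ * c.im)⟩ = z :=
        Complex.ext hz1 (hinv' _)
      have hov : (⟨a⁻¹ * (z.re - c.re), b⁻¹ * z.im + -(b⁻¹ * c.im)⟩ : ℂ) ∈
          overlap l h l' h' a b c := by
        refine ⟨⟨hlen ?_, h1⟩, by rw [e]; exact hz⟩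
        rw [hz1]; exact hz.1
      exact ⟨_, hov, by simp only [heq _ hov, e]⟩

end RectangularDecomposition

end QuadraticDifferential

/-! ### Counting strips and the leading eigenvalue. -/

theorem eq_sum_of_disjoint_Ioo {ι : Type*} [Fintype ι] {L : ℝ} (hL : 0 ≤ L) {α w : ι → ℝ}
    (hw : ∀ k, 0 ≤ w k) (hsub : ∀ k, Ioo (α k) (α k + w k) ⊆ Ioo 0 L)
    (hdisj : Pairwise fun k k' => Disjoint (Ioo (α k) (α k + w k)) (Ioo (α k') (α k' + w k')))
    (hcount : (Ioo 0 L \ ⋃ k, Ioo (α k) (α k + w k)).Countable) : L = ∑ k, w k := by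
  have h1 : MeasureTheory.volume (Ioo 0 L) =
      MeasureTheory.volume (⋃ k, Ioo (α k) (α k + w k)) := by
    refine le_antisymm ?_ (MeasureTheory.measure_mono (iUnion_subset hsub))
    rw [← sdiff_union_of_subset (iUnion_subset hsub)]
    refine (MeasureTheory.measure_union_le _ _).trans ?_
    rw [hcount.measure_zero, zero_add]
  rw [MeasureTheory.measure_iUnion hdisj fun k => measurableSet_Ioo] at h1
  simp only [Real.volume_Ioo, sub_zero, add_sub_cancel_left, tsum_fintype] at h1
  rw [← ENNReal.ofReal_sum_of_nonneg fun k _ => hw k] at h1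
  exact (ENNReal.ofReal_eq_ofReal_iff hL (Finset.sum_nonneg fun k _ => hw k)).1 h1

/-- Disjoint intervals of the same positive length in a bounded interval are finite in number. -/
theorem finite_of_disjoint_Ioo {ι : Type*} {L w : ℝ} (hw : 0 < w) {α : ι → ℝ}
    (hsub : ∀ k, Ioo (α k) (α k + w) ⊆ Ioo 0 L)
    (hdisj : Pairwise fun k k' => Disjoint (Ioo (α k) (α k + w)) (Ioo (α k') (α k' + w))) :
    Finite ι := by
  have := MeasureTheory.Measure.finite_const_le_meas_of_disjoint_iUnion MeasureTheory.volume
    (ENNReal.ofReal_pos.2 hw) (As := fun k => Ioo (α k) (α k + w)) (fun k => measurableSet_Ioo)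
    hdisj (ne_top_of_le_ne_top (by simp) (MeasureTheory.measure_mono (iUnion_subset hsub)))
  simp only [Real.volume_Ioo, add_sub_cancel_left, le_refl] at this
  exact Set.finite_univ_iff.1 this

theorem componentsOf_eq_of_mem {X : Type*} [TopologicalSpace X] {S C C' : Set X}
    (hC : C ∈ componentsOf S) (hC' : C' ∈ componentsOf S) {x : X} (hx : x ∈ C) (hx' : x ∈ C') :
    C = C' := by
  obtain ⟨y, -, rfl⟩ := hC
  obtain ⟨y', -, rfl⟩ := hC'
  rw [connectedComponentIn_eq hx, connectedComponentIn_eq hx']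

/-- Finiteness of the sigma type makes every `s k` finite, so `ncard` is a true count and not its
default value 0. -/
theorem sum_sigma_fst_eq_sum_ncard {ι α : Type*} [Fintype ι] (s : ι → Set α)
    [inst : Fintype (Σ k, s k)] (w : ι → ℝ) :
    ∑ p : Σ k, s k, w p.1 = ∑ k, ((s k).ncard : ℝ) * w k := by
  have : ∀ k, Finite (s k) := fun k => Finite.of_injective (fun C => (⟨k, C⟩ : Σ k, s k))
    fun C C' h => by simpa using h
  have : ∀ k, Fintype (s k) := fun k => Fintype.ofFinite _
  obtain rfl : inst = Sigma.instFintype := Subsingleton.elim _ _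
  rw [Fintype.sum_sigma]
  simp

/-- An eigenvalue of a nonnegative matrix with a positive eigenvector is the leading one. -/
theorem isLeadingEigenvalue_of_pos {n : ℕ} (hn : 0 < n) {A : Matrix (Fin n) (Fin n) ℕ} {r : ℝ}
    {l : Fin n → ℝ} (hl : ∀ i, 0 < l i) (hA : ∀ i, ∑ j, (A i j : ℝ) * l j = r * l i) :
    IsLeadingEigenvalue (A.map (fun a : ℕ => (a : ℂ))) r := by
  have : Nonempty (Fin n) := ⟨⟨0, hn⟩⟩
  constructor
  · refine Module.End.hasEigenvalue_of_hasEigenvector (x := fun i => (l i : ℂ)) ⟨?_, fun h => ?_⟩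
    · rw [Module.End.mem_eigenspace_iff]
      funext i
      simp only [Matrix.toLin'_apply, Matrix.mulVec, dotProduct, Matrix.map_apply, Pi.smul_apply,
        smul_eq_mul]
      exact_mod_cast congrArg Complex.ofReal (hA i)
    · have := congrFun h ⟨0, hn⟩
      exact (hl _).ne' (by simpa using this)
  · intro μ hμ
    obtain ⟨v, hv, hv0⟩ := hμ.exists_hasEigenvector
    rw [Module.End.mem_eigenspace_iff] at hv
    -- In the weighted norm max |v_i| / l_i the matrix has norm at most `r`; the eigenvalue equation
    -- is read off at an index where the maximum is attained.
    obtain ⟨i, -, hi⟩ := Finset.exists_max_image Finset.univ (fun i => ‖v i‖ / l i)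
      Finset.univ_nonempty
    set M := ‖v i‖ / l i with hM
    have hle : ∀ j, ‖v j‖ ≤ M * l j := fun j => (div_le_iff₀ (hl j)).1 (hi j (Finset.mem_univ j))
    have hMi : ‖v i‖ = M * l i := by rw [hM, div_mul_cancel₀ _ (hl i).ne']
    have hvi : 0 < M * l i := by
      obtain ⟨j, hj⟩ := Function.ne_iff.1 hv0
      have h1 : 0 < M * l j := (norm_pos_iff.2 hj).trans_le (hle j)
      exact mul_pos (pos_of_mul_pos_left h1 (hl j).le) (hl i)
    have hvi' := congrFun hv i
    simp only [Matrix.toLin'_apply, Matrix.mulVec, dotProduct, Matrix.map_apply, Pi.smul_apply,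
      smul_eq_mul] at hvi'
    have h1 : ‖μ‖ * ‖v i‖ ≤ r * (M * l i) := by
      rw [← norm_mul, ← hvi']
      calc ‖∑ j, (A i j : ℂ) * v j‖ ≤ ∑ j, ‖(A i j : ℂ) * v j‖ := norm_sum_le _ _
        _ ≤ ∑ j, M * ((A i j : ℝ) * l j) := Finset.sum_le_sum fun j _ => by
            rw [norm_mul, Complex.norm_natCast]
            have := mul_le_mul_of_nonneg_left (hle j) (Nat.cast_nonneg (α := ℝ) (A i j))
            linarith
        _ = r * (M * l i) := by rw [← Finset.mul_sum, hA]; ring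
    rw [hMi] at h1
    exact le_of_mul_le_mul_right h1 hvi

/-! ### The two eigenvector equations. -/

namespace QuadraticDifferential.RectangularDecomposition

variable {X : Type*} [TopologicalSpace X] [ChartedSpace ℂ X] {q : QuadraticDifferential X}
  {n : ℕ} {f : X ≃ₜ X} {lam : ℝ}

theorem subset_of_mem_crossings {D : RectangularDecomposition q n} {i j : Fin n} {C : Set X}
    (hC : C ∈ D.crossings f i j) : C ⊆ f '' D.R i ∩ D.R j := by
  obtain ⟨x, -, rfl⟩ := hC
  exact connectedComponentIn_subset _ _

theorem exists_crossing {D : RectangularDecomposition q n} {i j : Fin n} {x : X}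
    (hx : x ∈ f '' D.R i ∩ D.R j) : ∃ C ∈ D.crossings f i j, x ∈ C :=
  ⟨_, ⟨x, hx, rfl⟩, mem_connectedComponentIn hx⟩

variable (D : RectangularDecomposition q n) [T2Space X] [CompactSpace X] [ConnectedSpace X]
  [IsManifold 𝓘(ℂ) ω X]

/-- Distinct crossings give disjoint strips of the same width l_j/λ inside (0, l_i). -/
theorem finite_crossings (hf : q.IsPseudoAnosov f lam) (hfix : q.FixesCriticalTrajectories f)
    (i j : Fin n) : (D.crossings f i j).Finite := by
  have hlam : 0 < lam := one_pos.trans hf.one_lt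
  obtain ⟨Φ, ψ, H⟩ := (D.isRectangle i).exists_isRectParam
  obtain ⟨Φ', ψ', H'⟩ := (D.isRectangle j).exists_isRectParam
  choose α d hα hd hαC hdC using fun C : D.crossings f i j => D.exists_strips hf hfix H H' C.2
  refine Set.finite_coe_iff.1 (finite_of_disjoint_Ioo (div_pos H'.l_pos hlam) hα ?_)
  intro C C' hne
  refine Set.disjoint_left.2 fun x hx hx' => hne (Subtype.ext ?_)
  have hz : (⟨x, D.h i / 2⟩ : ℂ) ∈ Ioo 0 (D.l i) ×ℂ Ioo 0 (D.h i) :=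
    ⟨hα C hx, half_pos H.h_pos, half_lt_self H.h_pos⟩
  exact componentsOf_eq_of_mem C.2 C'.2 ((hαC C _ hz).2 hx) ((hαC C' _ hz).2 hx')

/-- Widths are compared on the middle horizontal line of R_i. A point of it off all strips is mapped
outside every rectangle, and not into Γ because f⁻¹(Γ) ⊆ Γ; so it lies in f⁻¹(J), which accounts for
countably many abscissas. -/
theorem sum_crossings_mul_l (hf : q.IsPseudoAnosov f lam) (hfix : q.FixesCriticalTrajectories f)
    (i : Fin n) : ∑ j, ((D.crossings f i j).ncard : ℝ) * D.l j = lam * D.l i := by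
  have hlam : 0 < lam := one_pos.trans hf.one_lt
  choose Φ ψ H using fun k => (D.isRectangle k).exists_isRectParam
  have hfin : ∀ j, Finite (D.crossings f i j) := fun j => D.finite_crossings hf hfix i j
  have : Fintype (Σ j, D.crossings f i j) := Fintype.ofFinite _
  choose α d hα hd hαC hdC using fun p : Σ j, D.crossings f i j =>
    D.exists_strips hf hfix (H i) (H p.1) p.2.2
  have hz : ∀ x ∈ Ioo 0 (D.l i), (⟨x, D.h i / 2⟩ : ℂ) ∈ Ioo 0 (D.l i) ×ℂ Ioo 0 (D.h i) :=
    fun x hx => ⟨hx, half_pos (H i).h_pos, half_lt_self (H i).h_pos⟩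
  have key := eq_sum_of_disjoint_Ioo (H i).l_pos.le
    (fun p : Σ j, D.crossings f i j => (div_pos (H p.1).l_pos hlam).le) hα ?_ ?_
  · rw [sum_sigma_fst_eq_sum_ncard (fun j => D.crossings f i j) fun j => D.l j / lam] at key
    rw [key, Finset.mul_sum]
    refine Finset.sum_congr rfl fun j _ => ?_
    field_simp
  · rintro ⟨j, C⟩ ⟨j', C'⟩ hne
    refine Set.disjoint_left.2 fun x hx hx' => hne ?_
    have m := (hαC _ _ (hz x (hα _ hx))).2 hx
    have m' := (hαC _ _ (hz x (hα _ hx'))).2 hx'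
    obtain rfl := D.R_eq_of_mem (subset_of_mem_crossings C.2 m).2
      (subset_of_mem_crossings C'.2 m').2
    rw [Subtype.ext (componentsOf_eq_of_mem C.2 C'.2 m m')]
  · refine (D.countable_re_preimage_vertical hf (H i).flat).mono ?_
    rintro x ⟨hx, hxn⟩
    have hR := (H i).map_mem (hz x hx)
    refine ⟨_, (H i).source ▸ hR, ?_, by rw [(H i).right_inv (hz x hx)]⟩
    by_contra hJ
    obtain ⟨j, hj⟩ := (D.mem_R_iff (x := f (Φ i ⟨x, D.h i / 2⟩))).2 (by
      rintro (h | h)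
      · exact hJ h
      · have := D.symm_horizontalSegments hf hfix h
        rw [f.symm_apply_apply] at this
        exact (D.notMem_of_mem_R hR).2 this)
    obtain ⟨C, hC, hxC⟩ := exists_crossing (f := f) (D := D) ⟨⟨_, hR, rfl⟩, hj⟩
    exact hxn (mem_iUnion.2 ⟨⟨j, C, hC⟩, (hαC ⟨j, C, hC⟩ _ (hz x hx)).1 hxC⟩)

/-- Heights are compared on the middle vertical line of R_j. A point of it off all strips has its
preimage outside every rectangle, and not in J because f(J) ⊆ J; so it lies in f(Γ), which accounts
for countably many ordinates. -/
theorem sum_crossings_mul_h (hf : q.IsPseudoAnosov f lam) (hfix : q.FixesCriticalTrajectories f)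
    (j : Fin n) : ∑ i, ((D.crossings f i j).ncard : ℝ) * D.h i = lam * D.h j := by
  have hlam : 0 < lam := one_pos.trans hf.one_lt
  choose Φ ψ H using fun k => (D.isRectangle k).exists_isRectParam
  have hfin : ∀ i, Finite (D.crossings f i j) := fun i => D.finite_crossings hf hfix i j
  have : Fintype (Σ i, D.crossings f i j) := Fintype.ofFinite _
  choose α d hα hd hαC hdC using fun p : Σ i, D.crossings f i j =>
    D.exists_strips hf hfix (H p.1) (H j) p.2.2
  have hz : ∀ y ∈ Ioo 0 (D.h j), (⟨D.l j / 2, y⟩ : ℂ) ∈ Ioo 0 (D.l j) ×ℂ Ioo 0 (D.h j) :=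
    fun y hy => ⟨⟨half_pos (H j).l_pos, half_lt_self (H j).l_pos⟩, hy⟩
  have key := eq_sum_of_disjoint_Ioo (H j).h_pos.le
    (fun p : Σ i, D.crossings f i j => (div_pos (H p.1).h_pos hlam).le) hd ?_ ?_
  · rw [sum_sigma_fst_eq_sum_ncard (fun i => D.crossings f i j) fun i => D.h i / lam] at key
    rw [key, Finset.mul_sum]
    refine Finset.sum_congr rfl fun i _ => ?_
    field_simp
  · rintro ⟨i, C⟩ ⟨i', C'⟩ hne
    refine Set.disjoint_left.2 fun y hy hy' => hne ?_
    have m := (hdC _ _ (hz y (hd _ hy))).2 hy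
    have m' := (hdC _ _ (hz y (hd _ hy'))).2 hy'
    obtain ⟨x, hx, hxe⟩ := (subset_of_mem_crossings C.2 m).1
    obtain ⟨x', hx', hxe'⟩ := (subset_of_mem_crossings C'.2 m').1
    obtain rfl := f.injective (hxe.trans hxe'.symm)
    obtain rfl := D.R_eq_of_mem hx hx'
    rw [Subtype.ext (componentsOf_eq_of_mem C.2 C'.2 m m')]
  · refine (D.countable_im_image_horizontal hf hfix (H j).flat).mono ?_
    rintro y ⟨hy, hyn⟩
    have hR := (H j).map_mem (hz y hy)
    refine ⟨_, (H j).source ▸ hR, ?_, by rw [(H j).right_inv (hz y hy)]⟩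
    by_contra hΓ
    obtain ⟨i, hi⟩ := (D.mem_R_iff (x := f.symm (Φ j ⟨D.l j / 2, y⟩))).2 (by
      rintro (h | h)
      · have := D.map_verticalSegment hf hfix h
        rw [f.apply_symm_apply] at this
        exact (D.notMem_of_mem_R hR).1 this
      · exact hΓ h)
    obtain ⟨C, hC, hyC⟩ := exists_crossing (f := f) (D := D)
      ⟨⟨_, hi, f.apply_symm_apply _⟩, hR⟩
    exact hyn (mem_iUnion.2 ⟨⟨i, C, hC⟩, (hdC ⟨i, C, hC⟩ _ (hz y hy)).1 hyC⟩)

end QuadraticDifferential.RectangularDecomposition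

theorem proposition1p1 {X : Type*} [TopologicalSpace X] [T2Space X] [CompactSpace X]
    [ConnectedSpace X] [ChartedSpace ℂ X] [IsManifold 𝓘(ℂ) ω X]
    (q : QuadraticDifferential X) (f : X ≃ₜ X) (lam : ℝ)
    (hf : q.IsPseudoAnosov f lam) (hfix : q.FixesCriticalTrajectories f)
    (n : ℕ) (D : q.RectangularDecomposition n) :
    (∀ i j, (D.crossings f i j).Finite) ∧
    IsLeadingEigenvalue ((D.crossingMatrix f).map (fun a : ℕ => (a : ℂ))) lam ∧
    Module.End.HasEigenvector
      (Matrix.toLin' ((D.crossingMatrix f).map (fun a : ℕ => (a : ℝ)))) lam D.l ∧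
    Module.End.HasEigenvector
      (Matrix.toLin' ((D.crossingMatrix f).map (fun a : ℕ => (a : ℝ)))ᵀ) lam D.h := by
  have hn := D.n_pos hf hfix
  refine ⟨D.finite_crossings hf hfix, isLeadingEigenvalue_of_pos hn (fun i => (D.isRectangle i).1)
    (D.sum_crossings_mul_l hf hfix), ⟨?_, fun h0 => ?_⟩, ⟨?_, fun h0 => ?_⟩⟩
  · rw [Module.End.mem_eigenspace_iff]
    funext i
    exact D.sum_crossings_mul_l hf hfix i
  · exact (D.isRectangle ⟨0, hn⟩).1.ne' (congrFun h0 _)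
  · rw [Module.End.mem_eigenspace_iff]
    funext j
    exact D.sum_crossings_mul_h hf hfix j
  · exact (D.isRectangle ⟨0, hn⟩).2.1.ne' (congrFun h0 _)
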